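/- **Setting.** Let $E$ be a real Hilbert space of finite even dimension $d$ (a Euclidean space), with a fixed orthonormal basis $e_1,\dots,e_d$ and corresponding coordinates $x_1,\dots,x_d$. Let $\mathrm{Cliff}_{\mathbb C}(E)$ be the universal unital complex algebra containing $E$ as a real subspace and subject to $x\cdot x=\|x\|^2$ for $x\in E$. It is a Hilbert space, with the ordered monomials $e_{i_1}\cdots e_{i_k}$ ($i_1<\dots<i_k$) as an orthonormal basis. Let $\mathcal L^2_E=L^2(E,\mathrm{Cliff}_{\mathbb C}(E))$ and let $\mathcal S_E\subset\mathcal L^2_E$ be the space of Schwartz functions. On $\mathcal S_E$ define $$(Cu)(y)=y\cdot u(y),\qquad (Du)(y)=\sum_{i=1}^d \hat e_i\,\frac{\partial u}{\partial x_i}(y),\qquad (c_xu)(y)=x\cdot u(y)\quad(x\in E),$$ where $\hat e_i(w)=(-1)^{\partial w}\,w\cdot e_i$ for homogeneous $w$. For $s\in[1,\infty)$ and $x\in E$, the Bott–Dirac operator is the unbounded operator $B_{s,x}=s^{-1}D+C-c_x$ on $\mathcal L^2_E$ with domain $\mathcal S_E$. For a bounded continuous function $\Psi:\mathbb R\to\mathbb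 R$, $\Psi(B_{s,x})$ is defined by the functional calculus of $B_{s,x}$, which is the unital $*$-homomorphism $\Phi:C_b(\mathbb R)\to\mathfrak B(\mathcal L^2_E)$ with $\Phi((t+i)^{-1})(B_{s,x}+i)u=u$ for all $u\in\mathcal S_E$, as $\Psi(B_{s,x})=\Phi(\Psi)$; and $F_{s,x}=B_{s,x}(1+B_{s,x}^2)^{-1/2}$, that is, $F_{s,x}=f(B_{s,x})$ with $f(t)=t/\sqrt{1+t^2}$. Write $\chi_A$ for multiplication by the characteristic function of a Borel set $A\subseteq E$, and $\chi_{x,R}=\chi_{B(x;R)}$, where $B(x;R)$ is the open ball. The propagation $\mathrm{prop}(T)$ of a bounded operator $T$ on $\mathcal L^2_E$ is the supremum of $\|y-x\|$ over all $(y,x)$ such that $\chi_V T\chi_U\neq0$ for all open neighbourhoods $U$ of $x$ and $V$ of $y$. **Proposition.** For each $\varepsilon>0$ there exist an odd continuous function $\Psi:\mathbb R\to[-1,1]$ with $\Psi(t)\to1$ as $t\to+\infty$, constants $R_0,c>0$, a constant $R_1=R_1(\varepsilon_1)>0$ for each $\varepsilon_1>0$, and a constant $R_2=R_2(\varepsilon_2,r)>0$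 for each $\varepsilon_2,r>0$, all independent of $E$ and of its dimension, such that for every Euclidean space $E$ of even dimension $d$ the functional calculus of each $B_{s,x}$ ($s\ge 1$, $x\in E$) exists and is unique (equivalently, $B_{s,x}$ is essentially self-adjoint), and the following hold. 1. For all $s\in[1,\infty)$ and $x\in E$: $\|F_{s,x}-\Psi(B_{s,x})\|<\varepsilon$. 2. For all $s\in[1,\infty)$ and $x\in E$: $\mathrm{prop}(\Psi(B_{s,x}))\le s^{-1}R_0$. 3. For all $s\in[1,\infty)$ and $x\in E$: $\Psi(B_{s,x})^2-1$ is compact. 4. For all $s\in[1,\infty)$ and $x,y\in E$: $\Psi(B_{s,x})-\Psi(B_{s,y})$ is compact. 5. For all $s\in[1,\infty)$ and $x,y\in E$: $\|F_{s,x}-F_{s,y}\|\le3\|x-y\|$ and $\|\Psi(B_{s,x})-\Psi(B_{s,y})\|\le c\|x-y\|$. 6. For all $x\in E$, the function $[1,\infty)\to\mathfrak B(\mathcal L^2_E)$, $s\mapsto\Psi(B_{s,x})$, is strong-$*$ continuous. 7. For every compact $K\subset[1,\infty)$, the functions $s\mapsto\Psi(B_{s,x})^2-1$, $x\in E$, are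 uniformly norm equicontinuous on $K$. 8. For every $r\ge0$ and every compact $K\subset[1,\infty)$, the functions $s\mapsto\Psi(B_{s,x})-\Psi(B_{s,y})$, $(x,y)\in E\times E$ with $\|x-y\|\le r$, are uniformly norm equicontinuous on $K$. 9. For every $\varepsilon_1>0$, all $R\ge R_1(\varepsilon_1)$, all $s\ge1$ with $s\ge2d$, and all $x\in E$: $\|(\Psi(B_{s,x})^2-1)(1-\chi_{x,R})\|<\varepsilon_1$. 10. For every $\varepsilon_2>0$ and $r>0$, all $R\ge R_2(\varepsilon_2,r)$, all $s\ge1$ with $s\ge2d$, and all $x,y\in E$ with $\|x-y\|\le r$: $\|(\Psi(B_{s,x})-\Psi(B_{s,y}))(1-\chi_{x,R})\|<\varepsilon_2$. -/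

import Mathlib

open MeasureTheory Filter Topology Module
open scoped SchwartzMap ENNReal TensorProduct BoundedContinuousFunction LineDeriv

noncomputable section

namespace BottDirac

/-! ### Functional calculus of an unbounded operator -/

section FunctionalCalculus

/-- A bounded continuous real function, regarded as a complex-valued one. -/
def complexify (ψ : ℝ →ᵇ ℝ) : ℝ →ᵇ ℂ :=
  BoundedContinuousFunction.ofNormedAddCommGroup (fun t => (ψ t : ℂ))
    (Complex.continuous_ofReal.comp ψ.continuous) ‖ψ‖
    (fun t => by simpa using ψ.norm_coe_le_norm t)

@[simp] theorem complexify_apply (ψ : ℝ →ᵇ ℝ) (t : ℝ) : complexify ψ t = (ψ t : ℂ) := rfl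

theorem ofReal_add_I_ne_zero (t : ℝ) : (t : ℂ) + Complex.I ≠ 0 := by
  intro h
  simpa using congrArg Complex.im h

/-- The function `t ↦ (t + i)⁻¹` on the real line. -/
def resolventFun : ℝ →ᵇ ℂ :=
  BoundedContinuousFunction.ofNormedAddCommGroup (fun t : ℝ => ((t : ℂ) + Complex.I)⁻¹)
    ((Complex.continuous_ofReal.add continuous_const).inv₀ ofReal_add_I_ne_zero) 1
    (fun t => by
      rw [norm_inv]
      refine inv_le_one_of_one_le₀ ?_
      simpa using Complex.abs_im_le_norm ((t : ℂ) + Complex.I))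

@[simp] theorem resolventFun_apply (t : ℝ) : resolventFun t = ((t : ℂ) + Complex.I)⁻¹ := rfl

variable {H : Type*} [NormedAddCommGroup H] [InnerProductSpace ℂ H] [CompleteSpace H]

/-- `Φ : C_b(ℝ) → 𝔅(H)` is a functional calculus for the unbounded operator `T`: it is a unital
`*`-homomorphism sending `t ↦ (t + i)⁻¹` to an operator that inverts `T + i` from the left.
A densely defined symmetric operator has such a `Φ` exactly when it has a self-adjoint extension
`A` (then `Φ ψ = ψ(A)`), and exactly one such `Φ` when it is essentially self-adjoint (then
`Φ ψ = ψ(closure of T)`). -/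
def IsFunctionalCalculus (T : H →ₗ.[ℂ] H) (Φ : (ℝ →ᵇ ℂ) →⋆ₐ[ℂ] (H →L[ℂ] H)) : Prop :=
  ∀ u : T.domain, Φ resolventFun (T u + Complex.I • (u : H)) = u

open Classical in
/-- The bounded operator `ψ(T)`, for a bounded continuous real function `ψ` and an (essentially
self-adjoint) unbounded operator `T`; the value is `0` if `T` does not have exactly one
functional calculus. -/
def funCalc (T : H →ₗ.[ℂ] H) (ψ : ℝ →ᵇ ℝ) : H →L[ℂ] H :=
  if h : ∃! Φ : (ℝ →ᵇ ℂ) →⋆ₐ[ℂ] (H →L[ℂ] H), IsFunctionalCalculus T Φ then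
    h.choose (complexify ψ)
  else 0

theorem funCalc_eq {T : H →ₗ.[ℂ] H} {Φ : (ℝ →ᵇ ℂ) →⋆ₐ[ℂ] (H →L[ℂ] H)}
    (hΦ : IsFunctionalCalculus T Φ) (huniq : ∀ Φ', IsFunctionalCalculus T Φ' → Φ' = Φ)
    (ψ : ℝ →ᵇ ℝ) : funCalc T ψ = Φ (complexify ψ) := by
  have h : ∃! Φ : (ℝ →ᵇ ℂ) →⋆ₐ[ℂ] (H →L[ℂ] H), IsFunctionalCalculus T Φ := ⟨Φ, hΦ, huniq⟩
  rw [funCalc, dif_pos h, huniq _ h.choose_spec.1]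

/-- The function `t ↦ t / √(1 + t²)`. -/
def boundedTransform : ℝ →ᵇ ℝ :=
  BoundedContinuousFunction.ofNormedAddCommGroup (fun t : ℝ => t / √(1 + t ^ 2))
    (continuous_id.div (by fun_prop) (fun t => by positivity)) 1
    (fun t => by
      rw [Real.norm_eq_abs, abs_div, abs_of_nonneg (Real.sqrt_nonneg _)]
      refine div_le_one_of_le₀ ?_ (Real.sqrt_nonneg _)
      exact Real.abs_le_sqrt (by linarith))

@[simp] theorem boundedTransform_apply (t : ℝ) : boundedTransform t = t / √(1 + t ^ 2) := rfl

end FunctionalCalculus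

/-! ### The complex Clifford algebra of a Euclidean space as a Hilbert space -/

section Clifford

variable (E : Type*) [NormedAddCommGroup E] [InnerProductSpace ℝ E]

/-- The quadratic form `x ↦ ‖x‖²`. -/
def normSqForm : QuadraticForm ℝ E := LinearMap.BilinMap.toQuadraticMap (innerₗ E)

variable {E} in
theorem normSqForm_apply (x : E) : normSqForm E x = ‖x‖ ^ 2 := by
  simp [normSqForm]

/-- The complex Clifford algebra `Cliff_ℂ(E)`. -/
def Cliff : Type _ := CliffordAlgebra ((normSqForm E).baseChange ℂ)

instance : Ring (Cliff E) := inferInstanceAs (Ring (CliffordAlgebra ((normSqForm E).baseChange ℂ)))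

instance : Algebra ℂ (Cliff E) :=
  inferInstanceAs (Algebra ℂ (CliffordAlgebra ((normSqForm E).baseChange ℂ)))

variable {E}

/-- The inclusion `E ⊆ Cliff_ℂ(E)`. -/
def cvec (x : E) : Cliff E := CliffordAlgebra.ι ((normSqForm E).baseChange ℂ) ((1 : ℂ) ⊗ₜ[ℝ] x)

theorem cvec_mul_self (x : E) : cvec x * cvec x = algebraMap ℂ (Cliff E) ((‖x‖ ^ 2 : ℝ) : ℂ) := by
  refine (CliffordAlgebra.ι_sq_scalar _ _).trans ?_
  rw [QuadraticForm.baseChange_tmul, normSqForm_apply]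
  simp
  rfl

theorem cvec_add (x y : E) : cvec (x + y) = cvec x + cvec y := by
  unfold cvec
  rw [TensorProduct.tmul_add, map_add]
  rfl

theorem cvec_smul (r : ℝ) (x : E) : cvec (r • x) = (r : ℂ) • cvec x := by
  have h : (1 : ℂ) ⊗ₜ[ℝ] (r • x) = (r : ℂ) • ((1 : ℂ) ⊗ₜ[ℝ] x) := by
    rw [TensorProduct.smul_tmul', ← TensorProduct.smul_tmul]
    simp
  unfold cvec
  rw [h, map_smul]
  rfl

/-- `w ↦ (-1)^{∂w} w` for homogeneous `w`. -/
def grade : Cliff E →ₐ[ℂ] Cliff E :=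
  CliffordAlgebra.involute (Q := (normSqForm E).baseChange ℂ)

theorem grade_cvec (x : E) : grade (cvec x) = -cvec x :=
  CliffordAlgebra.involute_ι (Q := (normSqForm E).baseChange ℂ) _

variable [FiniteDimensional ℝ E]

variable (E) in
/-- The fixed orthonormal basis `e₁, …, e_d` of `E`. -/
abbrev stdB : OrthonormalBasis (Fin (finrank ℝ E)) ℝ E := stdOrthonormalBasis ℝ E

/-- The monomial `e_{i₁} ⋯ e_{i_k}`, where `I = {i₁ < ⋯ < i_k}`. -/
def cliffMonomial (I : Finset (Fin (finrank ℝ E))) : Cliff E :=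
  (List.ofFn fun k : Fin I.card => cvec (stdB E (I.orderEmbOfFin rfl k))).prod

theorem associated_basis_eq_zero {i j : Fin (finrank ℝ E)} (hij : j ≠ i) :
    QuadraticMap.associated (R := ℂ) (-((normSqForm E).baseChange ℂ))
      ((1 : ℂ) ⊗ₜ[ℝ] stdB E j) ((1 : ℂ) ⊗ₜ[ℝ] stdB E i) = 0 := by
  have h : QuadraticMap.polar (normSqForm E) (stdB E j) (stdB E i) = 0 := by
    have h1 := norm_add_sq_real (stdB E j) (stdB E i)
    rw [(stdB E).orthonormal.2 hij] at h1
    simp only [QuadraticMap.polar, normSqForm_apply, h1]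
    ring
  rw [map_neg, LinearMap.neg_apply, LinearMap.neg_apply, QuadraticMap.associated_apply,
    ← TensorProduct.tmul_add]
  simp only [QuadraticForm.baseChange_tmul, one_mul, ← sub_smul]
  simp only [QuadraticMap.polar] at h
  rw [h]
  simp

/-- The canonical linear isomorphism with the exterior algebra sends Clifford monomials to the
exterior monomials; this is where orthogonality of the basis enters. -/
theorem equivExterior_prod (l : List (Fin (finrank ℝ E))) (hl : l.Nodup) :
    CliffordAlgebra.equivExterior ((normSqForm E).baseChange ℂ)
      ((l.map fun i => CliffordAlgebra.ι ((normSqForm E).baseChange ℂ)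
        ((1 : ℂ) ⊗ₜ[ℝ] stdB E i)).prod) =
      (l.map fun i => ExteriorAlgebra.ι ℂ ((1 : ℂ) ⊗ₜ[ℝ] stdB E i)).prod ∧
    ∀ j ∉ l, CliffordAlgebra.contractLeft (Q := (0 : QuadraticForm ℂ (ℂ ⊗[ℝ] E)))
      (QuadraticMap.associated (R := ℂ) (-((normSqForm E).baseChange ℂ))
        ((1 : ℂ) ⊗ₜ[ℝ] stdB E j))
      ((l.map fun i => ExteriorAlgebra.ι ℂ ((1 : ℂ) ⊗ₜ[ℝ] stdB E i)).prod) = 0 := by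
  induction l with
  | nil =>
    refine ⟨?_, fun j _ => ?_⟩
    · simp
    · simp only [List.map_nil, List.prod_nil]
      exact CliffordAlgebra.contractLeft_one (Q := (0 : QuadraticForm ℂ (ℂ ⊗[ℝ] E))) _
  | cons i l ih =>
    obtain ⟨h1, h2⟩ := ih (List.nodup_cons.1 hl).2
    have hi := (List.nodup_cons.1 hl).1
    refine ⟨?_, fun j hj => ?_⟩
    · rw [List.map_cons, List.prod_cons, List.map_cons, List.prod_cons]
      refine (CliffordAlgebra.changeForm_ι_mul
        CliffordAlgebra.changeForm.associated_neg_proof _ _).trans ?_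
      rw [CliffordAlgebra.equivExterior, CliffordAlgebra.changeFormEquiv_apply] at h1
      rw [h1, h2 i hi, sub_zero]
    · rw [List.mem_cons, not_or] at hj
      rw [List.map_cons, List.prod_cons]
      refine (CliffordAlgebra.contractLeft_ι_mul _ _ _).trans ?_
      rw [h2 j hj.2, associated_basis_eq_zero hj.1]
      simp

variable (E) in
/-- The canonical linear isomorphism between the Clifford and the exterior algebra. -/
def cliffEquivExterior : Cliff E ≃ₗ[ℂ] ExteriorAlgebra ℂ (ℂ ⊗[ℝ] E) :=
  CliffordAlgebra.equivExterior ((normSqForm E).baseChange ℂ)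

variable (E) in
/-- The basis of `Cliff_ℂ(E)` consisting of the monomials. -/
def cliffBasis : Basis (Finset (Fin (finrank ℝ E))) ℂ (Cliff E) :=
  ((Algebra.TensorProduct.basis ℂ (stdB E).toBasis).ExteriorAlgebra).map
    (cliffEquivExterior E).symm

theorem cliffBasis_apply (I : Finset (Fin (finrank ℝ E))) : cliffBasis E I = cliffMonomial I := by
  have hinj : Function.Injective fun k : Fin I.card => I.orderEmbOfFin rfl k :=
    (I.orderEmbOfFin rfl).injective
  have h := (equivExterior_prod (E := E) (List.ofFn fun k : Fin I.card => I.orderEmbOfFin rfl k)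
    (List.nodup_ofFn.2 hinj)).1
  rw [List.map_ofFn, List.map_ofFn] at h
  rw [cliffBasis, Basis.map_apply, LinearEquiv.symm_apply_eq]
  refine Eq.trans ?_ h.symm
  rw [ExteriorAlgebra.basis_apply]
  refine (ExteriorAlgebra.ιMulti_apply _).trans ?_
  congr 2
  funext k
  simp
  rfl

instance : Module.Finite ℂ (Cliff E) := Module.Finite.of_basis (cliffBasis E)

variable (E) in
/-- The coordinates of an element of `Cliff_ℂ(E)` with respect to the monomials. -/
def cliffCoord : Cliff E →ₗ[ℂ] EuclideanSpace ℂ (Finset (Fin (finrank ℝ E))) :=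
  (WithLp.linearEquiv 2 ℂ (Finset (Fin (finrank ℝ E)) → ℂ)).symm.toLinearMap ∘ₗ
    (cliffBasis E).equivFun.toLinearMap

theorem cliffCoord_injective : Function.Injective (cliffCoord E) :=
  (WithLp.linearEquiv 2 ℂ (Finset (Fin (finrank ℝ E)) → ℂ)).symm.injective.comp
    (cliffBasis E).equivFun.injective

/-- The Hilbert space structure of `Cliff_ℂ(E)`: the monomials form an orthonormal basis
(see `orthonormal_cliffMonomial`). -/
instance : NormedAddCommGroup (Cliff E) :=
  NormedAddCommGroup.induced (Cliff E) (EuclideanSpace ℂ (Finset (Fin (finrank ℝ E))))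
    (cliffCoord E) cliffCoord_injective

instance : InnerProductSpace ℂ (Cliff E) where
  __ := NormedSpace.induced ℂ (Cliff E) (EuclideanSpace ℂ (Finset (Fin (finrank ℝ E))))
    (cliffCoord E)
  inner a b := inner ℂ (cliffCoord E a) (cliffCoord E b)
  norm_sq_eq_re_inner a := norm_sq_eq_re_inner (𝕜 := ℂ) (cliffCoord E a)
  conj_inner_symm a b := inner_conj_symm (cliffCoord E a) (cliffCoord E b)
  add_left a b c := by rw [map_add, inner_add_left]
  smul_left a b r := by rw [map_smul, inner_smul_left]

instance : CompleteSpace (Cliff E) := FiniteDimensional.complete ℂ (Cliff E)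

theorem orthonormal_cliffMonomial :
    Orthonormal ℂ (cliffMonomial : Finset (Fin (finrank ℝ E)) → Cliff E) := by
  classical
  rw [orthonormal_iff_ite]
  intro I J
  rw [← cliffBasis_apply, ← cliffBasis_apply]
  change inner ℂ (cliffCoord E _) (cliffCoord E _) = _
  simp [cliffCoord, Finsupp.single_apply, PiLp.inner_apply, eq_comm]

theorem span_cliffMonomial :
    Submodule.span ℂ (Set.range (cliffMonomial : Finset (Fin (finrank ℝ E)) → Cliff E)) = ⊤ := by
  rw [← (cliffBasis E).span_eq]
  congr 1
  ext
  simp [cliffBasis_apply]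

variable (E) in
/-- The inclusion `E ⊆ Cliff_ℂ(E)` as a continuous real linear map. -/
def cvecL : E →L[ℝ] Cliff E :=
  LinearMap.toContinuousLinearMap
    { toFun := cvec
      map_add' := cvec_add
      map_smul' := cvec_smul }

@[simp] theorem cvecL_apply (x : E) : cvecL E x = cvec x := rfl

/-- Left Clifford multiplication `w ↦ x · w` on `Cliff_ℂ(E)`. -/
def leftMul (x : E) : Cliff E →L[ℂ] Cliff E :=
  LinearMap.toContinuousLinearMap (LinearMap.mulLeft ℂ (cvec x))

@[simp] theorem leftMul_apply (x : E) (w : Cliff E) : leftMul x w = cvec x * w := rfl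

/-- The operator `w ↦ (-1)^{∂w} w · x` on `Cliff_ℂ(E)`. -/
def hatMul (x : E) : Cliff E →L[ℂ] Cliff E :=
  LinearMap.toContinuousLinearMap (LinearMap.mulRight ℂ (cvec x) ∘ₗ grade.toLinearMap)

@[simp] theorem hatMul_apply (x : E) (w : Cliff E) : hatMul x w = grade w * cvec x := rfl

variable (E) in
/-- The bilinear map `(w, v) ↦ v * w` on `Cliff_ℂ(E)`. -/
def mulFlip : Cliff E →L[ℂ] Cliff E →L[ℂ] Cliff E :=
  LinearMap.toContinuousLinearMap
    (LinearMap.toContinuousLinearMap.toLinearMap ∘ₗ (LinearMap.mul ℂ (Cliff E)).flip)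

@[simp] theorem mulFlip_apply (w v : Cliff E) : mulFlip E w v = v * w := rfl

end Clifford

/-! ### The Bott-Dirac operators -/

section Operators

variable (E : Type*) [NormedAddCommGroup E] [InnerProductSpace ℝ E] [FiniteDimensional ℝ E]

/-- The Bott operator `(C u)(y) = y · u(y)` on Schwartz functions. -/
def bottOp : 𝓢(E, Cliff E) →ₗ[ℂ] 𝓢(E, Cliff E) :=
  (SchwartzMap.bilinLeftCLM (mulFlip E) (cvecL E).hasTemperateGrowth).toLinearMap

/-- The Dirac operator `D u = ∑ᵢ êᵢ · ∂u/∂xᵢ` on Schwartz functions. -/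
def diracOp : 𝓢(E, Cliff E) →ₗ[ℂ] 𝓢(E, Cliff E) :=
  ∑ i, (SchwartzMap.postcompCLM (hatMul (stdB E i))).toLinearMap ∘ₗ
    (LineDeriv.lineDerivOpCLM ℂ 𝓢(E, Cliff E) (stdB E i)).toLinearMap

variable {E}

/-- Left Clifford multiplication `c_x` by the fixed vector `x`, on Schwartz functions. -/
def cliffOp (x : E) : 𝓢(E, Cliff E) →ₗ[ℂ] 𝓢(E, Cliff E) :=
  (SchwartzMap.postcompCLM (leftMul x)).toLinearMap

@[simp] theorem bottOp_apply (u : 𝓢(E, Cliff E)) (y : E) : bottOp E u y = cvec y * u y := rfl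

@[simp] theorem diracOp_apply (u : 𝓢(E, Cliff E)) (y : E) :
    diracOp E u y = ∑ i, grade (fderiv ℝ u y (stdB E i)) * cvec (stdB E i) := by
  simp [diracOp, SchwartzMap.lineDerivOp_apply_eq_fderiv]

@[simp] theorem cliffOp_apply (x : E) (u : 𝓢(E, Cliff E)) (y : E) :
    cliffOp x u y = cvec x * u y := rfl

/-- `s⁻¹ D + C - c_x` on Schwartz functions. -/
def bottDiracSchwartz (s : ℝ) (x : E) : 𝓢(E, Cliff E) →ₗ[ℂ] 𝓢(E, Cliff E) :=
  ((s⁻¹ : ℝ) : ℂ) • diracOp E + bottOp E - cliffOp x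

variable [MeasurableSpace E] [BorelSpace E]

variable (E) in
/-- The Hilbert space `L²(E, Cliff_ℂ(E))`. -/
abbrev L2 : Type _ := Lp (Cliff E) 2 (volume : Measure E)

variable (E) in
/-- The inclusion of the Schwartz space into `L²(E, Cliff_ℂ(E))`. -/
def schwartzIncl : 𝓢(E, Cliff E) →ₗ[ℂ] L2 E :=
  (SchwartzMap.toLpCLM ℂ (Cliff E) 2 (volume : Measure E)).toLinearMap

theorem schwartzIncl_injective : Function.Injective (schwartzIncl E) :=
  SchwartzMap.injective_toLp 2 (volume : Measure E)

/-- The Bott-Dirac operator `B_{s,x} = s⁻¹ D + C - c_x`, an unbounded operator on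
`L²(E, Cliff_ℂ(E))` whose domain is the Schwartz space. -/
def bottDirac (s : ℝ) (x : E) : L2 E →ₗ.[ℂ] L2 E where
  domain := LinearMap.range (schwartzIncl E)
  toFun := schwartzIncl E ∘ₗ bottDiracSchwartz s x ∘ₗ
    (LinearEquiv.ofInjective (schwartzIncl E) schwartzIncl_injective).symm.toLinearMap

theorem bottDirac_apply (s : ℝ) (x : E) (u : 𝓢(E, Cliff E)) :
    bottDirac s x ⟨schwartzIncl E u, LinearMap.mem_range_self _ u⟩ =
      schwartzIncl E (bottDiracSchwartz s x u) := by
  change schwartzIncl E (bottDiracSchwartz s x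
    ((LinearEquiv.ofInjective (schwartzIncl E) schwartzIncl_injective).symm
      (LinearEquiv.ofInjective (schwartzIncl E) schwartzIncl_injective u))) = _
  rw [LinearEquiv.symm_apply_apply]

/-- `F_{s,x} = B_{s,x} (1 + B_{s,x}²)^{-1/2}`. -/
def boundedBottDirac (s : ℝ) (x : E) : L2 E →L[ℂ] L2 E :=
  funCalc (bottDirac s x) boundedTransform

/-! ### Characteristic functions, supports and propagation -/

theorem memLp_indicator {A : Set E} (hA : MeasurableSet A) (u : L2 E) :
    MemLp (A.indicator u) 2 (volume : Measure E) := (Lp.memLp u).indicator hA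

/-- Multiplication by the characteristic function of a Borel set `A`, as a bounded operator on
`L²(E, Cliff_ℂ(E))`. -/
def chi (A : Set E) (hA : MeasurableSet A) : L2 E →L[ℂ] L2 E :=
  LinearMap.mkContinuous
    { toFun := fun u => (memLp_indicator hA u).toLp _
      map_add' := fun u v => by
        rw [← MemLp.toLp_add, MemLp.toLp_eq_toLp_iff]
        filter_upwards [Lp.coeFn_add u v] with y hy
        by_cases h : y ∈ A
        · simp only [Pi.add_apply, Set.indicator_of_mem h]
          exact hy
        · simp [h]
      map_smul' := fun c u => by
        rw [RingHom.id_apply, ← MemLp.toLp_const_smul, MemLp.toLp_eq_toLp_iff]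
        filter_upwards [Lp.coeFn_smul c u] with y hy
        by_cases h : y ∈ A
        · simp only [Pi.smul_apply, Set.indicator_of_mem h]
          exact hy
        · simp [h] }
    1 (fun u => by
      rw [one_mul]
      refine Lp.norm_le_norm_of_ae_le ?_
      filter_upwards [MemLp.coeFn_toLp (memLp_indicator hA u)] with y hy
      change ‖(memLp_indicator hA u).toLp _ y‖ ≤ _
      rw [hy]
      exact norm_indicator_le_norm_self _ _)

theorem chi_ae {A : Set E} (hA : MeasurableSet A) (u : L2 E) :
    chi A hA u =ᵐ[volume] A.indicator u := MemLp.coeFn_toLp (memLp_indicator hA u)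

/-- `χ_{x,R}`, multiplication by the characteristic function of the open ball `B(x;R)`. -/
def chiBall (x : E) (R : ℝ) : L2 E →L[ℂ] L2 E := chi (Metric.ball x R) measurableSet_ball

/-- The support of a bounded operator `T`: the set of all `(y, x)` with `χ_V T χ_U ≠ 0` for all
(open) neighbourhoods `U` of `x` and `V` of `y`. -/
def opSupport (T : L2 E →L[ℂ] L2 E) : Set (E × E) :=
  {p | ∀ (U V : Set E) (hU : IsOpen U) (hV : IsOpen V), p.2 ∈ U → p.1 ∈ V →
    chi V hV.measurableSet ∘L T ∘L chi U hU.measurableSet ≠ 0}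

/-- The propagation of a bounded operator: the supremum of the distances `d(x, y)` over all
`(x, y)` in its support. -/
def propagation (T : L2 E →L[ℂ] L2 E) : ℝ≥0∞ := ⨆ p ∈ opSupport T, edist p.1 p.2

end Operators

end BottDirac

end

open BottDirac

/-!
The Bott-Dirac operator `B = s⁻¹ D + C - c_x` is a supersymmetric harmonic oscillator. With
`N = ∑ᵢ êᵢ eᵢ`, the anticommutator of `D` and `C - c_x`, its square is `H + s⁻¹ (N + d)`, where `H` is
a scalar harmonic oscillator, acting on the functions polynomial times Gaussian in a triangular way
with eigenvalues `2m/s` (`oscillator_sub_mem_ladder`). These functions are dense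
(`eq_zero_of_inner_ladder`) and are exhausted by finite-dimensional invariant subspaces of `B`, so `B`
has a dense set of finite sums of eigenvectors in its domain (`isDiagonal_bottDirac`). For such
diagonal operators the functional calculus is constructed by hand and shown to be unique
(`IsDiagonal.existsUnique_isFunctionalCalculus`), and growth of the eigenvalues of `H` gives compact
resolvent (`isCompactOperator_calculus_resolventFun`).

The function `Ψ` is the convolution of `f(t) = t / √(1 + t²)` with a Fejér kernel of small width `δ`
(`smoothed`). It is uniformly close to `f`, and `Ψ² - 1` and `Ψ - f` vanish at infinity. The Fejér
kernel has compactly supported Fourier transform, which by unit propagation speed gives `Ψ(B)`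
propagation at most `2 / (δ s)` (`propagation_calculus_smoothed_le`). Finite speed is not taken from a
wave equation: conjugating `B` by an exponential weight of slope `a` is a perturbation of norm `a / s`,
which bounds the resolvents on the imaginary axis, hence `exp (i τ B)` by the exponential formula,
between weighted norms (`norm_weight_calculus_expFun_le`); then `a → ∞`.

The dependence on the parameters rests on writing `f` as an integral of resolvents
(`truncatedTransform_eq_integral`), which turns the resolvent identity into two facts. First, `f` and
`Ψ` are operator Lipschitz with constant `1`, also in the relative sense that `(Ψ(A) - Ψ(A')) m(A')` is
bounded by the norm of `(A - A') m(A')` (`RelBound.norm_smoothed_sub_comp_calculus_le`). Second, for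
bounded perturbations `Ψ(A) - Ψ(A')` is small at high energies of `A'`, at a rate that depends only on
the size of the perturbation (`exists_norm_sub_comp_one_sub_cutoff_le`). At low energies, cut off by
`a² / (a² + t²)`, everything is compact, depends on `s` continuously in norm because `D` is bounded
relative to `B` (`relBound_left`), and decays away from `x`: the identity
`‖Bu‖² = s⁻² ‖Du‖² + ‖(C - c_x)u‖² + s⁻¹ ⟨u, Nu⟩` with `|N| ≤ d` shows that for `s ≥ 2d` the operator
`C - c_x` is bounded relative to `B` with a constant free of the dimension
(`norm_calculus_resolventFun_comp_le`). Combining the two energy ranges gives compactness,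
equicontinuity and uniform decay.
-/

noncomputable section

namespace BottDirac

/-! ### Diagonal operators and their functional calculus -/

section Spectral

variable {H : Type*} [NormedAddCommGroup H] [InnerProductSpace ℂ H]

/-- The span of the eigenvectors, with real eigenvalues, of an unbounded operator. -/
def eigenSpan (T : H →ₗ.[ℂ] H) : Submodule ℂ H :=
  Submodule.span ℂ {u : H | ∃ v : T.domain, (v : H) = u ∧ ∃ l : ℝ, T v = (l : ℂ) • u}

/-- A symmetric unbounded operator whose eigenvectors span a dense subspace. The eigenvectors have
to lie in the domain itself, so that such an operator is essentially self-adjoint. -/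
structure IsDiagonal (T : H →ₗ.[ℂ] H) : Prop where
  symm : ∀ u v : T.domain, inner ℂ (T u) (v : H) = inner ℂ (u : H) (T v)
  dense : (eigenSpan T).topologicalClosure = ⊤

/-- The closure of the space of eigenvectors with eigenvalue `l`. -/
def closedEigenspace (T : H →ₗ.[ℂ] H) (l : ℝ) : Submodule ℂ H :=
  (LinearMap.ker (T.toFun - (l : ℂ) • T.domain.subtype)).map T.domain.subtype |>.topologicalClosure

instance [CompleteSpace H] (T : H →ₗ.[ℂ] H) (l : ℝ) : CompleteSpace (closedEigenspace T l) :=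
  (Submodule.isClosed_topologicalClosure _).completeSpace_coe

theorem mem_closedEigenspace {T : H →ₗ.[ℂ] H} {l : ℝ} {v : T.domain}
    (hv : T v = (l : ℂ) • (v : H)) : (v : H) ∈ closedEigenspace T l := by
  refine Submodule.le_topologicalClosure _ ⟨v, ?_, rfl⟩
  simp only [SetLike.mem_coe, LinearMap.mem_ker, LinearMap.sub_apply, LinearMap.smul_apply,
    Submodule.subtype_apply, sub_eq_zero]
  exact hv

/-- To prove a closed condition on a closed eigenspace, eigenvectors suffice. -/
theorem closedEigenspace_induction {T : H →ₗ.[ℂ] H} {l : ℝ} {p : H → Prop}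
    (hp : IsClosed {w | p w}) (h : ∀ v : T.domain, T v = (l : ℂ) • (v : H) → p v)
    {w : H} (hw : w ∈ closedEigenspace T l) : p w := by
  have : (closedEigenspace T l : Set H) ⊆ {w | p w} := by
    rw [closedEigenspace, Submodule.topologicalClosure_coe]
    refine closure_minimal ?_ hp
    rintro _ ⟨v, hv, rfl⟩
    refine h v ?_
    simpa [sub_eq_zero] using hv
  exact this hw

namespace IsDiagonal

variable {T : H →ₗ.[ℂ] H}

theorem inner_apply_eq (hT : IsDiagonal T) {l : ℝ} {w : H} (hw : w ∈ closedEigenspace T l)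
    (u : T.domain) : inner ℂ w (T u) = (l : ℂ) * inner ℂ w (u : H) := by
  refine closedEigenspace_induction (p := fun w => inner ℂ w (T u) = (l : ℂ) * inner ℂ w (u : H))
    (isClosed_eq (by fun_prop) (by fun_prop)) (fun v hv => ?_) hw
  rw [← hT.symm, hv, inner_smul_left, Complex.conj_ofReal]

theorem orthogonalFamily (hT : IsDiagonal T) : OrthogonalFamily ℂ (fun l => closedEigenspace T l)
    fun l => (closedEigenspace T l).subtypeₗᵢ := by
  intro l m hlm w w'
  change inner ℂ (w : H) (w' : H) = 0
  refine closedEigenspace_induction (p := fun w' => inner ℂ (w : H) w' = 0)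
    (isClosed_eq (by fun_prop) (by fun_prop)) (fun v hv => ?_) w'.2
  have h := hT.inner_apply_eq w.2 v
  rw [hv, inner_smul_right] at h
  have h2 : ((m : ℂ) - l) * inner ℂ (w : H) (v : H) = 0 := by rw [sub_mul, h, sub_self]
  rcases mul_eq_zero.1 h2 with h3 | h3
  · exact absurd (by exact_mod_cast (sub_eq_zero.1 h3).symm) hlm
  · exact h3

theorem dense_eigenSpan (hT : IsDiagonal T) : Dense (eigenSpan T : Set H) := by
  rw [dense_iff_closure_eq, ← Submodule.topologicalClosure_coe, hT.dense, Submodule.top_coe]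

theorem ext_inner (hT : IsDiagonal T) {a b : H}
    (h : ∀ l, ∀ w ∈ closedEigenspace T l, inner ℂ w a = inner ℂ w b) : a = b := by
  refine hT.dense_eigenSpan.eq_of_inner_right ℂ fun v hv => ?_
  induction hv using Submodule.span_induction with
  | mem v hv =>
    obtain ⟨v, rfl, l, hl⟩ := hv
    exact h l v (mem_closedEigenspace hl)
  | zero => simp
  | add x y _ _ hx hy => rw [inner_add_left, inner_add_left, hx, hy]
  | smul c x _ hx => rw [inner_smul_left, inner_smul_left, hx]

variable [CompleteSpace H]

theorem isHilbertSum (hT : IsDiagonal T) : IsHilbertSum ℂ (fun l => closedEigenspace T l)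
    fun l => (closedEigenspace T l).subtypeₗᵢ := by
  refine IsHilbertSum.mkInternal _ hT.orthogonalFamily ?_
  rw [← hT.dense]
  refine Submodule.topologicalClosure_mono (Submodule.span_le.2 ?_)
  rintro _ ⟨v, rfl, l, hv⟩
  exact Submodule.mem_iSup_of_mem l (mem_closedEigenspace hv)

end IsDiagonal

section Multiplier

variable {G : ℝ → Type*} [∀ l, NormedAddCommGroup (G l)] [∀ l, InnerProductSpace ℂ (G l)]

theorem norm_smul_apply_le (ψ : ℝ →ᵇ ℂ) (f : lp G 2) (l : ℝ) :
    ‖ψ l • f l‖ ≤ ‖((‖ψ‖ : ℂ) • f : lp G 2) l‖ := by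
  rw [lp.coeFn_smul, Pi.smul_apply, norm_smul, norm_smul, Complex.norm_real, norm_norm]
  gcongr
  exact ψ.norm_coe_le_norm l

/-- Multiplication by a bounded function on a Hilbert sum indexed by the reals. -/
def lpMul (ψ : ℝ →ᵇ ℂ) : lp G 2 →L[ℂ] lp G 2 :=
  LinearMap.mkContinuous
    { toFun := fun f => ⟨fun l => ψ l • f l,
        (lp.memℓp ((‖ψ‖ : ℂ) • f)).mono' (norm_smul_apply_le ψ f)⟩
      map_add' := fun f g => Subtype.ext (funext fun l => smul_add (ψ l) (f l) (g l))
      map_smul' := fun c f => Subtype.ext (funext fun l => smul_comm (ψ l) c (f l)) }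
    ‖ψ‖ (fun f => by
      refine (lp.norm_mono (by simp) (norm_smul_apply_le ψ f)).trans ?_
      rw [norm_smul, Complex.norm_real, norm_norm])

@[simp] theorem lpMul_apply (ψ : ℝ →ᵇ ℂ) (f : lp G 2) (l : ℝ) : lpMul ψ f l = ψ l • f l := rfl

/-- The operator on a Hilbert sum, indexed by the reals, that multiplies the summand with index `l`
by `ψ l`. -/
def hilbertSumMul [CompleteSpace H] {V : ∀ l, G l →ₗᵢ[ℂ] H} (hV : IsHilbertSum ℂ G V)
    (ψ : ℝ →ᵇ ℂ) : H →L[ℂ] H :=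
  (hV.linearIsometryEquiv.symm.toContinuousLinearEquiv : lp G 2 →L[ℂ] H) ∘L lpMul ψ ∘L
    (hV.linearIsometryEquiv.toContinuousLinearEquiv : H →L[ℂ] lp G 2)

theorem inner_hilbertSumMul [CompleteSpace H] {V : ∀ l, G l →ₗᵢ[ℂ] H} (hV : IsHilbertSum ℂ G V)
    (ψ : ℝ →ᵇ ℂ) {l : ℝ} (w : G l) (u : H) :
    inner ℂ (V l w) (hilbertSumMul hV ψ u) = ψ l * inner ℂ (V l w) u := by
  classical
  have h : ∀ x : H, inner ℂ (V l w) x = inner ℂ w (hV.linearIsometryEquiv x l) := fun x => by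
    rw [← lp.inner_single_left, ← hV.linearIsometryEquiv.symm.inner_map_map,
      IsHilbertSum.linearIsometryEquiv_symm_apply_single, LinearIsometryEquiv.symm_apply_apply]
  have h2 : hV.linearIsometryEquiv (hilbertSumMul hV ψ u) = lpMul ψ (hV.linearIsometryEquiv u) :=
    hV.linearIsometryEquiv.apply_symm_apply _
  rw [h, h, h2, lpMul_apply, inner_smul_right]

end Multiplier

namespace IsDiagonal

variable {T : H →ₗ.[ℂ] H} [CompleteSpace H]

/-- `ψ(T)` for a diagonal operator `T`: on the Hilbert sum of the closed eigenspaces it is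
multiplication by `ψ`. -/
def calculusFun (hT : IsDiagonal T) (ψ : ℝ →ᵇ ℂ) : H →L[ℂ] H := hilbertSumMul hT.isHilbertSum ψ

theorem inner_calculusFun (hT : IsDiagonal T) {l : ℝ} {w : H} (hw : w ∈ closedEigenspace T l)
    (ψ : ℝ →ᵇ ℂ) (u : H) : inner ℂ w (hT.calculusFun ψ u) = ψ l * inner ℂ w u :=
  inner_hilbertSumMul hT.isHilbertSum ψ ⟨w, hw⟩ u

/-- The functional calculus of a diagonal operator. -/
def calculus (hT : IsDiagonal T) : (ℝ →ᵇ ℂ) →⋆ₐ[ℂ] (H →L[ℂ] H) where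
  toFun := hT.calculusFun
  map_one' := ContinuousLinearMap.ext fun u => hT.ext_inner fun l w hw => by
    simp [inner_calculusFun hT hw]
  map_mul' ψ φ := ContinuousLinearMap.ext fun u => hT.ext_inner fun l w hw => by
    simp [inner_calculusFun hT hw, mul_assoc]
  map_zero' := ContinuousLinearMap.ext fun u => hT.ext_inner fun l w hw => by
    simp [inner_calculusFun hT hw]
  map_add' ψ φ := ContinuousLinearMap.ext fun u => hT.ext_inner fun l w hw => by
    simp [inner_calculusFun hT hw, add_mul]
  commutes' c := ContinuousLinearMap.ext fun u => hT.ext_inner fun l w hw => by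
    simp [inner_calculusFun hT hw, Algebra.algebraMap_eq_smul_one]
  map_star' ψ := by
    rw [ContinuousLinearMap.star_eq_adjoint]
    refine ContinuousLinearMap.ext fun u => hT.ext_inner fun l w hw => ?_
    have h : hT.calculusFun ψ w = ψ l • w := hT.ext_inner fun m w' hw' => by
      rw [inner_calculusFun hT hw', inner_smul_right]
      rcases eq_or_ne m l with rfl | hml
      · rfl
      · have h0 : inner ℂ w' w = 0 := hT.orthogonalFamily hml ⟨w', hw'⟩ ⟨w, hw⟩
        rw [h0, mul_zero, mul_zero]
    rw [ContinuousLinearMap.adjoint_inner_right, h, inner_smul_left, inner_calculusFun hT hw]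
    rfl

theorem inner_calculus (hT : IsDiagonal T) {l : ℝ} {w : H} (hw : w ∈ closedEigenspace T l)
    (ψ : ℝ →ᵇ ℂ) (u : H) : inner ℂ w (hT.calculus ψ u) = ψ l * inner ℂ w u :=
  hT.inner_calculusFun hw ψ u

theorem isFunctionalCalculus_calculus (hT : IsDiagonal T) :
    IsFunctionalCalculus T hT.calculus := by
  intro u
  refine hT.ext_inner fun l w hw => ?_
  rw [inner_calculus hT hw, inner_add_right, inner_smul_right, hT.inner_apply_eq hw, ← add_mul,
    ← mul_assoc, resolventFun_apply, inv_mul_cancel₀ (ofReal_add_I_ne_zero l), one_mul]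

end IsDiagonal

/-- A function vanishing at `l` is uniformly approximated by multiples of
`t ↦ (t + i)⁻¹ - (l + i)⁻¹`. -/
theorem exists_approx_mul_resolventFun_sub {h : ℝ →ᵇ ℂ} {l : ℝ} (hl : h l = 0) {ε : ℝ}
    (hε : 0 < ε) : ∃ g : ℝ →ᵇ ℂ,
      ‖h - g * (resolventFun - algebraMap ℂ _ ((l : ℂ) + Complex.I)⁻¹)‖ ≤ ε := by
  set k : ℝ →ᵇ ℂ := resolventFun - algebraMap ℂ _ ((l : ℂ) + Complex.I)⁻¹ with hk
  have hkt : ∀ t : ℝ, k t = ((t : ℂ) + Complex.I)⁻¹ - ((l : ℂ) + Complex.I)⁻¹ := fun t => by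
    simp [hk, Algebra.algebraMap_eq_smul_one]
  obtain ⟨η, hη, hη'⟩ := Metric.continuousAt_iff.1 h.continuous.continuousAt ε hε
  set a : ℝ := ‖(l : ℂ) + Complex.I‖ with ha
  have ha0 : 0 < a := norm_pos_iff.2 (ofReal_add_I_ne_zero l)
  set c : ℝ := η / ((η + a) * a) with hc
  have hc0 : 0 < c := by positivity
  -- away from `l` the function `k` is bounded below
  have hkc : ∀ t : ℝ, η ≤ |t - l| → c ≤ ‖k t‖ := by
    intro t ht
    have h1 : k t = ((l : ℂ) - t) / (((t : ℂ) + Complex.I) * ((l : ℂ) + Complex.I)) := by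
      rw [hkt, inv_sub_inv (ofReal_add_I_ne_zero t) (ofReal_add_I_ne_zero l)]
      ring
    have h2 : ‖(l : ℂ) - t‖ = |t - l| := by
      rw [← Complex.ofReal_sub, Complex.norm_real, Real.norm_eq_abs, abs_sub_comm]
    have h3 : ‖(t : ℂ) + Complex.I‖ ≤ |t - l| + a := by
      have : (t : ℂ) + Complex.I = -((l : ℂ) - t) + (l + Complex.I) := by ring
      rw [this]
      refine (norm_add_le _ _).trans ?_
      rw [norm_neg, h2]
    have h4 : 0 < ‖(t : ℂ) + Complex.I‖ := norm_pos_iff.2 (ofReal_add_I_ne_zero t)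
    rw [h1, norm_div, norm_mul, h2, hc, div_le_div_iff₀ (by positivity) (by positivity)]
    have h5 : η * ‖(t : ℂ) + Complex.I‖ ≤ |t - l| * (η + a) := by nlinarith
    nlinarith
  -- the bounded function `q = k̄ / (|k|² + δ)` is almost inverse to `k` away from `l`, and near `l`
  -- the function `h` is small
  set δ : ℝ := ε * c ^ 2 / (‖h‖ + 1) with hδ
  have hδ0 : 0 < δ := by positivity
  have hden : ∀ t, 0 < ‖k t‖ ^ 2 + δ := fun t => by positivity
  have hden' : ∀ t, ((‖k t‖ ^ 2 + δ : ℝ) : ℂ) ≠ 0 := fun t => by exact_mod_cast (hden t).ne'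
  have hcont : Continuous fun t : ℝ => (star (k t)) / ((‖k t‖ ^ 2 + δ : ℝ) : ℂ) :=
    Continuous.div (by fun_prop) (by fun_prop) hden'
  set q : ℝ →ᵇ ℂ := BoundedContinuousFunction.ofNormedAddCommGroup
    (fun t : ℝ => (star (k t)) / ((‖k t‖ ^ 2 + δ : ℝ) : ℂ)) hcont (‖k‖ / δ) (fun t => by
      rw [norm_div, norm_star, Complex.norm_real, Real.norm_of_nonneg (hden t).le]
      gcongr
      · exact k.norm_coe_le_norm t
      · nlinarith [sq_nonneg ‖k t‖])
  refine ⟨h * q, (BoundedContinuousFunction.norm_le hε.le).2 fun t => ?_⟩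
  have h1 : (h - h * q * k) t = h t * ((δ / (‖k t‖ ^ 2 + δ) : ℝ) : ℂ) := by
    have h2 : star (k t) * k t = ((‖k t‖ ^ 2 : ℝ) : ℂ) := by
      rw [mul_comm]
      exact_mod_cast Complex.mul_conj' (k t)
    have h3 : (h - h * q * k) t = h t - h t * (star (k t) * k t / ((‖k t‖ ^ 2 + δ : ℝ) : ℂ)) := by
      change h t - h t * (star (k t) / ((‖k t‖ ^ 2 + δ : ℝ) : ℂ)) * k t = _
      ring
    have h4 := hden' t
    rw [h3, h2, Complex.ofReal_div]
    field_simp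
    push_cast
    ring
  rw [h1, norm_mul, Complex.norm_real, Real.norm_of_nonneg (by have := hden t; positivity)]
  rcases lt_or_ge |t - l| η with ht | ht
  · have h5 : ‖h t‖ ≤ ε := by
      have := hη' (x := t) (by simpa [Real.dist_eq] using ht)
      rw [hl, dist_zero_right] at this
      exact this.le
    have h6 : δ / (‖k t‖ ^ 2 + δ) ≤ 1 := div_le_one_of_le₀ (by nlinarith [sq_nonneg ‖k t‖]) (hden t).le
    calc _ ≤ ε * 1 := by have := hden t; gcongr
      _ = ε := mul_one _
  · have h5 := hkc t ht
    have h6 : δ / (‖k t‖ ^ 2 + δ) ≤ δ / c ^ 2 := by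
      gcongr
      nlinarith
    calc _ ≤ ‖h‖ * (δ / c ^ 2) := by
          have := hden t
          gcongr
          exact h.norm_coe_le_norm t
      _ = ε * (‖h‖ / (‖h‖ + 1)) := by rw [hδ]; field_simp
      _ ≤ ε * 1 := by
          gcongr
          exact div_le_one_of_le₀ (by linarith) (by positivity)
      _ = ε := mul_one _

/-- Any functional calculus acts on eigenvectors as expected. -/
theorem IsFunctionalCalculus.apply_eigenvector [CompleteSpace H] {T : H →ₗ.[ℂ] H}
    {Φ : (ℝ →ᵇ ℂ) →⋆ₐ[ℂ] (H →L[ℂ] H)} (hΦ : IsFunctionalCalculus T Φ) {u : T.domain} {l : ℝ}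
    (hu : T u = (l : ℂ) • (u : H)) (ψ : ℝ →ᵇ ℂ) : Φ ψ u = ψ l • (u : H) := by
  have hr : Φ (resolventFun - algebraMap ℂ _ ((l : ℂ) + Complex.I)⁻¹) u = 0 := by
    have h := hΦ u
    rw [hu, ← add_smul, map_smul] at h
    rw [map_sub, AlgHomClass.commutes, sub_apply,
      Algebra.algebraMap_eq_smul_one, smul_apply,
      one_apply_eq_self, sub_eq_zero]
    nth_rw 2 [← h]
    rw [smul_smul, inv_mul_cancel₀ (ofReal_add_I_ne_zero l), one_smul]
  -- the functions vanishing at `l` form the closed ideal generated by `(t + i)⁻¹ - (l + i)⁻¹`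
  have key : ∀ h : ℝ →ᵇ ℂ, h l = 0 → Φ h u = 0 := by
    intro h hl
    refine norm_le_zero_iff.1 (le_of_forall_pos_le_add fun ε hε => ?_)
    obtain ⟨g, hg⟩ := exists_approx_mul_resolventFun_sub hl
      (show 0 < ε / (‖(u : H)‖ + 1) by positivity)
    have h1 : Φ h u = Φ (h - g * (resolventFun - algebraMap ℂ _ ((l : ℂ) + Complex.I)⁻¹)) u := by
      rw [map_sub, map_mul, sub_apply, mul_apply_eq_comp, hr,
        map_zero, sub_zero]
    rw [h1, zero_add]
    calc _ ≤ ‖Φ (h - g * (resolventFun - algebraMap ℂ _ ((l : ℂ) + Complex.I)⁻¹))‖ * ‖(u : H)‖ :=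
          ContinuousLinearMap.le_opNorm _ _
      _ ≤ ε / (‖(u : H)‖ + 1) * (‖(u : H)‖ + 1) := by
          gcongr
          · exact (NonUnitalStarAlgHom.norm_apply_le Φ _).trans hg
          · linarith
      _ = ε := by field_simp
  have h := key (ψ - algebraMap ℂ _ (ψ l)) (by simp [Algebra.algebraMap_eq_smul_one])
  rw [map_sub, AlgHomClass.commutes, sub_apply, sub_eq_zero,
    Algebra.algebraMap_eq_smul_one, smul_apply,
    one_apply_eq_self] at h
  exact h

namespace IsDiagonal

variable {T : H →ₗ.[ℂ] H}

theorem ext_eigenvector (hT : IsDiagonal T) {A B : H →L[ℂ] H}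
    (h : ∀ (u : T.domain) (l : ℝ), T u = (l : ℂ) • (u : H) → A u = B u) : A = B := by
  refine ContinuousLinearMap.ext fun u => ?_
  refine congrFun (Continuous.ext_on hT.dense_eigenSpan A.continuous B.continuous fun v hv => ?_) u
  exact LinearMap.eqOn_span (f := (A : H →ₗ[ℂ] H)) (g := (B : H →ₗ[ℂ] H))
    (by rintro _ ⟨v, rfl, l, hl⟩; exact h v l hl) hv

variable [CompleteSpace H]

theorem eq_calculus (hT : IsDiagonal T) {Φ : (ℝ →ᵇ ℂ) →⋆ₐ[ℂ] (H →L[ℂ] H)}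
    (hΦ : IsFunctionalCalculus T Φ) : Φ = hT.calculus :=
  StarAlgHom.ext fun ψ => hT.ext_eigenvector fun u l hu => by
    rw [hΦ.apply_eigenvector hu, hT.isFunctionalCalculus_calculus.apply_eigenvector hu]

theorem existsUnique_isFunctionalCalculus (hT : IsDiagonal T) :
    ∃! Φ : (ℝ →ᵇ ℂ) →⋆ₐ[ℂ] (H →L[ℂ] H), IsFunctionalCalculus T Φ :=
  ⟨_, hT.isFunctionalCalculus_calculus, fun _ h => hT.eq_calculus h⟩

theorem funCalc_eq_calculus (hT : IsDiagonal T) (ψ : ℝ →ᵇ ℝ) :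
    funCalc T ψ = hT.calculus (complexify ψ) :=
  funCalc_eq hT.isFunctionalCalculus_calculus (fun _ h => hT.eq_calculus h) ψ

end IsDiagonal

end Spectral

section Perturbation

variable {H : Type*} [NormedAddCommGroup H] [InnerProductSpace ℂ H]

theorem eigenSpan_le_domain (T : H →ₗ.[ℂ] H) : eigenSpan T ≤ T.domain := by
  refine Submodule.span_le.2 ?_
  rintro _ ⟨v, rfl, -⟩
  exact v.2

/-- An operator norm can be estimated on a dense subspace. -/
theorem opNorm_le_of_dense {S : Submodule ℂ H} (hS : Dense (S : Set H)) {A : H →L[ℂ] H} {C : ℝ}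
    (hC : 0 ≤ C) (h : ∀ u ∈ S, ‖A u‖ ≤ C * ‖u‖) : ‖A‖ ≤ C := by
  refine A.opNorm_le_bound hC fun u => ?_
  exact hS.induction (P := fun u => ‖A u‖ ≤ C * ‖u‖) h
    (isClosed_le (by fun_prop) (by fun_prop)) u

variable [CompleteSpace H]

namespace IsDiagonal

variable {T : H →ₗ.[ℂ] H}

theorem norm_calculus_le (hT : IsDiagonal T) (ψ : ℝ →ᵇ ℂ) : ‖hT.calculus ψ‖ ≤ ‖ψ‖ :=
  NonUnitalStarAlgHom.norm_apply_le hT.calculus ψ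

theorem calculus_eigenvector (hT : IsDiagonal T) {u : T.domain} {l : ℝ}
    (hu : T u = (l : ℂ) • (u : H)) (ψ : ℝ →ᵇ ℂ) : hT.calculus ψ u = ψ l • (u : H) :=
  hT.isFunctionalCalculus_calculus.apply_eigenvector hu ψ

theorem calculus_mem_eigenSpan (hT : IsDiagonal T) (ψ : ℝ →ᵇ ℂ) {u : H} (hu : u ∈ eigenSpan T) :
    hT.calculus ψ u ∈ eigenSpan T := by
  induction hu using Submodule.span_induction with
  | mem v hv =>
    obtain ⟨v, rfl, l, hl⟩ := hv
    rw [hT.calculus_eigenvector hl]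
    exact Submodule.smul_mem _ _ (Submodule.subset_span ⟨v, rfl, l, hl⟩)
  | zero => simp
  | add x y _ _ hx hy => rw [map_add]; exact add_mem hx hy
  | smul c x _ hx => rw [map_smul]; exact Submodule.smul_mem _ _ hx

/-- Bounded pointwise convergence of functions gives strong convergence of operators. -/
theorem tendsto_calculus (hT : IsDiagonal T) {ψs : ℕ → ℝ →ᵇ ℂ} {ψ : ℝ →ᵇ ℂ} {M : ℝ}
    (hM : ∀ n, ‖ψs n‖ ≤ M) (h : ∀ t, Tendsto (fun n => ψs n t) atTop (𝓝 (ψ t))) (u : H) :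
    Tendsto (fun n => hT.calculus (ψs n) u) atTop (𝓝 (hT.calculus ψ u)) := by
  have h1 : ∀ u ∈ eigenSpan T,
      Tendsto (fun n => hT.calculus (ψs n) u) atTop (𝓝 (hT.calculus ψ u)) := by
    intro u hu
    induction hu using Submodule.span_induction with
    | mem v hv =>
      obtain ⟨v, rfl, l, hl⟩ := hv
      simp only [hT.calculus_eigenvector hl]
      exact (h l).smul_const _
    | zero => simp
    | add x y _ _ hx hy => simpa only [map_add] using hx.add hy
    | smul c x _ hx => simpa only [map_smul] using hx.const_smul c
  have hM0 : 0 ≤ M := (norm_nonneg _).trans (hM 0)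
  rw [Metric.tendsto_atTop]
  intro ε hε
  set D := M + ‖ψ‖ + 1 with hD
  have hD0 : 0 < D := by positivity
  obtain ⟨v, hv, hvu⟩ := Metric.dense_iff.1 hT.dense_eigenSpan u (ε / (2 * D)) (by positivity)
  obtain ⟨N, hN⟩ := Metric.tendsto_atTop.1 (h1 v hvu) (ε / 2) (by positivity)
  refine ⟨N, fun n hn => ?_⟩
  have e1 : hT.calculus (ψs n) u - hT.calculus ψ u =
      (hT.calculus (ψs n) v - hT.calculus ψ v) +
        (hT.calculus (ψs n) (u - v) - hT.calculus ψ (u - v)) := by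
    simp only [map_sub]; abel
  have e2 : ‖u - v‖ < ε / (2 * D) := by rwa [mem_ball_iff_norm, norm_sub_rev] at hv
  have e3 : ‖hT.calculus (ψs n) (u - v) - hT.calculus ψ (u - v)‖ ≤ D * ‖u - v‖ := by
    refine (norm_sub_le _ _).trans ?_
    have e4 := (hT.calculus (ψs n)).le_of_opNorm_le ((hT.norm_calculus_le _).trans (hM n)) (u - v)
    have e5 := (hT.calculus ψ).le_of_opNorm_le (hT.norm_calculus_le _) (u - v)
    have := norm_nonneg (u - v)
    rw [hD]
    linarith
  rw [dist_eq_norm, e1]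
  have e6 := hN n hn
  rw [dist_eq_norm] at e6
  calc _ ≤ _ := norm_add_le _ _
    _ < ε / 2 + D * (ε / (2 * D)) := by
        refine add_lt_add_of_lt_of_le e6 (e3.trans ?_)
        gcongr
    _ = ε := by field_simp; norm_num

/-- If `ψ = ∫ k_ω dμ(ω)` pointwise, with an integrable bound for `‖k_ω‖`, then
`ψ(T) = ∫ k_ω(T) dμ(ω)` in the weak sense. -/
theorem inner_calculus_eq_integral (hT : IsDiagonal T) {Ω : Type*} [MeasurableSpace Ω]
    {μ : Measure Ω} {k : Ω → ℝ →ᵇ ℂ} {ψ : ℝ →ᵇ ℂ} {g : Ω → ℝ} (hg : Integrable g μ)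
    (hk : ∀ t, AEStronglyMeasurable (fun ω => k ω t) μ) (hkg : ∀ ω, ‖k ω‖ ≤ g ω)
    (hψ : ∀ t, ψ t = ∫ ω, k ω t ∂μ) (v u : H) :
    Integrable (fun ω => inner ℂ v (hT.calculus (k ω) u)) μ ∧
      inner ℂ v (hT.calculus ψ u) = ∫ ω, inner ℂ v (hT.calculus (k ω) u) ∂μ := by
  have hbd : ∀ u ω, ‖inner ℂ v (hT.calculus (k ω) u)‖ ≤ g ω * (‖v‖ * ‖u‖) := fun u ω => by
    have := (hT.calculus (k ω)).le_of_opNorm_le ((hT.norm_calculus_le _).trans (hkg ω)) u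
    calc _ ≤ ‖v‖ * ‖hT.calculus (k ω) u‖ := norm_inner_le_norm _ _
      _ ≤ ‖v‖ * (g ω * ‖u‖) := by gcongr
      _ = _ := by ring
  have h1 : ∀ u ∈ eigenSpan T, Integrable (fun ω => inner ℂ v (hT.calculus (k ω) u)) μ ∧
      inner ℂ v (hT.calculus ψ u) = ∫ ω, inner ℂ v (hT.calculus (k ω) u) ∂μ := by
    intro u hu
    induction hu using Submodule.span_induction with
    | mem v hv =>
      obtain ⟨v, rfl, l, hl⟩ := hv
      simp only [hT.calculus_eigenvector hl, inner_smul_right]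
      refine ⟨(hg.mono' (hk l) (Eventually.of_forall fun ω =>
        ((k ω).norm_coe_le_norm l).trans (hkg ω))).mul_const _, ?_⟩
      rw [integral_mul_const, hψ]
    | zero => simp
    | add x y _ _ hx hy =>
      simp only [map_add, inner_add_right]
      exact ⟨hx.1.add hy.1, by rw [integral_add hx.1 hy.1, hx.2, hy.2]⟩
    | smul c x _ hx =>
      simp only [map_smul, inner_smul_right]
      exact ⟨hx.1.const_mul c, by rw [integral_const_mul, hx.2]⟩
  obtain ⟨w, hwS, hw⟩ := mem_closure_iff_seq_limit.1 (hT.dense_eigenSpan u)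
  obtain ⟨C, hC⟩ := (Metric.isBounded_range_of_tendsto w hw).exists_norm_le
  have hlim : ∀ ω, Tendsto (fun n => inner ℂ v (hT.calculus (k ω) (w n))) atTop
      (𝓝 (inner ℂ v (hT.calculus (k ω) u))) := fun ω =>
    ((continuous_const.inner ((hT.calculus (k ω)).continuous)).tendsto u).comp hw
  have hmeas : AEStronglyMeasurable (fun ω => inner ℂ v (hT.calculus (k ω) u)) μ :=
    aestronglyMeasurable_of_tendsto_ae atTop (fun n => (h1 (w n) (hwS n)).1.1)
      (Eventually.of_forall hlim)
  refine ⟨(hg.mul_const _).mono' hmeas (Eventually.of_forall (hbd u)), ?_⟩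
  have l1 : Tendsto (fun n => inner ℂ v (hT.calculus ψ (w n))) atTop
      (𝓝 (inner ℂ v (hT.calculus ψ u))) :=
    ((continuous_const.inner ((hT.calculus ψ).continuous)).tendsto u).comp hw
  have l2 := tendsto_integral_of_dominated_convergence (μ := μ) (fun ω => g ω * (‖v‖ * C))
    (fun n => (h1 (w n) (hwS n)).1.1) (hg.mul_const _)
    (fun n => Eventually.of_forall fun ω => (hbd (w n) ω).trans (by
      have : 0 ≤ g ω := (norm_nonneg _).trans (hkg ω)
      gcongr
      exact hC _ ⟨n, rfl⟩)) (Eventually.of_forall hlim)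
  refine tendsto_nhds_unique l1 (l2.congr fun n => ((h1 (w n) (hwS n)).2).symm)

end IsDiagonal

/-! ### Resolvents of diagonal operators -/

theorem ofReal_sub_ne_zero {z : ℂ} (hz : z.im ≠ 0) (t : ℝ) : (t : ℂ) - z ≠ 0 := fun h =>
  hz (by simpa using congrArg Complex.im h)

theorem norm_inv_ofReal_sub_le {z : ℂ} (hz : z.im ≠ 0) (t : ℝ) :
    ‖((t : ℂ) - z)⁻¹‖ ≤ |z.im|⁻¹ := by
  rw [norm_inv]
  refine inv_anti₀ (abs_pos.2 hz) ?_
  simpa using Complex.abs_im_le_norm ((t : ℂ) - z)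

/-- The function `t ↦ (t - z)⁻¹` for a non-real number `z`. -/
def res (z : ℂ) (hz : z.im ≠ 0) : ℝ →ᵇ ℂ :=
  BoundedContinuousFunction.ofNormedAddCommGroup (fun t : ℝ => ((t : ℂ) - z)⁻¹)
    ((Complex.continuous_ofReal.sub continuous_const).inv₀ (ofReal_sub_ne_zero hz)) |z.im|⁻¹
    (norm_inv_ofReal_sub_le hz)

@[simp] theorem res_apply (z : ℂ) (hz : z.im ≠ 0) (t : ℝ) : res z hz t = ((t : ℂ) - z)⁻¹ := rfl

theorem norm_res_le (z : ℂ) (hz : z.im ≠ 0) : ‖res z hz‖ ≤ |z.im|⁻¹ :=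
  (BoundedContinuousFunction.norm_le (by positivity)).2 (norm_inv_ofReal_sub_le hz)

namespace IsDiagonal

variable {T : H →ₗ.[ℂ] H}

theorem calculus_res_apply (hT : IsDiagonal T) {z : ℂ} (hz : z.im ≠ 0) (u : T.domain) :
    hT.calculus (res z hz) (T u - z • (u : H)) = u := by
  refine hT.ext_inner fun l w hw => ?_
  rw [inner_calculus hT hw, inner_sub_right, inner_smul_right, hT.inner_apply_eq hw, ← sub_mul,
    ← mul_assoc, res_apply, inv_mul_cancel₀ (ofReal_sub_ne_zero hz l), one_mul]

theorem apply_calculus_res (hT : IsDiagonal T) {z : ℂ} (hz : z.im ≠ 0) {u : H} {v : T.domain}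
    (h : (v : H) = hT.calculus (res z hz) u) : T v - z • (v : H) = u := by
  refine hT.ext_inner fun l w hw => ?_
  rw [inner_sub_right, inner_smul_right, hT.inner_apply_eq hw, ← sub_mul, h, inner_calculus hT hw,
    ← mul_assoc, res_apply, mul_inv_cancel₀ (ofReal_sub_ne_zero hz l), one_mul]

end IsDiagonal

/-- The difference of two operators `A`, `A'`, with the domain of `A'` contained in that of `A`,
composed with `m(A')`, is bounded by `κ`. For `m = 1` this means that `A - A'` is bounded, for
`m(t) = (t + i)⁻¹` that it is bounded relative to `A'`. -/
structure RelBound (A A' : H →ₗ.[ℂ] H) (hA' : IsDiagonal A') (m : ℝ →ᵇ ℂ) (κ : ℝ) : Prop where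
  domain_le : A'.domain ≤ A.domain
  nonneg : 0 ≤ κ
  bound : ∀ u ∈ eigenSpan A', ∀ v : A'.domain, (v : H) = hA'.calculus m u →
    ‖A' v - A ⟨v, domain_le v.2⟩‖ ≤ κ * ‖u‖

/-- The resolvent identity `(A - z)⁻¹ - (A' - z)⁻¹ = (A - z)⁻¹ (A' - A) (A' - z)⁻¹` as an
estimate. -/
theorem RelBound.norm_res_sub_comp_le {A A' : H →ₗ.[ℂ] H} (hA : IsDiagonal A)
    {hA' : IsDiagonal A'} {m : ℝ →ᵇ ℂ} {κ : ℝ} (h : RelBound A A' hA' m κ) {z : ℂ}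
    (hz : z.im ≠ 0) {g p : ℝ →ᵇ ℂ} (hgp : res z hz * g = m * p) :
    ‖(hA.calculus (res z hz) - hA'.calculus (res z hz)) ∘L hA'.calculus g‖ ≤
      |z.im|⁻¹ * (κ * ‖p‖) := by
  have hκ := h.nonneg
  refine opNorm_le_of_dense hA'.dense_eigenSpan (by positivity) fun u hu => ?_
  have hp := hA'.calculus_mem_eigenSpan p hu
  have hmem : hA'.calculus (res z hz) (hA'.calculus g u) ∈ A'.domain :=
    eigenSpan_le_domain _ (hA'.calculus_mem_eigenSpan _ (hA'.calculus_mem_eigenSpan _ hu))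
  set w : A'.domain := ⟨_, hmem⟩ with hw
  have hw1 : (w : H) = hA'.calculus m (hA'.calculus p u) := by
    change hA'.calculus (res z hz) (hA'.calculus g u) = _
    rw [← mul_apply_eq_comp, ← mul_apply_eq_comp, ← map_mul, ← map_mul, hgp]
  have hw2 : A' w - z • (w : H) = hA'.calculus g u := hA'.apply_calculus_res hz rfl
  have hb := h.bound _ hp w hw1
  have e1 : (hA.calculus (res z hz) - hA'.calculus (res z hz)) (hA'.calculus g u) =
      hA.calculus (res z hz) (A' w - A ⟨w, h.domain_le w.2⟩) := by
    have e2 := hA.calculus_res_apply hz ⟨w, h.domain_le w.2⟩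
    have e3 : hA'.calculus (res z hz) (hA'.calculus g u) = w := rfl
    have e4 : A' w - A ⟨w, h.domain_le w.2⟩ = hA'.calculus g u -
        (A ⟨w, h.domain_le w.2⟩ - z • (w : H)) := by rw [← hw2]; abel
    rw [sub_apply, e3, e4, map_sub]
    exact congrArg _ e2.symm
  rw [ContinuousLinearMap.comp_apply, e1]
  calc _ ≤ |z.im|⁻¹ * ‖A' w - A ⟨w, h.domain_le w.2⟩‖ :=
        ContinuousLinearMap.le_of_opNorm_le _ ((hA.norm_calculus_le _).trans (norm_res_le z hz)) _
    _ ≤ |z.im|⁻¹ * (κ * (‖p‖ * ‖u‖)) := by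
        gcongr
        refine hb.trans ?_
        gcongr
        exact ContinuousLinearMap.le_of_opNorm_le _ (hA'.norm_calculus_le _) _
    _ = _ := by ring

variable {A A' : H →ₗ.[ℂ] H} (hA : IsDiagonal A) (hA' : IsDiagonal A')

theorem norm_calculus_sub_comp_le_of_tendsto {ψs : ℕ → ℝ →ᵇ ℂ} {ψ : ℝ →ᵇ ℂ} {M C : ℝ}
    (hM : ∀ n, ‖ψs n‖ ≤ M) (h : ∀ t, Tendsto (fun n => ψs n t) atTop (𝓝 (ψ t))) {X : H →L[ℂ] H}
    (hC : ∀ n, ‖(hA.calculus (ψs n) - hA'.calculus (ψs n)) ∘L X‖ ≤ C) :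
    ‖(hA.calculus ψ - hA'.calculus ψ) ∘L X‖ ≤ C := by
  refine ContinuousLinearMap.opNorm_le_bound _ ((norm_nonneg _).trans (hC 0)) fun u => ?_
  have h1 := ((hA.tendsto_calculus hM h (X u)).sub (hA'.tendsto_calculus hM h (X u))).norm
  exact le_of_tendsto h1 (Eventually.of_forall fun n =>
    ((hA.calculus (ψs n) - hA'.calculus (ψs n)) ∘L X).le_of_opNorm_le (hC n) u)

theorem norm_calculus_sub_comp_le_integral {Ω : Type*} [MeasurableSpace Ω]
    {μ : Measure Ω} {k : Ω → ℝ →ᵇ ℂ} {ψ : ℝ →ᵇ ℂ} {g G : Ω → ℝ} (hg : Integrable g μ)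
    (hk : ∀ t, AEStronglyMeasurable (fun ω => k ω t) μ) (hkg : ∀ ω, ‖k ω‖ ≤ g ω)
    (hψ : ∀ t, ψ t = ∫ ω, k ω t ∂μ) {X : H →L[ℂ] H} (hG : Integrable G μ)
    (hC : ∀ ω, ‖(hA.calculus (k ω) - hA'.calculus (k ω)) ∘L X‖ ≤ G ω) :
    ‖(hA.calculus ψ - hA'.calculus ψ) ∘L X‖ ≤ ∫ ω, G ω ∂μ := by
  have hG0 : ∀ ω, 0 ≤ G ω := fun ω => (norm_nonneg _).trans (hC ω)
  refine ContinuousLinearMap.opNorm_le_of_re_inner_le (integral_nonneg hG0) fun u v hu hv => ?_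
  obtain ⟨i1, e1⟩ := hA.inner_calculus_eq_integral hg hk hkg hψ v (X u)
  obtain ⟨i2, e2⟩ := hA'.inner_calculus_eq_integral hg hk hkg hψ v (X u)
  have e3 : inner ℂ v (((hA.calculus ψ - hA'.calculus ψ) ∘L X) u) =
      ∫ ω, inner ℂ v (((hA.calculus (k ω) - hA'.calculus (k ω)) ∘L X) u) ∂μ := by
    simp only [ContinuousLinearMap.comp_apply, sub_apply, inner_sub_right]
    rw [e1, e2, integral_sub i1 i2]
  have e4 : ‖inner ℂ v (((hA.calculus ψ - hA'.calculus ψ) ∘L X) u)‖ ≤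
      (∫ ω, G ω ∂μ) * (‖v‖ * ‖u‖) := by
    rw [e3, ← integral_mul_const]
    refine norm_integral_le_of_norm_le (hG.mul_const _) (Eventually.of_forall fun ω => ?_)
    calc _ ≤ ‖v‖ * ‖((hA.calculus (k ω) - hA'.calculus (k ω)) ∘L X) u‖ := norm_inner_le_norm _ _
      _ ≤ ‖v‖ * (G ω * ‖u‖) := by
          gcongr
          exact ContinuousLinearMap.le_of_opNorm_le _ (hC ω) u
      _ = _ := by ring
  rw [hu, hv, mul_one, mul_one, ← norm_inner_symm] at e4
  exact (RCLike.re_le_norm _).trans e4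

end Perturbation

/-! ### The bounded transform as an average of resolvents -/

section BoundedTransform

/-- The translate `t ↦ f(t - a)` of the function `f(t) = t / √(1 + t²)`. -/
def boundedTransformShift (a : ℝ) : ℝ →ᵇ ℂ :=
  (complexify boundedTransform).compContinuous ⟨fun t => t - a, by fun_prop⟩

@[simp] theorem boundedTransformShift_apply (a t : ℝ) :
    boundedTransformShift a t = ((t - a) / √(1 + (t - a) ^ 2) : ℝ) := rfl

theorem abs_div_sqrt_le_one (t : ℝ) : |t / √(1 + t ^ 2)| ≤ 1 := by
  rw [abs_div, abs_of_nonneg (Real.sqrt_nonneg _)]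
  exact div_le_one_of_le₀ (Real.abs_le_sqrt (by linarith)) (Real.sqrt_nonneg _)

theorem norm_boundedTransformShift_le (a : ℝ) : ‖boundedTransformShift a‖ ≤ 1 :=
  (BoundedContinuousFunction.norm_le zero_le_one).2 fun t => by
    rw [boundedTransformShift_apply, Complex.norm_real]
    exact abs_div_sqrt_le_one _

/-- A point on the vertical line through `a`, at height `±√(1 + l²)`; the sign is encoded by a
Boolean. -/
def vertical (a l : ℝ) (σ : Bool) : ℂ := ⟨a, (if σ then 1 else -1) * √(1 + l ^ 2)⟩

theorem one_le_sqrt_one_add_sq (l : ℝ) : 1 ≤ √(1 + l ^ 2) := by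
  rw [Real.one_le_sqrt]; nlinarith [sq_nonneg l]

theorem abs_vertical_im (a l : ℝ) (σ : Bool) : |(vertical a l σ).im| = √(1 + l ^ 2) := by
  cases σ <;> simp [vertical]

theorem vertical_im_ne_zero (a l : ℝ) (σ : Bool) : (vertical a l σ).im ≠ 0 := by
  rw [← abs_pos, abs_vertical_im]
  linarith [one_le_sqrt_one_add_sq l]

/-- The function `t ↦ π⁻¹ (t - a) / (1 + l² + (t - a)²)`, a combination of two resolvents. -/
def cauchyKernel (a l : ℝ) : ℝ →ᵇ ℂ :=
  ((2 * Real.pi)⁻¹ : ℂ) • (res (vertical a l true) (vertical_im_ne_zero _ _ _) +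
    res (vertical a l false) (vertical_im_ne_zero _ _ _))

theorem cauchyKernel_apply (a l t : ℝ) :
    cauchyKernel a l t = (Real.pi⁻¹ * ((t - a) / (1 + (t - a) ^ 2 + l ^ 2)) : ℝ) := by
  have h1 := ofReal_sub_ne_zero (vertical_im_ne_zero a l true) t
  have h2 := ofReal_sub_ne_zero (vertical_im_ne_zero a l false) t
  have hs : ((√(1 + l ^ 2) : ℝ) : ℂ) ^ 2 = 1 + (l : ℂ) ^ 2 := by
    rw [← Complex.ofReal_pow, Real.sq_sqrt (by positivity)]
    push_cast; ring
  have e1 : vertical a l true = a + √(1 + l ^ 2) * Complex.I := by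
    apply Complex.ext <;> simp [vertical]
  have e2 : vertical a l false = a - √(1 + l ^ 2) * Complex.I := by
    apply Complex.ext <;> simp [vertical]
  have h3 : (((1 + (t - a) ^ 2 + l ^ 2 : ℝ)) : ℂ) ≠ 0 := by
    exact_mod_cast (by positivity : (1 + (t - a) ^ 2 + l ^ 2 : ℝ) ≠ 0)
  have hpi : (Real.pi : ℂ) ≠ 0 := by exact_mod_cast Real.pi_ne_zero
  have h4 : ((t : ℂ) - vertical a l true) * (t - vertical a l false) =
      ((1 + (t - a) ^ 2 + l ^ 2 : ℝ) : ℂ) := by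
    rw [e1, e2]
    push_cast
    linear_combination (-(√(1 + l ^ 2) : ℂ) ^ 2) * Complex.I_sq + hs
  have h5 : ((t : ℂ) - vertical a l true)⁻¹ + ((t : ℂ) - vertical a l false)⁻¹ =
      2 * (t - a) / ((1 + (t - a) ^ 2 + l ^ 2 : ℝ) : ℂ) := by
    rw [inv_add_inv h1 h2, h4, e1, e2]
    congr 1
    ring
  simp only [cauchyKernel, BoundedContinuousFunction.coe_smul, BoundedContinuousFunction.coe_add,
    Pi.add_apply, res_apply, h5, smul_eq_mul]
  rw [Complex.ofReal_mul, Complex.ofReal_div, Complex.ofReal_inv]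
  rw [Complex.ofReal_sub]
  field_simp

theorem norm_cauchyKernel_le (a l : ℝ) : ‖cauchyKernel a l‖ ≤ 1 := by
  have h : ∀ σ, ‖res (vertical a l σ) (vertical_im_ne_zero _ _ _)‖ ≤ 1 := fun σ => by
    refine (norm_res_le _ _).trans ?_
    rw [abs_vertical_im]
    exact inv_le_one_of_one_le₀ (one_le_sqrt_one_add_sq l)
  have hpi : ‖((2 * Real.pi)⁻¹ : ℂ)‖ ≤ 2⁻¹ := by
    rw [norm_inv, norm_mul, Complex.norm_real, Real.norm_of_nonneg Real.pi_pos.le,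
      Complex.norm_ofNat]
    refine inv_anti₀ (by norm_num) ?_
    linarith [Real.pi_gt_three]
  calc _ ≤ ‖((2 * Real.pi)⁻¹ : ℂ)‖ * (1 + 1) := by
        rw [cauchyKernel, norm_smul]
        gcongr
        exact (norm_add_le _ _).trans (add_le_add (h _) (h _))
    _ ≤ 2⁻¹ * (1 + 1) := by gcongr
    _ = 1 := by norm_num

/-- The integral of `cauchyKernel a l` over `|l| ≤ n`. -/
def truncatedTransform (a : ℝ) (n : ℕ) : ℝ →ᵇ ℂ :=
  BoundedContinuousFunction.ofNormedAddCommGroup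
    (fun t : ℝ => (((t - a) / √(1 + (t - a) ^ 2) *
      (2 / Real.pi * Real.arctan (n / √(1 + (t - a) ^ 2))) : ℝ) : ℂ))
    (by
      have h : ∀ t : ℝ, √(1 + (t - a) ^ 2) ≠ 0 := fun t => by positivity
      have h1 : Continuous fun t : ℝ => (t - a) / √(1 + (t - a) ^ 2) :=
        Continuous.div (by fun_prop) (by fun_prop) h
      have h2 : Continuous fun t : ℝ => (n : ℝ) / √(1 + (t - a) ^ 2) :=
        Continuous.div (by fun_prop) (by fun_prop) h
      exact Complex.continuous_ofReal.comp
        (h1.mul (continuous_const.mul (Real.continuous_arctan.comp h2))))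
    1 (fun t => by
      have hpi := Real.pi_pos
      rw [Complex.norm_real, Real.norm_eq_abs, abs_mul]
      have h1 := abs_div_sqrt_le_one (t - a)
      have h2 : |2 / Real.pi * Real.arctan (n / √(1 + (t - a) ^ 2))| ≤ 1 := by
        have h3 := Real.arctan_lt_pi_div_two (n / √(1 + (t - a) ^ 2))
        have h4 : 0 ≤ Real.arctan (n / √(1 + (t - a) ^ 2)) :=
          Real.arctan_nonneg.2 (by positivity)
        rw [abs_of_nonneg (by positivity)]
        calc _ ≤ 2 / Real.pi * (Real.pi / 2) := by gcongr
          _ = 1 := by field_simp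
      calc _ ≤ (1 : ℝ) * 1 := mul_le_mul h1 h2 (abs_nonneg _) zero_le_one
        _ = 1 := mul_one _)

theorem truncatedTransform_apply (a : ℝ) (n : ℕ) (t : ℝ) :
    truncatedTransform a n t = (((t - a) / √(1 + (t - a) ^ 2) *
      (2 / Real.pi * Real.arctan (n / √(1 + (t - a) ^ 2))) : ℝ) : ℂ) := rfl

theorem norm_truncatedTransform_le (a : ℝ) (n : ℕ) : ‖truncatedTransform a n‖ ≤ 1 :=
  BoundedContinuousFunction.norm_ofNormedAddCommGroup_le _ zero_le_one _

theorem tendsto_truncatedTransform (a t : ℝ) :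
    Tendsto (fun n => truncatedTransform a n t) atTop (𝓝 (boundedTransformShift a t)) := by
  have h0 : 0 < √(1 + (t - a) ^ 2) := by positivity
  have h1 : Tendsto (fun n : ℕ => Real.arctan (n / √(1 + (t - a) ^ 2))) atTop
      (𝓝 (Real.pi / 2)) :=
    (Real.tendsto_arctan_atTop.mono_right nhdsWithin_le_nhds).comp
      (tendsto_natCast_atTop_atTop.atTop_div_const h0)
  have h2 := ((h1.const_mul (2 / Real.pi)).const_mul ((t - a) / √(1 + (t - a) ^ 2)))
  have h3 : (t - a) / √(1 + (t - a) ^ 2) * (2 / Real.pi * (Real.pi / 2)) =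
      (t - a) / √(1 + (t - a) ^ 2) := by
    have := Real.pi_ne_zero
    field_simp
  rw [h3] at h2
  exact (Complex.continuous_ofReal.tendsto _).comp h2

theorem truncatedTransform_eq_integral (a : ℝ) (n : ℕ) (t : ℝ) :
    truncatedTransform a n t = ∫ l in Set.Ioc (-n : ℝ) n, cauchyKernel a l t := by
  simp only [cauchyKernel_apply]
  rw [integral_complex_ofReal, truncatedTransform_apply]
  congr 1
  rw [integral_const_mul, ← intervalIntegral.integral_of_le (by linarith [n.cast_nonneg (α := ℝ)])]
  set c := √(1 + (t - a) ^ 2) with hc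
  have h0 : 0 < c := by positivity
  have hc2 : c ^ 2 = 1 + (t - a) ^ 2 := Real.sq_sqrt (by positivity)
  have h1 : ∀ l : ℝ, (t - a) / (1 + (t - a) ^ 2 + l ^ 2) =
      (t - a) / c ^ 2 * (1 / (1 + (l / c) ^ 2)) := fun l => by
    rw [← hc2]
    field_simp
  simp only [h1]
  rw [intervalIntegral.integral_const_mul,
    intervalIntegral.integral_comp_div (fun x => 1 / (1 + x ^ 2)) h0.ne', 
    integral_one_div_one_add_sq, neg_div, Real.arctan_neg]
  have := Real.pi_ne_zero
  simp only [smul_eq_mul]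
  field_simp
  ring

variable {H : Type*} [NormedAddCommGroup H] [InnerProductSpace ℂ H] [CompleteSpace H]
  {A A' : H →ₗ.[ℂ] H} (hA : IsDiagonal A) (hA' : IsDiagonal A')

/-- An estimate for differences of resolvents on a vertical line gives an estimate for differences
of (translates of) the bounded transform. -/
theorem norm_boundedTransformShift_sub_comp_le {X : H →L[ℂ] H} {a : ℝ} {g : ℝ → ℝ}
    (hg : Integrable g) (h : ∀ l σ, ‖(hA.calculus (res (vertical a l σ) (vertical_im_ne_zero _ _ _)) -
      hA'.calculus (res (vertical a l σ) (vertical_im_ne_zero _ _ _))) ∘L X‖ ≤ g l) :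
    ‖(hA.calculus (boundedTransformShift a) - hA'.calculus (boundedTransformShift a)) ∘L X‖ ≤
      Real.pi⁻¹ * ∫ l, g l := by
  have hg0 : ∀ l, 0 ≤ g l := fun l => (norm_nonneg _).trans (h l true)
  have hpi := Real.pi_pos
  have hk : ∀ l, ‖(hA.calculus (cauchyKernel a l) - hA'.calculus (cauchyKernel a l)) ∘L X‖ ≤
      Real.pi⁻¹ * g l := fun l => by
    have e : (hA.calculus (cauchyKernel a l) - hA'.calculus (cauchyKernel a l)) ∘L X =
        ((2 * Real.pi)⁻¹ : ℂ) •
        ((hA.calculus (res (vertical a l true) (vertical_im_ne_zero _ _ _)) -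
          hA'.calculus (res (vertical a l true) (vertical_im_ne_zero _ _ _))) ∘L X +
        (hA.calculus (res (vertical a l false) (vertical_im_ne_zero _ _ _)) -
          hA'.calculus (res (vertical a l false) (vertical_im_ne_zero _ _ _))) ∘L X) := by
      simp only [cauchyKernel, map_smul, map_add]
      ext u
      simp only [ContinuousLinearMap.comp_apply, sub_apply, smul_apply, add_apply, smul_add,
        smul_sub]
      abel
    rw [e, norm_smul, norm_inv, norm_mul, Complex.norm_real, Real.norm_of_nonneg hpi.le,
      Complex.norm_ofNat]
    calc _ ≤ (2 * Real.pi)⁻¹ * (g l + g l) := by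
          gcongr
          exact (norm_add_le _ _).trans (add_le_add (h _ _) (h _ _))
      _ = _ := by field_simp; ring
  refine norm_calculus_sub_comp_le_of_tendsto hA hA' (norm_truncatedTransform_le a)
    (tendsto_truncatedTransform a) fun n => ?_
  refine (norm_calculus_sub_comp_le_integral hA hA' (μ := volume.restrict (Set.Ioc (-n : ℝ) n))
    (k := fun l => cauchyKernel a l) (g := fun _ => 1) (G := fun l => Real.pi⁻¹ * g l)
    (integrable_const _) (fun t => ?_) (norm_cauchyKernel_le a)
    (truncatedTransform_eq_integral a n) (hg.const_mul _).integrableOn hk).trans ?_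
  · simp only [cauchyKernel_apply]
    refine Continuous.aestronglyMeasurable (Complex.continuous_ofReal.comp ?_)
    exact continuous_const.mul
      (Continuous.div (by fun_prop) (by fun_prop) fun l => by positivity)
  · rw [← integral_const_mul]
    exact setIntegral_le_integral (hg.const_mul _)
      (Eventually.of_forall fun l => mul_nonneg (by positivity) (hg0 l))

/-- Translates of the bounded transform are operator Lipschitz, with constant `1`. -/
theorem norm_boundedTransformShift_sub_comp_le_of_res {X : H →L[ℂ] H} {a κ : ℝ}
    (h : ∀ (z : ℂ) (hz : z.im ≠ 0), z.re = a → 1 ≤ |z.im| →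
      ‖(hA.calculus (res z hz) - hA'.calculus (res z hz)) ∘L X‖ ≤ κ * (|z.im| ^ 2)⁻¹) :
    ‖(hA.calculus (boundedTransformShift a) - hA'.calculus (boundedTransformShift a)) ∘L X‖ ≤ κ := by
  refine (norm_boundedTransformShift_sub_comp_le hA hA' (integrable_inv_one_add_sq.const_mul κ)
    fun l σ => ?_).trans_eq ?_
  · refine (h _ (vertical_im_ne_zero a l σ) rfl ?_).trans_eq ?_
    · rw [abs_vertical_im]; exact one_le_sqrt_one_add_sq l
    · rw [abs_vertical_im, Real.sq_sqrt (by positivity)]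
  · rw [integral_const_mul, integral_univ_inv_one_add_sq]
    have := Real.pi_ne_zero
    field_simp

end BoundedTransform

/-! ### Perturbation estimates at high energy -/

section Cutoff

/-- The cutoff function `t ↦ a² / (a² + t²)`. -/
def cutoff (a : ℝ) (ha : 0 < a) : ℝ →ᵇ ℂ :=
  BoundedContinuousFunction.ofNormedAddCommGroup
    (fun t : ℝ => ((a ^ 2 / (a ^ 2 + t ^ 2) : ℝ) : ℂ))
    (Complex.continuous_ofReal.comp
      (Continuous.div (by fun_prop) (by fun_prop) fun t => by positivity)) 1
    (fun t => by
      rw [Complex.norm_real, Real.norm_of_nonneg (by positivity)]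
      exact div_le_one_of_le₀ (by nlinarith [sq_nonneg t]) (by positivity))

variable {a : ℝ} (ha : 0 < a)

theorem cutoff_apply (t : ℝ) : cutoff a ha t = ((a ^ 2 / (a ^ 2 + t ^ 2) : ℝ) : ℂ) := rfl

theorem norm_cutoff_le : ‖cutoff a ha‖ ≤ 1 :=
  BoundedContinuousFunction.norm_ofNormedAddCommGroup_le _ zero_le_one _

theorem one_sub_cutoff_apply (t : ℝ) :
    (1 - cutoff a ha) t = ((t ^ 2 / (a ^ 2 + t ^ 2) : ℝ) : ℂ) := by
  have h : a ^ 2 + t ^ 2 ≠ 0 := by positivity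
  have h1 : t ^ 2 / (a ^ 2 + t ^ 2) = 1 - a ^ 2 / (a ^ 2 + t ^ 2) := by field_simp; ring
  rw [h1]
  simp [cutoff_apply]

theorem norm_one_sub_cutoff_apply_le (t : ℝ) : ‖(1 - cutoff a ha) t‖ ≤ 1 := by
  rw [one_sub_cutoff_apply, Complex.norm_real, Real.norm_of_nonneg (by positivity)]
  exact div_le_one_of_le₀ (by nlinarith [sq_nonneg a]) (by positivity)

theorem mul_I_im_ne_zero {b : ℝ} (hb : b ≠ 0) : ((b : ℂ) * Complex.I).im ≠ 0 := by simpa using hb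

theorem cutoff_eq_smul_sub : cutoff a ha = ((a : ℂ) / (2 * Complex.I)) •
    (res ((a : ℝ) * Complex.I) (mul_I_im_ne_zero ha.ne') -
      res ((-a : ℝ) * Complex.I) (mul_I_im_ne_zero (neg_ne_zero.2 ha.ne'))) := by
  ext t
  have h1 := ofReal_sub_ne_zero (mul_I_im_ne_zero ha.ne') t
  have h2 := ofReal_sub_ne_zero (mul_I_im_ne_zero (neg_ne_zero.2 ha.ne')) t
  have h3 : ((a : ℂ) ^ 2 + (t : ℂ) ^ 2) ≠ 0 := by
    exact_mod_cast (by positivity : a ^ 2 + t ^ 2 ≠ 0)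
  have h4 : ((t : ℂ) - (a : ℝ) * Complex.I) * (t - (-a : ℝ) * Complex.I) = a ^ 2 + t ^ 2 := by
    push_cast
    linear_combination (-(a : ℂ) ^ 2) * Complex.I_sq
  rw [cutoff_apply]
  simp only [BoundedContinuousFunction.coe_smul, BoundedContinuousFunction.coe_sub, Pi.sub_apply,
    res_apply, smul_eq_mul]
  rw [inv_sub_inv h1 h2, h4]
  have hI := Complex.I_ne_zero
  push_cast
  field_simp
  ring

/-- The resolvent function of a purely imaginary number is small where the cutoff is not. -/
theorem norm_res_mul_one_sub_cutoff_le {z : ℂ} (hz : z.im ≠ 0) (h0 : z.re = 0) :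
    ‖res z hz * (1 - cutoff a ha)‖ ≤ min |z.im|⁻¹ (2 * a)⁻¹ := by
  refine (BoundedContinuousFunction.norm_le (by positivity)).2 fun t => le_min ?_ ?_
  · rw [BoundedContinuousFunction.mul_apply, norm_mul]
    calc _ ≤ |z.im|⁻¹ * 1 := by
          gcongr
          · exact norm_inv_ofReal_sub_le hz t
          · exact norm_one_sub_cutoff_apply_le ha t
      _ = _ := mul_one _
  · rw [BoundedContinuousFunction.mul_apply, norm_mul, one_sub_cutoff_apply, Complex.norm_real,
      Real.norm_of_nonneg (by positivity), res_apply, norm_inv]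
    rcases eq_or_ne t 0 with rfl | ht
    · simp [ha.le]
    have h1 : |t| ≤ ‖(t : ℂ) - z‖ := by simpa [h0] using Complex.abs_re_le_norm ((t : ℂ) - z)
    have h2 : 0 < |t| := abs_pos.2 ht
    calc _ ≤ |t|⁻¹ * (t ^ 2 / (a ^ 2 + t ^ 2)) := by gcongr
      _ = |t| / (a ^ 2 + t ^ 2) := by rw [← sq_abs t]; field_simp
      _ ≤ (2 * a)⁻¹ := by
          rw [div_le_iff₀ (by positivity), inv_mul_eq_div, le_div_iff₀ (by positivity)]
          nlinarith [sq_nonneg (a - |t|), sq_abs t]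

/-- Functions vanishing at infinity are small where the cutoff is not. -/
theorem exists_norm_mul_one_sub_cutoff_le {h : ℝ →ᵇ ℂ} (hh : Tendsto h (cocompact ℝ) (𝓝 0))
    {η : ℝ} (hη : 0 < η) :
    ∃ N : ℝ, 1 ≤ N ∧ ∀ a (ha : 0 < a), N ≤ a → ‖h * (1 - cutoff a ha)‖ ≤ η := by
  have h1 : ∀ᶠ t in cocompact ℝ, ‖h t‖ < η := by
    simpa using hh.eventually (Metric.ball_mem_nhds 0 hη)
  obtain ⟨L, hL⟩ : ∃ L : ℝ, ∀ t, L < |t| → ‖h t‖ < η := by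
    rw [← Metric.cobounded_eq_cocompact, ← comap_norm_atTop, eventually_comap] at h1
    obtain ⟨L, hL⟩ := eventually_atTop.1 h1
    exact ⟨L, fun t ht => hL _ ht.le t rfl⟩
  refine ⟨1 + L ^ 2 * ‖h‖ / η, by have := sq_nonneg L; have := norm_nonneg h; simp; positivity,
    fun a ha hNa => ?_⟩
  refine (BoundedContinuousFunction.norm_le hη.le).2 fun t => ?_
  rw [BoundedContinuousFunction.mul_apply, norm_mul]
  rcases lt_or_ge L |t| with ht | ht
  · calc _ ≤ η * 1 := by
          gcongr
          · exact (hL t ht).le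
          · exact norm_one_sub_cutoff_apply_le ha t
      _ = η := mul_one _
  · rw [one_sub_cutoff_apply, Complex.norm_real, Real.norm_of_nonneg (by positivity)]
    have h0 : 0 ≤ L ^ 2 * ‖h‖ / η := by positivity
    have h2 : t ^ 2 ≤ L ^ 2 := by rw [← sq_abs t]; gcongr
    have h3 : L ^ 2 * ‖h‖ ≤ a ^ 2 * η := by
      have : L ^ 2 * ‖h‖ / η ≤ a ^ 2 := by nlinarith
      rwa [div_le_iff₀ hη] at this
    calc _ ≤ ‖h‖ * (L ^ 2 / a ^ 2) := by
          gcongr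
          · exact h.norm_coe_le_norm t
          · nlinarith [sq_nonneg t]
      _ ≤ η := by
          rw [← mul_div_assoc, div_le_iff₀ (by positivity)]
          linarith

/-- The decay rate, as the cutoff is moved to infinity, in
`norm_boundedTransform_sub_comp_one_sub_cutoff_le`. -/
def cutoffRate (a : ℝ) : ℝ :=
  Real.pi⁻¹ * ∫ l : ℝ, (√(1 + l ^ 2))⁻¹ * min (√(1 + l ^ 2))⁻¹ (2 * a)⁻¹

theorem cutoffRate_integrand_le {a : ℝ} (ha : 0 < a) (l : ℝ) :
    ‖(√(1 + l ^ 2))⁻¹ * min (√(1 + l ^ 2))⁻¹ (2 * a)⁻¹‖ ≤ (1 + l ^ 2)⁻¹ := by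
  rw [Real.norm_of_nonneg (by positivity)]
  calc _ ≤ (√(1 + l ^ 2))⁻¹ * (√(1 + l ^ 2))⁻¹ := by gcongr; exact min_le_left _ _
    _ = _ := by rw [← mul_inv, Real.mul_self_sqrt (by positivity)]

theorem continuous_cutoffRate_integrand (a : ℝ) :
    Continuous fun l : ℝ => (√(1 + l ^ 2))⁻¹ * min (√(1 + l ^ 2))⁻¹ (2 * a)⁻¹ := by
  have h : Continuous fun l : ℝ => (√(1 + l ^ 2))⁻¹ :=
    Continuous.inv₀ (by fun_prop) fun l => by positivity
  exact h.mul (h.min continuous_const)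

theorem integrable_cutoffRate_integrand {a : ℝ} (ha : 0 < a) :
    Integrable fun l : ℝ => (√(1 + l ^ 2))⁻¹ * min (√(1 + l ^ 2))⁻¹ (2 * a)⁻¹ :=
  integrable_inv_one_add_sq.mono' (continuous_cutoffRate_integrand a).aestronglyMeasurable
    (Eventually.of_forall (cutoffRate_integrand_le ha))

theorem tendsto_cutoffRate : Tendsto cutoffRate atTop (𝓝 0) := by
  have h := tendsto_integral_filter_of_dominated_convergence (l := atTop)
    (F := fun (a l : ℝ) => (√(1 + l ^ 2))⁻¹ * min (√(1 + l ^ 2))⁻¹ (2 * a)⁻¹) (f := fun _ => 0)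
    (μ := volume) (fun l : ℝ => (1 + l ^ 2)⁻¹)
    (Eventually.of_forall fun a => (continuous_cutoffRate_integrand a).aestronglyMeasurable)
    ((eventually_gt_atTop 0).mono fun a ha => Eventually.of_forall (cutoffRate_integrand_le ha))
    integrable_inv_one_add_sq (Eventually.of_forall fun l => ?_)
  · have h1 := h.const_mul Real.pi⁻¹
    rw [integral_zero, mul_zero] at h1
    exact h1
  · have h1 : Tendsto (fun a : ℝ => (2 * a)⁻¹) atTop (𝓝 0) :=
      tendsto_inv_atTop_zero.comp (tendsto_id.const_mul_atTop (by norm_num))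
    have h2 := ((tendsto_const_nhds (x := (√(1 + l ^ 2))⁻¹)).min h1).const_mul (√(1 + l ^ 2))⁻¹
    rwa [min_eq_right (by positivity), mul_zero] at h2

end Cutoff

section Estimates

variable {H : Type*} [NormedAddCommGroup H] [InnerProductSpace ℂ H] [CompleteSpace H]
  {A A' : H →ₗ.[ℂ] H} (hA : IsDiagonal A) {hA' : IsDiagonal A'} {κ : ℝ}

theorem RelBound.norm_res_sub_comp_calculus_le {m : ℝ →ᵇ ℂ} (h : RelBound A A' hA' m κ) {z : ℂ}
    (hz : z.im ≠ 0) :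
    ‖(hA.calculus (res z hz) - hA'.calculus (res z hz)) ∘L hA'.calculus m‖ ≤
      κ * (|z.im| ^ 2)⁻¹ := by
  have hκ := h.nonneg
  calc _ ≤ |z.im|⁻¹ * (κ * ‖res z hz‖) := h.norm_res_sub_comp_le hA hz (mul_comm _ _)
    _ ≤ |z.im|⁻¹ * (κ * |z.im|⁻¹) := by gcongr; exact norm_res_le z hz
    _ = _ := by rw [sq, mul_inv]; ring

theorem RelBound.norm_boundedTransformShift_sub_comp_calculus_le {m : ℝ →ᵇ ℂ}
    (h : RelBound A A' hA' m κ) (a : ℝ) :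
    ‖(hA.calculus (boundedTransformShift a) - hA'.calculus (boundedTransformShift a)) ∘L
      hA'.calculus m‖ ≤ κ :=
  norm_boundedTransformShift_sub_comp_le_of_res hA hA' fun _ hz _ _ =>
    h.norm_res_sub_comp_calculus_le hA hz

theorem RelBound.norm_res_sub_le (h : RelBound A A' hA' 1 κ) {z : ℂ} (hz : z.im ≠ 0) :
    ‖hA.calculus (res z hz) - hA'.calculus (res z hz)‖ ≤ κ * (|z.im| ^ 2)⁻¹ := by
  have := h.norm_res_sub_comp_calculus_le hA hz
  rwa [map_one, ContinuousLinearMap.one_def, ContinuousLinearMap.comp_id] at this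

theorem norm_cutoff_sub_le_of_res {a : ℝ} (ha : 0 < a) {C : ℝ}
    (h : ∀ (z : ℂ) (hz : z.im ≠ 0), z.re = 0 → |z.im| = a →
      ‖hA.calculus (res z hz) - hA'.calculus (res z hz)‖ ≤ C) :
    ‖hA.calculus (cutoff a ha) - hA'.calculus (cutoff a ha)‖ ≤ a * C := by
  have e : hA.calculus (cutoff a ha) - hA'.calculus (cutoff a ha) =
      ((a : ℂ) / (2 * Complex.I)) •
        ((hA.calculus (res ((a : ℝ) * Complex.I) (mul_I_im_ne_zero ha.ne')) -
          hA'.calculus (res ((a : ℝ) * Complex.I) (mul_I_im_ne_zero ha.ne'))) -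
        (hA.calculus (res ((-a : ℝ) * Complex.I) (mul_I_im_ne_zero (neg_ne_zero.2 ha.ne'))) -
          hA'.calculus (res ((-a : ℝ) * Complex.I) (mul_I_im_ne_zero (neg_ne_zero.2 ha.ne'))))) := by
    rw [cutoff_eq_smul_sub, map_smul, map_smul, map_sub, map_sub, ← smul_sub]
    congr 1
    abel
  have e2 : ‖(a : ℂ) / (2 * Complex.I)‖ = a / 2 := by
    rw [norm_div, norm_mul, Complex.norm_I, Complex.norm_real, Real.norm_of_nonneg ha.le,
      Complex.norm_ofNat, mul_one]
  rw [e, norm_smul, e2]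
  calc _ ≤ a / 2 * (C + C) := by
        gcongr
        refine (norm_sub_le _ _).trans (add_le_add (h _ _ (by simp) ?_) (h _ _ (by simp) ?_))
        · simp [abs_of_pos ha]
        · simp [abs_of_pos ha]
    _ = a * C := by ring

theorem RelBound.norm_cutoff_sub_le (h : RelBound A A' hA' 1 κ) {a : ℝ} (ha : 0 < a) :
    ‖hA.calculus (cutoff a ha) - hA'.calculus (cutoff a ha)‖ ≤ κ / a := by
  refine (norm_cutoff_sub_le_of_res hA ha (C := κ * (a ^ 2)⁻¹) fun z hz _ hza => ?_).trans_eq ?_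
  · have := h.norm_res_sub_le hA hz
    rwa [hza] at this
  · field_simp

theorem RelBound.norm_cutoff_sub_le_of_resolventFun (h : RelBound A A' hA' resolventFun κ) {a : ℝ}
    (ha : 0 < a) (ha1 : 1 ≤ a) :
    ‖hA.calculus (cutoff a ha) - hA'.calculus (cutoff a ha)‖ ≤ 3 * κ := by
  have hκ := h.nonneg
  refine (norm_cutoff_sub_le_of_res hA ha (C := a⁻¹ * (κ * 3)) fun z hz h0 hza => ?_).trans_eq ?_
  · have e : res z hz * 1 = resolventFun * (1 + (z + Complex.I) • res z hz) := by
      ext t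
      have h1 := ofReal_sub_ne_zero hz t
      have h2 := ofReal_add_I_ne_zero t
      simp only [mul_one, BoundedContinuousFunction.mul_apply, BoundedContinuousFunction.coe_add,
        BoundedContinuousFunction.coe_smul, BoundedContinuousFunction.coe_one, Pi.add_apply,
        Pi.one_apply, res_apply, resolventFun_apply, smul_eq_mul]
      field_simp
      ring
    have h1 := h.norm_res_sub_comp_le hA hz e
    rw [map_one, ContinuousLinearMap.one_def, ContinuousLinearMap.comp_id, hza] at h1
    refine h1.trans ?_
    gcongr
    have h2 : ‖res z hz‖ ≤ a⁻¹ := hza ▸ norm_res_le z hz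
    have h3 : ‖z‖ = a := by
      rw [← hza, ← Complex.re_add_im z, h0]
      simp
    have h4 : ‖z + Complex.I‖ ≤ a + 1 := by
      refine (norm_add_le _ _).trans ?_
      rw [h3, Complex.norm_I]
    calc _ ≤ ‖(1 : ℝ →ᵇ ℂ)‖ + ‖z + Complex.I‖ * ‖res z hz‖ := by
          rw [← norm_smul]; exact norm_add_le _ _
      _ ≤ 1 + (a + 1) * a⁻¹ := by
          gcongr
          exact norm_one.le
      _ ≤ 1 + (a + a) * a⁻¹ := by gcongr
      _ = 3 := by field_simp; norm_num
  · field_simp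

/-- For bounded perturbations, `f(A) - f(A')` with `f(t) = t / √(1 + t²)` is small at high
energies, at a rate depending only on the size of the perturbation. -/
theorem RelBound.norm_boundedTransform_sub_comp_one_sub_cutoff_le (h : RelBound A A' hA' 1 κ)
    {a : ℝ} (ha : 0 < a) :
    ‖(hA.calculus (boundedTransformShift 0) - hA'.calculus (boundedTransformShift 0)) ∘L
      hA'.calculus (1 - cutoff a ha)‖ ≤ κ * cutoffRate a := by
  have hκ := h.nonneg
  refine (norm_boundedTransformShift_sub_comp_le hA hA'
    ((integrable_cutoffRate_integrand ha).const_mul κ) fun l σ => ?_).trans_eq ?_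
  · have h1 := h.norm_res_sub_comp_le hA (vertical_im_ne_zero 0 l σ) (g := 1 - cutoff a ha)
      (one_mul _).symm
    refine h1.trans ?_
    have h2 := norm_res_mul_one_sub_cutoff_le ha (vertical_im_ne_zero 0 l σ) rfl
    rw [abs_vertical_im] at h2 ⊢
    calc _ ≤ (√(1 + l ^ 2))⁻¹ * (κ * min (√(1 + l ^ 2))⁻¹ (2 * a)⁻¹) := by gcongr
      _ = _ := by ring
  · rw [integral_const_mul, cutoffRate]; ring

/-- For bounded perturbations, `ψ(A) - ψ(A')` is small at high energies if `ψ` differs from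
`t / √(1 + t²)` by a function vanishing at infinity. -/
theorem exists_norm_sub_comp_one_sub_cutoff_le {ψ : ℝ →ᵇ ℂ}
    (hψ : Tendsto (ψ - boundedTransformShift 0) (cocompact ℝ) (𝓝 0)) (r : ℝ) {η : ℝ}
    (hη : 0 < η) : ∃ N : ℝ, 1 ≤ N ∧ ∀ a (ha : 0 < a), N ≤ a →
      ∀ {H : Type*} [NormedAddCommGroup H] [InnerProductSpace ℂ H] [CompleteSpace H]
        {A A' : H →ₗ.[ℂ] H} (hA : IsDiagonal A) {hA' : IsDiagonal A'} {κ : ℝ},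
      RelBound A A' hA' 1 κ → κ ≤ r →
      ‖(hA.calculus ψ - hA'.calculus ψ) ∘L hA'.calculus (1 - cutoff a ha)‖ ≤ η := by
  set h := ψ - boundedTransformShift 0 with hh
  obtain ⟨N₁, hN₁, h₁⟩ := exists_norm_mul_one_sub_cutoff_le hψ (show 0 < η / 8 by positivity)
  obtain ⟨N₂, h₂⟩ := Metric.tendsto_atTop.1 tendsto_cutoffRate (η / (4 * (|r| + 1)))
    (by positivity)
  refine ⟨max N₁ (max N₂ (4 * ‖h‖ * |r| / η)), le_max_of_le_left hN₁, fun a ha hNa => ?_⟩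
  intro H _ _ _ A A' hA hA' κ hκ hκr
  have hκ0 := hκ.nonneg
  have hκr' : κ ≤ |r| := hκr.trans (le_abs_self r)
  have i1 := h₁ a ha ((le_max_left _ _).trans hNa)
  have i2 := h₂ a ((le_max_left _ _).trans ((le_max_right _ _).trans hNa))
  have i3 : 4 * ‖h‖ * |r| / η ≤ a := (le_max_right _ _).trans ((le_max_right _ _).trans hNa)
  rw [dist_zero_right] at i2
  -- `ψ` is the bounded transform plus `h`, and `h` is small where the cutoff is not; the rest of
  -- `h(A)` sees only the difference of the cutoffs of `A` and `A'`
  have e : (hA.calculus ψ - hA'.calculus ψ) ∘L hA'.calculus (1 - cutoff a ha) =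
      (hA.calculus (boundedTransformShift 0) - hA'.calculus (boundedTransformShift 0)) ∘L
        hA'.calculus (1 - cutoff a ha) + hA.calculus (h * (1 - cutoff a ha)) +
      hA.calculus h * (hA.calculus (cutoff a ha) - hA'.calculus (cutoff a ha)) -
      hA'.calculus (h * (1 - cutoff a ha)) := by
    rw [← ContinuousLinearMap.mul_def, ← ContinuousLinearMap.mul_def, map_mul, map_mul, hh]
    simp only [map_sub, map_one]
    noncomm_ring
  have b1 := hκ.norm_boundedTransform_sub_comp_one_sub_cutoff_le hA ha
  have b2 := (hA.norm_calculus_le (h * (1 - cutoff a ha))).trans i1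
  have b3 := (hA'.norm_calculus_le (h * (1 - cutoff a ha))).trans i1
  have b4 : ‖hA.calculus h * (hA.calculus (cutoff a ha) - hA'.calculus (cutoff a ha))‖ ≤ η / 4 := by
    calc _ ≤ ‖h‖ * (|r| / a) := by
          refine (norm_mul_le _ _).trans ?_
          gcongr
          · exact hA.norm_calculus_le h
          · refine (hκ.norm_cutoff_sub_le hA ha).trans ?_
            gcongr
      _ ≤ η / 4 := by
          rw [div_le_iff₀ hη] at i3
          rw [← mul_div_assoc, div_le_iff₀ ha]
          linarith
  have b5 : κ * cutoffRate a ≤ η / 4 := by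
    calc _ ≤ |r| * (η / (4 * (|r| + 1))) := by
          have : cutoffRate a ≤ η / (4 * (|r| + 1)) := (le_abs_self _).trans i2.le
          calc _ ≤ κ * (η / (4 * (|r| + 1))) := by gcongr
            _ ≤ _ := by gcongr
      _ ≤ (|r| + 1) * (η / (4 * (|r| + 1))) := by gcongr; linarith
      _ = η / 4 := by field_simp
  rw [e]
  refine (norm_sub_le _ _).trans ?_
  have n1 := norm_add_le ((hA.calculus (boundedTransformShift 0) -
    hA'.calculus (boundedTransformShift 0)) ∘L hA'.calculus (1 - cutoff a ha) +
      hA.calculus (h * (1 - cutoff a ha)))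
      (hA.calculus h * (hA.calculus (cutoff a ha) - hA'.calculus (cutoff a ha)))
  have n2 := norm_add_le ((hA.calculus (boundedTransformShift 0) -
    hA'.calculus (boundedTransformShift 0)) ∘L hA'.calculus (1 - cutoff a ha))
      (hA.calculus (h * (1 - cutoff a ha)))
  linarith

end Estimates

/-! ### Band-limited approximation of the bounded transform -/

section Smoothing

theorem sinc_sq_le (v : ℝ) : Real.sinc v ^ 2 ≤ 2 * (1 + v ^ 2)⁻¹ := by
  have h1 : Real.sinc v ^ 2 ≤ 1 := by
    rw [← sq_abs]
    exact pow_le_one₀ (abs_nonneg _) (Real.abs_sinc_le_one v)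
  have h2 : v ^ 2 * Real.sinc v ^ 2 ≤ 1 := by
    rcases eq_or_ne v 0 with rfl | hv
    · simp
    · rw [Real.sinc_of_ne_zero hv, div_pow, mul_div_cancel₀ _ (pow_ne_zero 2 hv)]
      exact Real.sin_sq_le_one v
  rw [← div_eq_mul_inv, le_div_iff₀ (by positivity)]
  linarith

theorem integrable_sinc_sq : Integrable fun v : ℝ => Real.sinc v ^ 2 :=
  (integrable_inv_one_add_sq.const_mul 2).mono' (Real.continuous_sinc.pow 2).aestronglyMeasurable
    (Eventually.of_forall fun v => by
      rw [Real.norm_of_nonneg (sq_nonneg _)]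
      exact sinc_sq_le v)

theorem integral_sinc_sq_pos : 0 < ∫ v : ℝ, Real.sinc v ^ 2 :=
  integral_pos_of_integrable_nonneg_nonzero (x := 0) (Real.continuous_sinc.pow 2)
    integrable_sinc_sq (fun v => sq_nonneg _) (by simp)

/-- The Fejér kernel: the square of the cardinal sine, normalized to have integral `1`. -/
def fejer (v : ℝ) : ℝ := (∫ v : ℝ, Real.sinc v ^ 2)⁻¹ * Real.sinc v ^ 2

theorem fejer_nonneg (v : ℝ) : 0 ≤ fejer v :=
  mul_nonneg (inv_nonneg.2 integral_sinc_sq_pos.le) (sq_nonneg _)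

theorem continuous_fejer : Continuous fejer := continuous_const.mul (Real.continuous_sinc.pow 2)

theorem integrable_fejer : Integrable fejer := integrable_sinc_sq.const_mul _

theorem integral_fejer : ∫ v, fejer v = 1 := by
  unfold fejer
  rw [integral_const_mul, inv_mul_cancel₀ integral_sinc_sq_pos.ne']

theorem fejer_neg (v : ℝ) : fejer (-v) = fejer v := by simp [fejer]

theorem abs_boundedTransform_le (t : ℝ) : |boundedTransform t| ≤ 1 := abs_div_sqrt_le_one t

theorem boundedTransform_neg (t : ℝ) : boundedTransform (-t) = -boundedTransform t := by
  simp [neg_div]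

theorem abs_boundedTransform_sub_le (s t : ℝ) :
    |boundedTransform s - boundedTransform t| ≤ |s - t| := by
  have h1 : LipschitzWith 1 Real.arctan := by
    refine lipschitzWith_of_nnnorm_deriv_le Real.differentiable_arctan fun x => ?_
    rw [← NNReal.coe_le_coe, coe_nnnorm, Real.deriv_arctan, Real.norm_of_nonneg (by positivity)]
    exact div_le_one_of_le₀ (by nlinarith [sq_nonneg x]) (by positivity)
  have h2 := (Real.lipschitzWith_sin.comp h1).dist_le_mul s t
  simpa [Real.dist_eq, Real.sin_arctan] using h2

theorem tendsto_boundedTransform_atTop : Tendsto boundedTransform atTop (𝓝 1) := by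
  have h : Tendsto (fun t => Real.sin (Real.arctan t)) atTop (𝓝 (Real.sin (Real.pi / 2))) :=
    (Real.continuous_sin.tendsto _).comp
      (Real.tendsto_arctan_atTop.mono_right nhdsWithin_le_nhds)
  rw [Real.sin_pi_div_two] at h
  exact h.congr fun t => Real.sin_arctan t

theorem norm_boundedTransform_mul_fejer_le (s v : ℝ) :
    ‖boundedTransform s * fejer v‖ ≤ fejer v := by
  rw [norm_mul, Real.norm_of_nonneg (fejer_nonneg v)]
  exact mul_le_of_le_one_left (fejer_nonneg v) (abs_boundedTransform_le s)

theorem integrable_boundedTransform_mul_fejer (δ t : ℝ) :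
    Integrable fun v => boundedTransform (t - δ * v) * fejer v :=
  integrable_fejer.mono' ((boundedTransform.continuous.comp (by fun_prop)).mul
    continuous_fejer).aestronglyMeasurable
    (Eventually.of_forall fun v => norm_boundedTransform_mul_fejer_le _ v)

/-- The convolution of `t ↦ t / √(1 + t²)` with the Fejér kernel at scale `δ`. -/
def smoothed (δ : ℝ) : ℝ →ᵇ ℝ :=
  BoundedContinuousFunction.ofNormedAddCommGroup
    (fun t => ∫ v, boundedTransform (t - δ * v) * fejer v)
    (continuous_of_dominated
      (fun t => (integrable_boundedTransform_mul_fejer δ t).aestronglyMeasurable)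
      (fun t => Eventually.of_forall fun v => norm_boundedTransform_mul_fejer_le _ v)
      integrable_fejer
      (Eventually.of_forall fun v => (boundedTransform.continuous.comp (by fun_prop)).mul
        continuous_const))
    1 (fun t => by
      rw [← integral_fejer]
      exact norm_integral_le_of_norm_le integrable_fejer
        (Eventually.of_forall fun v => norm_boundedTransform_mul_fejer_le _ v))

theorem smoothed_apply (δ t : ℝ) :
    smoothed δ t = ∫ v, boundedTransform (t - δ * v) * fejer v := rfl

theorem norm_smoothed_le (δ : ℝ) : ‖smoothed δ‖ ≤ 1 :=
  BoundedContinuousFunction.norm_ofNormedAddCommGroup_le _ zero_le_one _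

theorem smoothed_mem_Icc (δ t : ℝ) : smoothed δ t ∈ Set.Icc (-1 : ℝ) 1 :=
  abs_le.1 (((smoothed δ).norm_coe_le_norm t).trans (norm_smoothed_le δ))

theorem smoothed_neg (δ t : ℝ) : smoothed δ (-t) = -smoothed δ t := by
  rw [smoothed_apply, smoothed_apply, ← integral_neg, ← integral_neg_eq_self]
  refine integral_congr_ae (Eventually.of_forall fun v => ?_)
  change boundedTransform (-t - δ * -v) * fejer (-v) = -(boundedTransform (t - δ * v) * fejer v)
  rw [fejer_neg, show -t - δ * -v = -(t - δ * v) by ring, boundedTransform_neg, neg_mul]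

theorem tendsto_smoothed_atTop (δ : ℝ) : Tendsto (smoothed δ) atTop (𝓝 1) := by
  have h := tendsto_integral_filter_of_dominated_convergence (l := (atTop : Filter ℝ))
    (F := fun t v => boundedTransform (t - δ * v) * fejer v) (f := fejer) (μ := volume) fejer
    (Eventually.of_forall fun t => (integrable_boundedTransform_mul_fejer δ t).aestronglyMeasurable)
    (Eventually.of_forall fun t => Eventually.of_forall fun v =>
      norm_boundedTransform_mul_fejer_le _ v)
    integrable_fejer (Eventually.of_forall fun v => ?_)
  · rwa [integral_fejer] at h
  · have h1 : Tendsto (fun t => boundedTransform (t - δ * v)) atTop (𝓝 1) :=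
      tendsto_boundedTransform_atTop.comp (tendsto_atTop_add_const_right _ _ tendsto_id)
    simpa using h1.mul_const (fejer v)

/-- At small scales the convolution is uniformly close to the original function. -/
theorem exists_abs_boundedTransform_sub_smoothed_le {ε : ℝ} (hε : 0 < ε) :
    ∃ δ > 0, ∀ t, |boundedTransform t - smoothed δ t| ≤ ε := by
  have h := tendsto_integral_filter_of_dominated_convergence (l := 𝓝[>] (0 : ℝ))
    (F := fun δ v => min 2 (δ * |v|) * fejer v) (f := fun _ => 0) (μ := volume)
    (fun v => 2 * fejer v)
    (Eventually.of_forall fun δ => (Continuous.mul (by fun_prop)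
      continuous_fejer).aestronglyMeasurable)
    (eventually_mem_nhdsWithin.mono fun δ hδ => Eventually.of_forall fun v => by
      have hδ' : (0 : ℝ) < δ := hδ
      have := fejer_nonneg v
      rw [Real.norm_of_nonneg (by positivity)]
      gcongr
      exact min_le_left _ _)
    (integrable_fejer.const_mul 2) (Eventually.of_forall fun v => by
      have h1 : Tendsto (fun δ : ℝ => δ * |v|) (𝓝[>] 0) (𝓝 0) := by
        have : Tendsto (fun δ : ℝ => δ * |v|) (𝓝 0) (𝓝 (0 * |v|)) :=
          (continuous_id.mul continuous_const).tendsto _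
        rw [zero_mul] at this
        exact this.mono_left nhdsWithin_le_nhds
      have h2 := ((tendsto_const_nhds (x := (2 : ℝ))).min h1).mul_const (fejer v)
      rwa [min_eq_right (by norm_num), zero_mul] at h2)
  rw [integral_zero] at h
  obtain ⟨δ, hδε, hδ⟩ := ((h.eventually (gt_mem_nhds hε)).and eventually_mem_nhdsWithin).exists
  have hδ' : (0 : ℝ) < δ := hδ
  refine ⟨δ, hδ', fun t => ?_⟩
  have e : boundedTransform t - smoothed δ t =
      ∫ v, (boundedTransform t - boundedTransform (t - δ * v)) * fejer v := by
    simp only [sub_mul]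
    rw [integral_sub (integrable_fejer.const_mul _) (integrable_boundedTransform_mul_fejer δ t),
      integral_const_mul, integral_fejer, mul_one, smoothed_apply]
  rw [e, ← Real.norm_eq_abs]
  refine (norm_integral_le_of_norm_le (g := fun v => min 2 (δ * |v|) * fejer v) ?_
    (Eventually.of_forall fun v => ?_)).trans hδε.le
  · refine (integrable_fejer.const_mul 2).mono' (Continuous.mul (by fun_prop)
      continuous_fejer).aestronglyMeasurable (Eventually.of_forall fun v => ?_)
    have := fejer_nonneg v
    rw [Real.norm_of_nonneg (by positivity)]
    gcongr
    exact min_le_left _ _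
  · rw [norm_mul, Real.norm_of_nonneg (fejer_nonneg v)]
    refine mul_le_mul_of_nonneg_right (le_min ?_ ?_) (fejer_nonneg v)
    · have h1 := abs_boundedTransform_le t
      have h2 := abs_boundedTransform_le (t - δ * v)
      refine (norm_sub_le _ _).trans ?_
      rw [Real.norm_eq_abs, Real.norm_eq_abs]
      linarith
    · refine (abs_boundedTransform_sub_le _ _).trans_eq ?_
      rw [sub_sub_cancel, abs_mul, abs_of_pos hδ']

theorem tendsto_cocompact_zero_of_odd {h : ℝ → ℝ} (hodd : ∀ t, h (-t) = -h t)
    (htop : Tendsto h atTop (𝓝 0)) : Tendsto h (cocompact ℝ) (𝓝 0) := by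
  rw [cocompact_eq_atBot_atTop, tendsto_sup]
  refine ⟨?_, htop⟩
  have h1 := (htop.comp tendsto_neg_atBot_atTop).neg
  rw [neg_zero] at h1
  exact h1.congr fun t => by simp [hodd]

theorem tendsto_complexify_smoothed_sub (δ : ℝ) :
    Tendsto (complexify (smoothed δ) - boundedTransformShift 0) (cocompact ℝ) (𝓝 0) := by
  have h : Tendsto (fun t => smoothed δ t - boundedTransform t) (cocompact ℝ) (𝓝 0) := by
    refine tendsto_cocompact_zero_of_odd (fun t => ?_) ?_
    · rw [smoothed_neg, boundedTransform_neg]; ring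
    · have := (tendsto_smoothed_atTop δ).sub tendsto_boundedTransform_atTop
      rwa [sub_self] at this
  have h2 := (Complex.continuous_ofReal.tendsto 0).comp h
  rw [Complex.ofReal_zero] at h2
  refine h2.congr fun t => ?_
  simp

theorem tendsto_complexify_smoothed_sq_sub_one (δ : ℝ) :
    Tendsto (complexify (smoothed δ) ^ 2 - 1 : ℝ →ᵇ ℂ) (cocompact ℝ) (𝓝 0) := by
  have h1 : Tendsto (fun t => smoothed δ t ^ 2 - 1) atTop (𝓝 0) := by
    have := ((tendsto_smoothed_atTop δ).pow 2).sub_const 1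
    simpa using this
  have h : Tendsto (fun t => smoothed δ t ^ 2 - 1) (cocompact ℝ) (𝓝 0) := by
    rw [cocompact_eq_atBot_atTop, tendsto_sup]
    refine ⟨(h1.comp tendsto_neg_atBot_atTop).congr fun t => ?_, h1⟩
    simp [smoothed_neg]
  have h2 := (Complex.continuous_ofReal.tendsto 0).comp h
  rw [Complex.ofReal_zero] at h2
  refine h2.congr fun t => ?_
  simp

theorem complexify_boundedTransform : complexify boundedTransform = boundedTransformShift 0 := by
  ext t
  simp

variable {H : Type*} [NormedAddCommGroup H] [InnerProductSpace ℂ H] [CompleteSpace H]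
  {A A' : H →ₗ.[ℂ] H} (hA : IsDiagonal A) {hA' : IsDiagonal A'} {κ : ℝ}

/-- The smoothed function inherits the operator Lipschitz estimate of the bounded transform. -/
theorem RelBound.norm_smoothed_sub_comp_calculus_le {m : ℝ →ᵇ ℂ} (h : RelBound A A' hA' m κ)
    (δ : ℝ) : ‖(hA.calculus (complexify (smoothed δ)) - hA'.calculus (complexify (smoothed δ))) ∘L
      hA'.calculus m‖ ≤ κ := by
  refine (norm_calculus_sub_comp_le_integral hA hA' (μ := volume)
    (k := fun v => (fejer v : ℂ) • boundedTransformShift (δ * v)) (g := fejer)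
    (G := fun v => fejer v * κ) integrable_fejer (fun t => ?_) (fun v => ?_) (fun t => ?_)
    (integrable_fejer.mul_const κ) fun v => ?_).trans_eq ?_
  · refine Continuous.aestronglyMeasurable ?_
    change Continuous fun v : ℝ => (fejer v : ℂ) * ((boundedTransform (t - δ * v) : ℝ) : ℂ)
    exact (Complex.continuous_ofReal.comp continuous_fejer).mul
      (Complex.continuous_ofReal.comp (boundedTransform.continuous.comp (by fun_prop)))
  · rw [norm_smul, Complex.norm_real, Real.norm_of_nonneg (fejer_nonneg v)]
    exact mul_le_of_le_one_right (fejer_nonneg v) (norm_boundedTransformShift_le _)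
  · rw [complexify_apply, smoothed_apply, ← integral_complex_ofReal]
    refine integral_congr_ae (Eventually.of_forall fun v => ?_)
    simp [mul_comm]
  · rw [map_smul, map_smul, ← smul_sub, ContinuousLinearMap.smul_comp, norm_smul,
      Complex.norm_real, Real.norm_of_nonneg (fejer_nonneg v)]
    exact mul_le_mul_of_nonneg_left (h.norm_boundedTransformShift_sub_comp_calculus_le hA _)
      (fejer_nonneg v)
  · rw [integral_mul_const, integral_fejer, one_mul]

end Smoothing

/-! ### Clifford multiplication operators -/

section CliffordOperators

variable {E : Type*} [NormedAddCommGroup E] [InnerProductSpace ℝ E]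

theorem cvec_mul_add_mul (x y : E) :
    cvec x * cvec y + cvec y * cvec x = algebraMap ℂ (Cliff E) ((2 * inner ℝ x y : ℝ) : ℂ) := by
  have h := cvec_mul_self (x + y)
  rw [cvec_add, add_mul, mul_add, mul_add, cvec_mul_self, cvec_mul_self, norm_add_sq_real] at h
  push_cast [map_add] at h ⊢
  rw [← sub_eq_zero] at h ⊢
  rw [← h]
  abel

theorem grade_grade (w : Cliff E) : grade (grade w) = w :=
  CliffordAlgebra.involute_involute (Q := (normSqForm E).baseChange ℂ) w

variable [FiniteDimensional ℝ E]

theorem cvec_stdB_mul_self (i : Fin (finrank ℝ E)) : cvec (stdB E i) * cvec (stdB E i) = 1 := by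
  rw [cvec_mul_self, (stdB E).orthonormal.1 i]
  simp

theorem cvec_stdB_mul_stdB {i j : Fin (finrank ℝ E)} (h : i ≠ j) :
    cvec (stdB E i) * cvec (stdB E j) = -(cvec (stdB E j) * cvec (stdB E i)) := by
  have h1 := cvec_mul_add_mul (stdB E i) (stdB E j)
  rw [(stdB E).orthonormal.2 h] at h1
  rw [eq_neg_iff_add_eq_zero, h1]
  simp

/-- The product of basis vectors along a list of indices. -/
def listProd (l : List (Fin (finrank ℝ E))) : Cliff E := (l.map fun i => cvec (stdB E i)).prod

@[simp] theorem listProd_nil : listProd ([] : List (Fin (finrank ℝ E))) = 1 := rfl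

@[simp] theorem listProd_cons (i : Fin (finrank ℝ E)) (l : List (Fin (finrank ℝ E))) :
    listProd (i :: l) = cvec (stdB E i) * listProd l := by simp [listProd]

theorem listProd_sortedLT {l : List (Fin (finrank ℝ E))} (hl : l.Pairwise (· < ·)) :
    listProd l = cliffMonomial l.toFinset := by
  have h : l.toFinset.sort = l := (List.toFinset_sort (r := (· ≤ ·))
    (hl.imp fun h => h.ne)).2 (hl.imp fun h => h.le)
  rw [listProd, cliffMonomial]
  congr 1
  refine List.ext_get (by simp [List.toFinset_card_of_nodup (hl.imp fun h => h.ne)]) fun n h1 h2 => ?_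
  simp [Finset.orderEmbOfFin_apply, h]

/-- Multiplying an increasing product by a basis vector gives an increasing product up to sign: the
vector is moved to its place, where it cancels if it is already present. -/
theorem exists_mul_listProd (i : Fin (finrank ℝ E)) {l : List (Fin (finrank ℝ E))}
    (hl : l.Pairwise (· < ·)) : ∃ l' : List (Fin (finrank ℝ E)), l'.Pairwise (· < ·) ∧
      (∀ j ∈ l', j = i ∨ j ∈ l) ∧ ∃ ε : ℤˣ, cvec (stdB E i) * listProd l = ε • listProd l' := by
  induction l with
  | nil => exact ⟨[i], by simp, by simp, 1, by simp⟩
  | cons j l ih =>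
    obtain ⟨hj, hl2⟩ := List.pairwise_cons.1 hl
    rcases lt_trichotomy i j with hij | rfl | hij
    · refine ⟨i :: j :: l, ?_, by simp, 1, by simp⟩
      refine List.pairwise_cons.2 ⟨?_, List.pairwise_cons.2 ⟨hj, hl2⟩⟩
      intro k hk
      rcases List.mem_cons.1 hk with rfl | hk
      · exact hij
      · exact hij.trans (hj k hk)
    · refine ⟨l, hl2, fun k hk => Or.inr (List.mem_cons_of_mem _ hk), 1, ?_⟩
      rw [listProd_cons, ← mul_assoc, cvec_stdB_mul_self, one_mul, one_smul]
    · obtain ⟨l', hl', hmem, ε, hε⟩ := ih hl2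
      refine ⟨j :: l', List.pairwise_cons.2 ⟨fun k hk => ?_, hl'⟩, fun k hk => ?_, -ε, ?_⟩
      · rcases hmem k hk with rfl | hk
        · exact hij
        · exact hj k hk
      · rcases List.mem_cons.1 hk with rfl | hk
        · simp
        · rcases hmem k hk with rfl | hk
          · simp
          · simp [hk]
      · rw [listProd_cons, ← mul_assoc, cvec_stdB_mul_stdB hij.ne', neg_mul, mul_assoc, hε,
          listProd_cons, mul_smul_comm, Units.neg_smul]

theorem cliffMonomial_eq_listProd (I : Finset (Fin (finrank ℝ E))) :
    (cliffMonomial I : Cliff E) = listProd I.sort := by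
  rw [listProd_sortedLT (Finset.sortedLT_sort I).pairwise, Finset.sort_toFinset]

theorem exists_cvec_mul_cliffMonomial (i : Fin (finrank ℝ E)) (I : Finset (Fin (finrank ℝ E))) :
    ∃ (K : Finset (Fin (finrank ℝ E))) (ε : ℤˣ),
      cvec (stdB E i) * cliffMonomial I = ε • cliffMonomial K := by
  obtain ⟨l, hl, -, ε, hε⟩ := exists_mul_listProd i (Finset.sortedLT_sort I).pairwise
  exact ⟨l.toFinset, ε, by rw [cliffMonomial_eq_listProd, hε, listProd_sortedLT hl]⟩

theorem exists_grade_listProd_mul (i : Fin (finrank ℝ E)) (l : List (Fin (finrank ℝ E))) :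
    ∃ ε : ℤˣ, grade (listProd l) * cvec (stdB E i) = ε • (cvec (stdB E i) * listProd l) := by
  induction l with
  | nil => exact ⟨1, by simp⟩
  | cons j l ih =>
    obtain ⟨ε, hε⟩ := ih
    rcases eq_or_ne j i with rfl | hij
    · refine ⟨-ε, ?_⟩
      rw [listProd_cons, map_mul, grade_cvec, mul_assoc, hε, mul_smul_comm, Units.neg_smul, neg_mul,
        smul_neg]
    · refine ⟨ε, ?_⟩
      rw [listProd_cons, map_mul, grade_cvec, mul_assoc, hε, mul_smul_comm, neg_mul, ← mul_assoc,
        cvec_stdB_mul_stdB hij, neg_mul, neg_neg, mul_assoc]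

theorem exists_grade_cliffMonomial_mul (i : Fin (finrank ℝ E)) (I : Finset (Fin (finrank ℝ E))) :
    ∃ (K : Finset (Fin (finrank ℝ E))) (ε : ℤˣ),
      grade (cliffMonomial I) * cvec (stdB E i) = ε • cliffMonomial K := by
  obtain ⟨K, ε, h⟩ := exists_cvec_mul_cliffMonomial i I
  obtain ⟨ε', h'⟩ := exists_grade_listProd_mul i I.sort
  refine ⟨K, ε' * ε, ?_⟩
  rw [cliffMonomial_eq_listProd, h', ← cliffMonomial_eq_listProd, h, smul_smul]

/-- Sesquilinear identities on the Clifford algebra can be checked on monomials. -/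
theorem inner_eq_of_cliffMonomial {L : Cliff E →L[ℂ] Cliff E} {c : ℤˣ}
    (h : ∀ I J, inner ℂ (L (cliffMonomial I)) (cliffMonomial J : Cliff E) =
      c • inner ℂ (cliffMonomial I : Cliff E) (L (cliffMonomial J))) (u v : Cliff E) :
    inner ℂ (L u) v = c • inner ℂ u (L v) := by
  have hu : u ∈ Submodule.span ℂ (Set.range (cliffMonomial : _ → Cliff E)) := by
    rw [span_cliffMonomial]; trivial
  have hv : v ∈ Submodule.span ℂ (Set.range (cliffMonomial : _ → Cliff E)) := by
    rw [span_cliffMonomial]; trivial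
  induction hu, hv using Submodule.span_induction₂ with
  | mem_mem x y hx hy =>
    obtain ⟨I, rfl⟩ := hx
    obtain ⟨J, rfl⟩ := hy
    exact h I J
  | zero_left y hy => simp
  | zero_right x hx => simp
  | add_left x y z _ _ _ hx hy => rw [map_add, inner_add_left, hx, hy, inner_add_left, smul_add]
  | add_right x y z _ _ _ hx hy => rw [map_add, inner_add_right, hx, hy, inner_add_right, smul_add]
  | smul_left r x y _ _ h => rw [map_smul, inner_smul_left, inner_smul_left, h, mul_smul_comm]
  | smul_right r x y _ _ h => rw [map_smul, inner_smul_right, inner_smul_right, h, mul_smul_comm]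

theorem units_smul_eq_cast (ε : ℤˣ) (w : Cliff E) : ε • w = (((ε : ℤ) : ℝ) : ℂ) • w := by
  rcases Int.units_eq_one_or ε with rfl | rfl <;> simp

/-- An operator that permutes the monomials up to sign and squares to `c = ±1` is `c` times its
own adjoint. -/
theorem inner_eq_of_permutes {L : Cliff E →L[ℂ] Cliff E} {c : ℤˣ} (hL : ∀ w, L (L w) = c • w)
    (hp : ∀ I, ∃ (K : Finset (Fin (finrank ℝ E))) (ε : ℤˣ),
      L (cliffMonomial I) = ε • cliffMonomial K) (u v : Cliff E) :
    inner ℂ (L u) v = c • inner ℂ u (L v) := by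
  have hmap : ∀ (ε : ℤˣ) (w : Cliff E), L (ε • w) = ε • L w := fun ε w => by
    rw [units_smul_eq_cast, map_smul, ← units_smul_eq_cast]
  have key : ∀ (I J K : Finset (Fin (finrank ℝ E))) (ε : ℤˣ),
      L (cliffMonomial I) = ε • cliffMonomial K → K = J →
      inner ℂ (L (cliffMonomial I)) (cliffMonomial J : Cliff E) =
        c • inner ℂ (cliffMonomial I : Cliff E) (L (cliffMonomial J)) := by
    rintro I J K ε h rfl
    have h2 : L (cliffMonomial K) = (ε * c) • (cliffMonomial I : Cliff E) := by
      have h3 := congrArg L h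
      rw [hL, hmap] at h3
      rw [mul_smul, h3, smul_smul, Int.units_mul_self, one_smul]
    rw [h, h2, units_smul_eq_cast, units_smul_eq_cast, inner_smul_left, inner_smul_right,
      inner_self_eq_norm_sq_to_K, inner_self_eq_norm_sq_to_K, orthonormal_cliffMonomial.1,
      orthonormal_cliffMonomial.1]
    rcases Int.units_eq_one_or ε with rfl | rfl <;> rcases Int.units_eq_one_or c with rfl | rfl <;>
      simp
  refine inner_eq_of_cliffMonomial (fun I J => ?_) u v
  obtain ⟨K, ε, hK⟩ := hp I
  by_cases hKJ : K = J
  · exact key I J K ε hK hKJ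
  · have h1 : inner ℂ (L (cliffMonomial I)) (cliffMonomial J : Cliff E) = 0 := by
      rw [hK, units_smul_eq_cast, inner_smul_left, orthonormal_cliffMonomial.2 hKJ, mul_zero]
    obtain ⟨M, ε', hM⟩ := hp J
    by_cases hMI : M = I
    · have h2 := key J I M ε' hM hMI
      rw [inner_eq_zero_symm.1 h1, smul_zero] at h2
      rw [h1, inner_eq_zero_symm.1 h2, smul_zero]
    · rw [h1, hM, units_smul_eq_cast, inner_smul_right,
        orthonormal_cliffMonomial.2 (Ne.symm hMI), mul_zero, smul_zero]

theorem leftMul_add (x y : E) : leftMul (x + y) = leftMul x + leftMul y := by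
  ext w
  simp [cvec_add, add_mul]

theorem leftMul_smul (r : ℝ) (x : E) : leftMul (r • x) = (r : ℂ) • leftMul x := by
  ext w
  simp [cvec_smul]

theorem hatMul_add (x y : E) : hatMul (x + y) = hatMul x + hatMul y := by
  ext w
  simp [cvec_add, mul_add]

theorem hatMul_smul (r : ℝ) (x : E) : hatMul (r • x) = (r : ℂ) • hatMul x := by
  ext w
  simp [cvec_smul]

theorem span_stdB_induction {p : E → Prop} (h0 : p 0) (hadd : ∀ x y, p x → p y → p (x + y))
    (hsmul : ∀ (r : ℝ) x, p x → p (r • x)) (hb : ∀ i, p (stdB E i)) (x : E) : p x := by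
  have hx : x ∈ Submodule.span ℝ (Set.range (stdB E)) := by
    rw [← (stdB E).coe_toBasis, (stdB E).toBasis.span_eq]; trivial
  induction hx using Submodule.span_induction with
  | mem x hx => obtain ⟨i, rfl⟩ := hx; exact hb i
  | zero => exact h0
  | add x y _ _ hx hy => exact hadd x y hx hy
  | smul r x _ hx => exact hsmul r x hx

/-- Left Clifford multiplication by a vector is self-adjoint. -/
theorem inner_leftMul (x : E) (u v : Cliff E) :
    inner ℂ (leftMul x u) v = inner ℂ u (leftMul x v) := by
  induction x using span_stdB_induction with
  | h0 =>
    have : leftMul (0 : E) = 0 := by simpa using leftMul_smul 0 (0 : E)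
    simp [this]
  | hadd x y hx hy =>
    rw [leftMul_add, add_apply, add_apply, inner_add_left, inner_add_right, hx, hy]
  | hsmul r x hx =>
    rw [leftMul_smul, smul_apply, smul_apply, inner_smul_left, inner_smul_right,
      Complex.conj_ofReal, hx]
  | hb i =>
    have := inner_eq_of_permutes (L := leftMul (stdB E i)) (c := 1) (fun w => by
      rw [leftMul_apply, leftMul_apply, ← mul_assoc, cvec_stdB_mul_self, one_mul, one_smul])
      (exists_cvec_mul_cliffMonomial i) u v
    rwa [one_smul] at this

theorem hatMul_hatMul_self (x : E) (w : Cliff E) :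
    hatMul x (hatMul x w) = -((‖x‖ ^ 2 : ℝ) : ℂ) • w := by
  rw [hatMul_apply, hatMul_apply, map_mul, grade_grade, grade_cvec, mul_neg, neg_mul, mul_assoc,
    cvec_mul_self, neg_smul, Algebra.smul_def, Algebra.commutes]

theorem leftMul_leftMul_self (x : E) (w : Cliff E) :
    leftMul x (leftMul x w) = ((‖x‖ ^ 2 : ℝ) : ℂ) • w := by
  rw [leftMul_apply, leftMul_apply, ← mul_assoc, cvec_mul_self, Algebra.smul_def]

/-- The operators `w ↦ (-1)^{∂w} w · x` are skew-adjoint. -/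
theorem inner_hatMul (x : E) (u v : Cliff E) :
    inner ℂ (hatMul x u) v = -inner ℂ u (hatMul x v) := by
  induction x using span_stdB_induction with
  | h0 =>
    have : hatMul (0 : E) = 0 := by simpa using hatMul_smul 0 (0 : E)
    simp [this]
  | hadd x y hx hy =>
    rw [hatMul_add, add_apply, add_apply, inner_add_left, inner_add_right, hx, hy, neg_add]
  | hsmul r x hx =>
    rw [hatMul_smul, smul_apply, smul_apply, inner_smul_left, inner_smul_right,
      Complex.conj_ofReal, hx, mul_neg]
  | hb i =>
    have := inner_eq_of_permutes (L := hatMul (stdB E i)) (c := -1) (fun w => by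
      rw [hatMul_hatMul_self, (stdB E).orthonormal.1 i]; simp)
      (exists_grade_cliffMonomial_mul i) u v
    rwa [Units.neg_smul, one_smul] at this

theorem norm_leftMul (x : E) (w : Cliff E) : ‖leftMul x w‖ = ‖x‖ * ‖w‖ := by
  rw [← sq_eq_sq₀ (norm_nonneg _) (by positivity), mul_pow, norm_sq_eq_re_inner (𝕜 := ℂ),
    inner_leftMul, leftMul_leftMul_self, inner_smul_right]
  exact (Complex.re_ofReal_mul _ _).trans (congrArg _ (norm_sq_eq_re_inner (𝕜 := ℂ) w).symm)

theorem norm_hatMul (x : E) (w : Cliff E) : ‖hatMul x w‖ = ‖x‖ * ‖w‖ := by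
  rw [← sq_eq_sq₀ (norm_nonneg _) (by positivity), mul_pow, norm_sq_eq_re_inner (𝕜 := ℂ),
    inner_hatMul, hatMul_hatMul_self, inner_smul_right, neg_mul, neg_neg]
  exact (Complex.re_ofReal_mul _ _).trans (congrArg _ (norm_sq_eq_re_inner (𝕜 := ℂ) w).symm)

theorem leftMul_hatMul (x y : E) (w : Cliff E) :
    leftMul x (hatMul y w) = -hatMul y (leftMul x w) := by
  simp [grade_cvec, mul_assoc]

theorem hatMul_hatMul_add (x y : E) (w : Cliff E) : hatMul x (hatMul y w) + hatMul y (hatMul x w) =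
    -((2 * inner ℝ x y : ℝ) : ℂ) • w := by
  have h := cvec_mul_add_mul x y
  simp only [hatMul_apply, map_mul, grade_grade, grade_cvec, mul_neg, neg_mul, mul_assoc]
  rw [← neg_add, ← mul_add, add_comm, h, neg_smul, Algebra.smul_def, Algebra.commutes]

end CliffordOperators

/-! ### The algebra of the Bott-Dirac operators -/

section Generators

variable {E : Type*} [NormedAddCommGroup E] [InnerProductSpace ℝ E] [FiniteDimensional ℝ E]

variable (E) in
/-- The partial derivative `∂ / ∂xᵢ` on Schwartz functions. -/
def derivOp (i : Fin (finrank ℝ E)) : Module.End ℂ 𝓢(E, Cliff E) :=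
  (LineDeriv.lineDerivOpCLM ℂ 𝓢(E, Cliff E) (stdB E i)).toLinearMap

/-- The `i`-th coordinate of `y - x`, as a complex number. -/
def coordFun (x : E) (i : Fin (finrank ℝ E)) (y : E) : ℂ := (inner ℝ (stdB E i) (y - x) : ℝ)

/-- Multiplication of Schwartz functions by the `i`-th coordinate centred at `x`. -/
def coordOp (x : E) (i : Fin (finrank ℝ E)) : Module.End ℂ 𝓢(E, Cliff E) :=
  (SchwartzMap.smulLeftCLM (Cliff E) (coordFun x i)).toLinearMap

/-- A linear map of the Clifford algebra, applied pointwise to Schwartz functions. -/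
def postOp (L : Cliff E →L[ℂ] Cliff E) : Module.End ℂ 𝓢(E, Cliff E) :=
  (SchwartzMap.postcompCLM L).toLinearMap

theorem postOp_apply (L : Cliff E →L[ℂ] Cliff E) (u : 𝓢(E, Cliff E)) (y : E) :
    postOp L u y = L (u y) := rfl

variable (E) in
/-- Left Clifford multiplication by `eᵢ` on Schwartz functions. -/
def leftOp (i : Fin (finrank ℝ E)) : Module.End ℂ 𝓢(E, Cliff E) :=
  postOp (leftMul (stdB E i))

variable (E) in
/-- The operator `êᵢ` on Schwartz functions. -/
def hatOp (i : Fin (finrank ℝ E)) : Module.End ℂ 𝓢(E, Cliff E) :=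
  postOp (hatMul (stdB E i))

theorem hasTemperateGrowth_coordFun (x : E) (i : Fin (finrank ℝ E)) :
    (coordFun x i).HasTemperateGrowth := by
  have h : (fun y : E => inner ℝ (stdB E i) (y - x)).HasTemperateGrowth := by
    have : (fun y : E => inner ℝ (stdB E i) (y - x)) =
        (fun y => inner ℝ (stdB E i) y) - fun _ => inner ℝ (stdB E i) x := by
      ext y; simp [inner_sub_right]
    rw [this]
    exact (Function.hasTemperateGrowth_inner_right _).sub (Function.HasTemperateGrowth.const _)
  exact Function.HasTemperateGrowth.comp Function.Complex.hasTemperateGrowth_ofReal h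

theorem derivOp_apply (i : Fin (finrank ℝ E)) (u : 𝓢(E, Cliff E)) (y : E) :
    derivOp E i u y = fderiv ℝ u y (stdB E i) :=
  SchwartzMap.lineDerivOp_apply_eq_fderiv _ _ _

theorem coordOp_apply (x : E) (i : Fin (finrank ℝ E)) (u : 𝓢(E, Cliff E)) (y : E) :
    coordOp x i u y = coordFun x i y • u y :=
  SchwartzMap.smulLeftCLM_apply_apply (hasTemperateGrowth_coordFun x i) u y

theorem sum_coordFun_smul_leftMul (x y : E) :
    ∑ i, coordFun x i y • leftMul (stdB E i) = leftMul (y - x) := by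
  have h := (stdB E).sum_repr' (y - x)
  have hsum : ∀ s : Finset (Fin (finrank ℝ E)),
      leftMul (∑ i ∈ s, inner ℝ (stdB E i) (y - x) • stdB E i) =
        ∑ i ∈ s, coordFun x i y • leftMul (stdB E i) := by
    intro s
    induction s using Finset.cons_induction with
    | empty => simpa using leftMul_smul 0 (0 : E)
    | cons a s ha ih => rw [Finset.sum_cons, Finset.sum_cons, leftMul_add, ih, leftMul_smul]; rfl
  rw [← hsum, h]

theorem hasFDerivAt_coordFun (x : E) (i : Fin (finrank ℝ E)) (y : E) :
    HasFDerivAt (coordFun x i)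
      (Complex.ofRealCLM ∘L (innerSL ℝ (stdB E i))) y := by
  have h : HasFDerivAt (fun y : E => innerSL ℝ (stdB E i) (y - x)) (innerSL ℝ (stdB E i)) y :=
    (innerSL ℝ (stdB E i)).hasFDerivAt.comp y ((hasFDerivAt_id y).sub_const x)
  exact Complex.ofRealCLM.hasFDerivAt.comp y h

/-! The commutation relations of the generators. -/

theorem derivOp_mul_coordOp (x : E) (i j : Fin (finrank ℝ E)) :
    derivOp E i * coordOp x j = coordOp x j * derivOp E i + if i = j then 1 else 0 := by
  refine LinearMap.ext fun u => SchwartzMap.ext fun y => ?_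
  have h1 : (coordOp x j u : E → Cliff E) = fun y => coordFun x j y • u y :=
    funext fun y => coordOp_apply x j u y
  have h2 := ((hasFDerivAt_coordFun x j y).smul (u.hasFDerivAt y)).fderiv
  have h3 : (derivOp E i * coordOp x j) u y = fderiv ℝ (coordOp x j u) y (stdB E i) :=
    derivOp_apply _ _ _
  have h4 : (coordOp x j * derivOp E i) u y = coordFun x j y • fderiv ℝ u y (stdB E i) := by
    rw [← derivOp_apply]; exact coordOp_apply _ _ _ _
  rw [h3, h1, LinearMap.add_apply, add_apply, h4]
  have h5 : fderiv ℝ (fun y => coordFun x j y • u y) y (stdB E i) =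
      coordFun x j y • fderiv ℝ u y (stdB E i) +
        ((inner ℝ (stdB E j) (stdB E i) : ℝ) : ℂ) • u y := by
    refine (congrFun (congrArg DFunLike.coe h2) (stdB E i)).trans ?_
    simp
  rw [h5, orthonormal_iff_ite.1 (stdB E).orthonormal]
  rcases eq_or_ne i j with rfl | hij
  · simp
  · simp [hij, hij.symm]

theorem commute_derivOp (i j : Fin (finrank ℝ E)) : Commute (derivOp E i) (derivOp E j) := by
  refine LinearMap.ext fun u => SchwartzMap.ext fun y => ?_
  have h : ∀ a b, (derivOp E a * derivOp E b) u y =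
      fderiv ℝ (fderiv ℝ u) y (stdB E a) (stdB E b) := fun a b => by
    have h1 : (derivOp E b u : E → Cliff E) = fun y => fderiv ℝ u y (stdB E b) :=
      funext fun y => derivOp_apply b u y
    have h2 : (derivOp E a * derivOp E b) u y = fderiv ℝ (derivOp E b u) y (stdB E a) :=
      derivOp_apply _ _ _
    have h3 : DifferentiableAt ℝ (fderiv ℝ u) y :=
      ((u.smooth 2).fderiv_right (m := 1) (by norm_num)).differentiable (by norm_num) y
    rw [h2, h1, fderiv_clm_apply h3 (differentiableAt_const _)]
    simp
  rw [h, h]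
  exact ((u.smooth 2).contDiffAt.isSymmSndFDerivAt (by simp)).eq _ _

theorem commute_coordOp (x : E) (i j : Fin (finrank ℝ E)) :
    Commute (coordOp x i) (coordOp x j) := by
  refine LinearMap.ext fun u => SchwartzMap.ext fun y => ?_
  change coordOp x i (coordOp x j u) y = coordOp x j (coordOp x i u) y
  simp only [coordOp_apply]
  exact smul_comm _ _ _

theorem commute_derivOp_postcomp (i : Fin (finrank ℝ E)) (L : Cliff E →L[ℂ] Cliff E) :
    Commute (derivOp E i) (postOp L) := by
  refine LinearMap.ext fun u => SchwartzMap.ext fun y => ?_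
  have h1 : (derivOp E i * postOp L) u y =
      fderiv ℝ (fun y => L (u y)) y (stdB E i) := derivOp_apply _ _ _
  have h2 : (postOp L * derivOp E i) u y =
      L (fderiv ℝ u y (stdB E i)) := by rw [← derivOp_apply]; rfl
  rw [h1, h2]
  have h3 := ((L.restrictScalars ℝ).hasFDerivAt.comp y (u.hasFDerivAt y)).fderiv
  exact congrFun (congrArg DFunLike.coe h3) (stdB E i)

theorem commute_coordOp_postcomp (x : E) (i : Fin (finrank ℝ E)) (L : Cliff E →L[ℂ] Cliff E) :
    Commute (coordOp x i) (postOp L) := by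
  refine LinearMap.ext fun u => SchwartzMap.ext fun y => ?_
  change coordOp x i (postOp L u) y = L (coordOp x i u y)
  rw [coordOp_apply, coordOp_apply, map_smul]
  rfl

theorem leftOp_mul_hatOp (i j : Fin (finrank ℝ E)) :
    leftOp E i * hatOp E j = -(hatOp E j * leftOp E i) :=
  LinearMap.ext fun u => SchwartzMap.ext fun y => leftMul_hatMul _ _ (u y)

theorem inner_stdB (i j : Fin (finrank ℝ E)) :
    inner ℝ (stdB E i) (stdB E j) = if i = j then 1 else 0 :=
  orthonormal_iff_ite.1 (stdB E).orthonormal i j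

theorem hatOp_mul_hatOp_add (i j : Fin (finrank ℝ E)) :
    hatOp E i * hatOp E j + hatOp E j * hatOp E i = if i = j then -2 else 0 := by
  refine LinearMap.ext fun u => SchwartzMap.ext fun y => ?_
  refine (hatMul_hatMul_add _ _ (u y)).trans ?_
  rw [inner_stdB]
  split_ifs
  · have : (-2 : Module.End ℂ 𝓢(E, Cliff E)) u = (-2 : ℂ) • u := by
      rw [LinearMap.neg_apply, neg_smul]
      exact congrArg Neg.neg ((Module.End.ofNat_apply 2 u).trans (by norm_num [two_smul]))
    rw [this]
    simp
  · simp

theorem leftOp_mul_leftOp_add (i j : Fin (finrank ℝ E)) :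
    leftOp E i * leftOp E j + leftOp E j * leftOp E i = if i = j then 2 else 0 := by
  refine LinearMap.ext fun u => SchwartzMap.ext fun y => ?_
  have h : leftMul (stdB E i) (leftMul (stdB E j) (u y)) +
      leftMul (stdB E j) (leftMul (stdB E i) (u y)) =
      ((2 * inner ℝ (stdB E i) (stdB E j) : ℝ) : ℂ) • u y := by
    simp only [leftMul_apply, ← mul_assoc]
    rw [← add_mul, cvec_mul_add_mul, Algebra.smul_def]
  refine h.trans ?_
  rw [inner_stdB]
  split_ifs
  · have : (2 : Module.End ℂ 𝓢(E, Cliff E)) u = (2 : ℂ) • u :=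
      (Module.End.ofNat_apply 2 u).trans (by norm_num [two_smul])
    rw [this]; simp
  · simp

/-- The operator `C - c_x` of Clifford multiplication by `y - x`. -/
def bottShift (x : E) : Module.End ℂ 𝓢(E, Cliff E) := bottOp E - cliffOp x

theorem bottShift_apply (x : E) (u : 𝓢(E, Cliff E)) (y : E) :
    bottShift x u y = leftMul (y - x) (u y) := by
  have h : cvec (y - x) = cvec y - cvec x := by
    have := cvec_add (y - x) x
    rw [sub_add_cancel] at this
    rw [this, add_sub_cancel_right]
  rw [leftMul_apply, h, sub_mul]
  rfl

theorem bottShift_eq_sum (x : E) : bottShift x = ∑ i, leftOp E i * coordOp x i := by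
  refine LinearMap.ext fun u => SchwartzMap.ext fun y => ?_
  rw [bottShift_apply, ← sum_coordFun_smul_leftMul x y, LinearMap.sum_apply]
  simp only [sum_apply]
  refine Finset.sum_congr rfl fun i _ => ?_
  change _ = leftMul (stdB E i) (coordOp x i u y)
  rw [coordOp_apply, map_smul]
  rfl

theorem diracOp_eq_sum : diracOp E = ∑ i, hatOp E i * derivOp E i := rfl

theorem bottDiracSchwartz_eq (s : ℝ) (x : E) :
    bottDiracSchwartz s x = ((s⁻¹ : ℝ) : ℂ) • diracOp E + bottShift x := by
  rw [bottDiracSchwartz, bottShift, add_sub_assoc]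

theorem bottDiracSchwartz_sub_left (s s' : ℝ) (x : E) (u : 𝓢(E, Cliff E)) :
    bottDiracSchwartz s' x u - bottDiracSchwartz s x u =
      ((s'⁻¹ - s⁻¹ : ℝ) : ℂ) • diracOp E u := by
  rw [bottDiracSchwartz_eq, bottDiracSchwartz_eq]
  simp only [LinearMap.add_apply, LinearMap.smul_apply]
  rw [Complex.ofReal_sub, sub_smul]
  abel

variable (E) in
/-- The operator `N = ∑ᵢ êᵢ eᵢ`, which multiplies a monomial of degree `k` by `2k - d`. -/
def numberOp : Module.End ℂ 𝓢(E, Cliff E) := ∑ i, hatOp E i * leftOp E i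

/-- The anticommutator of the Dirac and the Bott operator is the bounded operator `N`. -/
theorem diracOp_mul_bottShift_add (x : E) :
    diracOp E * bottShift x + bottShift x * diracOp E = numberOp E := by
  have h : ∀ i j : Fin (finrank ℝ E), hatOp E i * derivOp E i * (leftOp E j * coordOp x j) +
      leftOp E j * coordOp x j * (hatOp E i * derivOp E i) =
      if i = j then hatOp E i * leftOp E j else 0 := by
    intro i j
    have c1 : derivOp E i * leftOp E j = leftOp E j * derivOp E i :=
      commute_derivOp_postcomp i (leftMul (stdB E j))
    have c2 : coordOp x j * hatOp E i = hatOp E i * coordOp x j :=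
      commute_coordOp_postcomp x j (hatMul (stdB E i))
    have e1 : hatOp E i * derivOp E i * (leftOp E j * coordOp x j) =
        hatOp E i * leftOp E j * (derivOp E i * coordOp x j) := by
      simp only [mul_assoc]; rw [← mul_assoc (derivOp E i), c1, mul_assoc]
    have e2 : leftOp E j * coordOp x j * (hatOp E i * derivOp E i) =
        -(hatOp E i * leftOp E j * (coordOp x j * derivOp E i)) := by
      rw [mul_assoc, ← mul_assoc (coordOp x j), c2, mul_assoc, ← mul_assoc, leftOp_mul_hatOp,
        neg_mul]
    rw [e1, e2, derivOp_mul_coordOp, mul_add, add_neg_cancel_comm]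
    split_ifs <;> simp
  rw [diracOp_eq_sum, bottShift_eq_sum, numberOp, Finset.sum_mul_sum, Finset.sum_mul_sum,
    Finset.sum_comm (γ := Fin (finrank ℝ E)) (f := fun i j => leftOp E i * _ * (hatOp E j * _)),
    ← Finset.sum_add_distrib]
  refine Finset.sum_congr rfl fun i _ => ?_
  rw [← Finset.sum_add_distrib, Finset.sum_congr rfl fun j _ => h i j]
  simp

/-- If `aᵢ` anticommute up to a constant and commute with the commuting `bᵢ`, then
`(∑ aᵢ bᵢ)² = c ∑ bᵢ²`. -/
theorem sum_mul_self_of_anticommute {R ι : Type*} [Ring R] [Algebra ℂ R] [Fintype ι] [DecidableEq ι]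
    {a b : ι → R} {c : ℂ} (ha : ∀ i j, a i * a j + a j * a i = if i = j then (2 * c) • 1 else 0)
    (hab : ∀ i j, Commute (a i) (b j)) (hb : ∀ i j, Commute (b i) (b j)) :
    (∑ i, a i * b i) * (∑ i, a i * b i) = c • ∑ i, b i * b i := by
  have e : ∀ i j, a i * b i * (a j * b j) = a i * a j * (b i * b j) := fun i j => by
    rw [mul_assoc, ← mul_assoc (b i), ← (hab j i).eq]; simp only [mul_assoc]
  have h2 : (2 : ℂ) • ((∑ i, a i * b i) * (∑ i, a i * b i)) = (2 : ℂ) • (c • ∑ i, b i * b i) := by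
    rw [two_smul, Finset.sum_mul_sum]
    nth_rw 2 [Finset.sum_comm]
    rw [← Finset.sum_add_distrib, smul_smul, Finset.smul_sum]
    refine Finset.sum_congr rfl fun i _ => ?_
    rw [← Finset.sum_add_distrib]
    have e2 : ∀ j, a i * b i * (a j * b j) + a j * b j * (a i * b i) =
        if i = j then (2 * c) • (b i * b j) else 0 := fun j => by
      rw [e, e, (hb j i).eq, ← add_mul, ha]
      split_ifs <;> simp
    rw [Finset.sum_congr rfl fun j _ => e2 j]
    simp
  have := congrArg (fun w => (2 : ℂ)⁻¹ • w) h2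
  simpa [smul_smul] using this

theorem diracOp_mul_self : diracOp E * diracOp E = -∑ i, derivOp E i * derivOp E i := by
  classical
  have h := sum_mul_self_of_anticommute (a := hatOp E) (b := derivOp E) (c := -1) (fun i j => by
    rw [hatOp_mul_hatOp_add]
    split_ifs
    · rw [mul_neg, mul_one, neg_smul, ofNat_smul_eq_nsmul]; norm_num
    · rfl)
    (fun i j => (commute_derivOp_postcomp j _).symm) commute_derivOp
  rw [diracOp_eq_sum, h, neg_smul, one_smul]

theorem bottShift_mul_self (x : E) :
    bottShift x * bottShift x = ∑ i, coordOp x i * coordOp x i := by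
  classical
  have h := sum_mul_self_of_anticommute (a := leftOp E) (b := coordOp x) (c := 1) (fun i j => by
    rw [leftOp_mul_leftOp_add]
    split_ifs
    · rw [mul_one, ofNat_smul_eq_nsmul]; norm_num
    · rfl)
    (fun i j => (commute_coordOp_postcomp x j _).symm) (commute_coordOp x)
  rw [bottShift_eq_sum, h, one_smul]

theorem bottDiracSchwartz_mul_self (s : ℝ) (x : E) :
    bottDiracSchwartz s x * bottDiracSchwartz s x =
      (((s⁻¹) ^ 2 : ℝ) : ℂ) • (diracOp E * diracOp E) + bottShift x * bottShift x +
        ((s⁻¹ : ℝ) : ℂ) • numberOp E := by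
  rw [bottDiracSchwartz_eq, ← diracOp_mul_bottShift_add x]
  simp only [add_mul, mul_add, smul_mul_assoc, mul_smul_comm, smul_smul, smul_add]
  rw [Complex.ofReal_pow, sq]
  abel

end Generators

/-! ### Symmetry and norm identities in `L²` -/

section Symmetry

variable {E : Type*} [NormedAddCommGroup E] [InnerProductSpace ℝ E] [FiniteDimensional ℝ E]
  [MeasurableSpace E] [BorelSpace E]

theorem inner_schwartzIncl (u v : 𝓢(E, Cliff E)) :
    inner ℂ (schwartzIncl E u) (schwartzIncl E v) = ∫ y, inner ℂ (u y) (v y) :=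
  SchwartzMap.inner_toL2_toL2_eq u v

theorem schwartzIncl_ae (u : 𝓢(E, Cliff E)) : schwartzIncl E u =ᵐ[volume] u :=
  SchwartzMap.coeFn_toLp u 2 volume

/-- `P'` is a formal adjoint of `P` on Schwartz functions, with respect to the inner product
of `L²`. -/
def FormalAdjoint (P P' : Module.End ℂ 𝓢(E, Cliff E)) : Prop :=
  ∀ u v, inner ℂ (schwartzIncl E (P u)) (schwartzIncl E v) =
    inner ℂ (schwartzIncl E u) (schwartzIncl E (P' v))

namespace FormalAdjoint

variable {P P' Q Q' : Module.End ℂ 𝓢(E, Cliff E)}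

theorem add (hP : FormalAdjoint P P') (hQ : FormalAdjoint Q Q') :
    FormalAdjoint (P + Q) (P' + Q') := fun u v => by
  simp only [LinearMap.add_apply, map_add, inner_add_left, inner_add_right, hP u v, hQ u v]

theorem sum {ι : Type*} {s : Finset ι} {P P' : ι → Module.End ℂ 𝓢(E, Cliff E)}
    (h : ∀ i, FormalAdjoint (P i) (P' i)) : FormalAdjoint (∑ i ∈ s, P i) (∑ i ∈ s, P' i) :=
  fun u v => by
    simp only [LinearMap.sum_apply, map_sum, sum_inner, inner_sum, h _ u v]

theorem mul (hP : FormalAdjoint P P') (hQ : FormalAdjoint Q Q') :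
    FormalAdjoint (P * Q) (Q' * P') := fun _ _ => (hP _ _).trans (hQ _ _)

theorem ofReal_smul (hP : FormalAdjoint P P') (r : ℝ) :
    FormalAdjoint ((r : ℂ) • P) ((r : ℂ) • P') := fun u v => by
  simp only [LinearMap.smul_apply, map_smul, inner_smul_left, inner_smul_right, hP u v,
    Complex.conj_ofReal]

end FormalAdjoint

theorem formalAdjoint_derivOp (i : Fin (finrank ℝ E)) :
    FormalAdjoint (derivOp E i) (-derivOp E i) := fun u v => by
  rw [LinearMap.neg_apply, map_neg, inner_neg_right, inner_schwartzIncl, inner_schwartzIncl]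
  have h := SchwartzMap.integral_bilinear_lineDerivOp_right_eq_neg_left (μ := volume) u v
    (isBoundedBilinearMap_inner (𝕜 := ℂ) (E := Cliff E)).toContinuousLinearMap (stdB E i)
  rw [eq_neg_iff_add_eq_zero, add_comm, ← eq_neg_iff_add_eq_zero]
  exact h

theorem formalAdjoint_coordOp (x : E) (i : Fin (finrank ℝ E)) :
    FormalAdjoint (coordOp x i) (coordOp x i) := fun u v => by
  rw [inner_schwartzIncl, inner_schwartzIncl]
  refine integral_congr_ae (Eventually.of_forall fun y => ?_)
  simp only [coordOp_apply, inner_smul_left, inner_smul_right]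
  rw [coordFun, Complex.conj_ofReal]

theorem formalAdjoint_postOp {L L' : Cliff E →L[ℂ] Cliff E}
    (h : ∀ u v, inner ℂ (L u) v = inner ℂ u (L' v)) : FormalAdjoint (postOp L) (postOp L') :=
  fun u v => by
    rw [inner_schwartzIncl, inner_schwartzIncl]
    exact integral_congr_ae (Eventually.of_forall fun y => h _ _)

theorem formalAdjoint_leftOp (i : Fin (finrank ℝ E)) :
    FormalAdjoint (leftOp E i) (leftOp E i) := formalAdjoint_postOp (inner_leftMul _)

theorem formalAdjoint_hatOp (i : Fin (finrank ℝ E)) :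
    FormalAdjoint (hatOp E i) (-hatOp E i) := fun u v => by
  rw [LinearMap.neg_apply, map_neg, inner_neg_right, inner_schwartzIncl, inner_schwartzIncl,
    ← integral_neg]
  exact integral_congr_ae (Eventually.of_forall fun y => inner_hatMul _ _ _)

theorem formalAdjoint_diracOp : FormalAdjoint (diracOp E) (diracOp E) := by
  have h := FormalAdjoint.sum (s := Finset.univ)
    fun i => (formalAdjoint_hatOp (E := E) i).mul (formalAdjoint_derivOp i)
  have e : ∀ i, -derivOp E i * -hatOp E i = hatOp E i * derivOp E i := fun i => by
    rw [neg_mul_neg]; exact (commute_derivOp_postcomp i _).eq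
  rw [diracOp_eq_sum]
  rwa [Finset.sum_congr rfl fun i _ => e i] at h

theorem formalAdjoint_bottShift (x : E) : FormalAdjoint (bottShift x) (bottShift x) := by
  have h := FormalAdjoint.sum (s := Finset.univ)
    fun i => (formalAdjoint_leftOp (E := E) i).mul (formalAdjoint_coordOp x i)
  have e : ∀ i, coordOp x i * leftOp E i = leftOp E i * coordOp x i := fun i =>
    (commute_coordOp_postcomp x i _).eq
  rw [bottShift_eq_sum]
  rwa [Finset.sum_congr rfl fun i _ => e i] at h

theorem formalAdjoint_bottDiracSchwartz (s : ℝ) (x : E) :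
    FormalAdjoint (bottDiracSchwartz s x) (bottDiracSchwartz s x) := by
  rw [bottDiracSchwartz_eq]
  exact (formalAdjoint_diracOp.ofReal_smul _).add (formalAdjoint_bottShift x)

theorem norm_postOp {L : Cliff E →L[ℂ] Cliff E} (h : ∀ w, ‖L w‖ = ‖w‖) (u : 𝓢(E, Cliff E)) :
    ‖schwartzIncl E (postOp L u)‖ = ‖schwartzIncl E u‖ := by
  rw [← sq_eq_sq₀ (norm_nonneg _) (norm_nonneg _), norm_sq_eq_re_inner (𝕜 := ℂ),
    norm_sq_eq_re_inner (𝕜 := ℂ), inner_schwartzIncl, inner_schwartzIncl]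
  congr 1
  refine integral_congr_ae (Eventually.of_forall fun y => ?_)
  simp only [inner_self_eq_norm_sq_to_K]
  rw [postOp_apply, h]

theorem norm_hatOp_leftOp (i : Fin (finrank ℝ E)) (u : 𝓢(E, Cliff E)) :
    ‖schwartzIncl E (hatOp E i (leftOp E i u))‖ = ‖schwartzIncl E u‖ := by
  have h1 : ‖stdB E i‖ = 1 := (stdB E).orthonormal.1 i
  rw [hatOp, norm_postOp fun w => by rw [norm_hatMul, h1, one_mul], leftOp,
    norm_postOp fun w => by rw [norm_leftMul, h1, one_mul]]

theorem norm_numberOp_le (u : 𝓢(E, Cliff E)) :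
    ‖schwartzIncl E (numberOp E u)‖ ≤ finrank ℝ E * ‖schwartzIncl E u‖ := by
  rw [numberOp, LinearMap.sum_apply, map_sum]
  refine (norm_sum_le _ _).trans_eq ?_
  refine (Finset.sum_congr rfl fun i _ => norm_hatOp_leftOp i u).trans ?_
  simp

theorem FormalAdjoint.norm_sq {P : Module.End ℂ 𝓢(E, Cliff E)} (h : FormalAdjoint P P)
    (u : 𝓢(E, Cliff E)) : ‖schwartzIncl E (P u)‖ ^ 2 =
      (inner ℂ (schwartzIncl E u) (schwartzIncl E ((P * P) u))).re := by
  rw [Module.End.mul_apply, ← h]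
  exact norm_sq_eq_re_inner (𝕜 := ℂ) _

/-- The Bochner-type identity `‖Bu‖² = s⁻² ‖Du‖² + ‖(C - c_x)u‖² + s⁻¹ ⟨u, Nu⟩`. -/
theorem norm_bottDiracSchwartz_sq (s : ℝ) (x : E) (u : 𝓢(E, Cliff E)) :
    ‖schwartzIncl E (bottDiracSchwartz s x u)‖ ^ 2 =
      (s⁻¹) ^ 2 * ‖schwartzIncl E (diracOp E u)‖ ^ 2 + ‖schwartzIncl E (bottShift x u)‖ ^ 2 +
        s⁻¹ * (inner ℂ (schwartzIncl E u) (schwartzIncl E (numberOp E u))).re := by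
  rw [(formalAdjoint_bottDiracSchwartz s x).norm_sq, formalAdjoint_diracOp.norm_sq,
    (formalAdjoint_bottShift x).norm_sq, bottDiracSchwartz_mul_self]
  simp only [LinearMap.add_apply, LinearMap.smul_apply, map_add, map_smul, inner_add_right,
    inner_smul_right, Complex.add_re, Complex.re_ofReal_mul]

theorem abs_re_inner_numberOp_le (u : 𝓢(E, Cliff E)) :
    |(inner ℂ (schwartzIncl E u) (schwartzIncl E (numberOp E u))).re| ≤
      finrank ℝ E * ‖schwartzIncl E u‖ ^ 2 := by
  refine (Complex.abs_re_le_norm _).trans ((norm_inner_le_norm _ _).trans ?_)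
  have := norm_numberOp_le u
  calc _ ≤ ‖schwartzIncl E u‖ * (finrank ℝ E * ‖schwartzIncl E u‖) := by gcongr
    _ = _ := by ring

/-- For a symmetric operator `B` this gives `‖(B ± i) u‖² = ‖B u‖² + ‖u‖²`. -/
theorem norm_add_I_smul_sq {H : Type*} [NormedAddCommGroup H] [InnerProductSpace ℂ H] {a b : H}
    (h : inner ℂ a b = inner ℂ b a) {c : ℂ} (hc : c = Complex.I ∨ c = -Complex.I) :
    ‖a + c • b‖ ^ 2 = ‖a‖ ^ 2 + ‖b‖ ^ 2 := by
  have h1 : (inner ℂ a b : ℂ).im = 0 := by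
    have h2 := inner_conj_symm (𝕜 := ℂ) a b
    rw [← h] at h2
    exact Complex.conj_eq_iff_im.1 h2
  have h3 : ‖c‖ = 1 := by rcases hc with rfl | rfl <;> simp
  have h4 : RCLike.re (inner ℂ a (c • b) : ℂ) = 0 := by
    rw [inner_smul_right]
    rcases hc with rfl | rfl <;> simp [h1]
  rw [norm_add_sq (𝕜 := ℂ), h4, norm_smul, h3]
  ring

theorem norm_bottDiracSchwartz_add_smul_sq (s : ℝ) (x : E) {c : ℂ}
    (hc : c = Complex.I ∨ c = -Complex.I) (u : 𝓢(E, Cliff E)) :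
    ‖schwartzIncl E (bottDiracSchwartz s x u) + c • schwartzIncl E u‖ ^ 2 =
      ‖schwartzIncl E (bottDiracSchwartz s x u)‖ ^ 2 + ‖schwartzIncl E u‖ ^ 2 :=
  norm_add_I_smul_sq (formalAdjoint_bottDiracSchwartz s x u u) hc

/-- The arithmetic behind `norm_diracOp_le`. -/
theorem sq_le_of_bochner {s d W X C U n c : ℝ} (hs : 1 ≤ s) (hd : 0 ≤ d)
    (h1 : W ^ 2 = (s⁻¹) ^ 2 * X ^ 2 + C ^ 2 + s⁻¹ * n) (h2 : -(d * U ^ 2) ≤ n)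
    (h3 : c = W ^ 2 + U ^ 2) : X ^ 2 ≤ (s * (1 + d)) ^ 2 * c := by
  have hs0 : 0 < s := by linarith
  have h4 : 0 < s⁻¹ := by positivity
  have h5 : s⁻¹ ≤ 1 := inv_le_one_of_one_le₀ hs
  have h6 : s⁻¹ ^ 2 * X ^ 2 ≤ (1 + d) * (W ^ 2 + U ^ 2) := by
    have : s⁻¹ * -(d * U ^ 2) ≤ s⁻¹ * n := by gcongr
    have h7 : s⁻¹ * (d * U ^ 2) ≤ d * U ^ 2 := mul_le_of_le_one_left (by positivity) h5
    have h8 : 0 ≤ d * W ^ 2 := by positivity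
    linarith [sq_nonneg C, sq_nonneg U]
  have h9 : 0 ≤ W ^ 2 + U ^ 2 := by positivity
  rw [h3]
  calc X ^ 2 = s ^ 2 * (s⁻¹ ^ 2 * X ^ 2) := by field_simp
    _ ≤ s ^ 2 * ((1 + d) * (W ^ 2 + U ^ 2)) := by gcongr
    _ ≤ s ^ 2 * ((1 + d) ^ 2 * (W ^ 2 + U ^ 2)) := by
        gcongr
        nlinarith
    _ = _ := by ring

/-- The arithmetic behind `norm_bottShift_le`: this is where `s ≥ 2d` enters. -/
theorem sq_le_of_bochner' {s d W X C U n c : ℝ} (hs : 1 ≤ s) (hsd : 2 * d ≤ s)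
    (h1 : W ^ 2 = (s⁻¹) ^ 2 * X ^ 2 + C ^ 2 + s⁻¹ * n) (h2 : -(d * U ^ 2) ≤ n)
    (h3 : c = W ^ 2 + U ^ 2) : C ^ 2 ≤ c := by
  have hs0 : 0 < s := by linarith
  have h4 : 0 < s⁻¹ := by positivity
  have h5 : s⁻¹ * d ≤ 1 := by
    rw [inv_mul_le_iff₀ hs0]
    linarith
  have h6 : s⁻¹ * -(d * U ^ 2) ≤ s⁻¹ * n := by gcongr
  have h7 : s⁻¹ * d * U ^ 2 ≤ U ^ 2 := mul_le_of_le_one_left (by positivity) h5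
  have h8 : 0 ≤ (s⁻¹) ^ 2 * X ^ 2 := by positivity
  linarith

/-- The Dirac operator is bounded relative to the Bott-Dirac operator. -/
theorem norm_diracOp_le {s : ℝ} (hs : 1 ≤ s) (x : E) (u : 𝓢(E, Cliff E)) :
    ‖schwartzIncl E (diracOp E u)‖ ≤ s * (1 + finrank ℝ E) *
      ‖schwartzIncl E (bottDiracSchwartz s x u) + Complex.I • schwartzIncl E u‖ := by
  have hs0 : 0 < s := by linarith
  refine le_of_sq_le_sq ?_ (by positivity)
  rw [mul_pow]
  exact sq_le_of_bochner hs (Nat.cast_nonneg _) (norm_bottDiracSchwartz_sq s x u)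
    (abs_le.1 (abs_re_inner_numberOp_le u)).1
    (norm_bottDiracSchwartz_add_smul_sq s x (Or.inl rfl) u)

/-- For `s ≥ 2d` the Bott operator is bounded relative to the Bott-Dirac operator with a constant
that does not depend on the dimension. -/
theorem norm_bottShift_le {s : ℝ} (hs : 1 ≤ s) (hsd : 2 * (finrank ℝ E : ℝ) ≤ s) (x : E) {c : ℂ}
    (hc : c = Complex.I ∨ c = -Complex.I) (u : 𝓢(E, Cliff E)) :
    ‖schwartzIncl E (bottShift x u)‖ ≤
      ‖schwartzIncl E (bottDiracSchwartz s x u) + c • schwartzIncl E u‖ :=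
  le_of_sq_le_sq (sq_le_of_bochner' hs hsd (norm_bottDiracSchwartz_sq s x u)
    (abs_le.1 (abs_re_inner_numberOp_le u)).1
    (norm_bottDiracSchwartz_add_smul_sq s x hc u)) (norm_nonneg _)

end Symmetry

/-! ### Gaussian Schwartz functions -/

section Gaussian

universe u

variable {E : Type u} [NormedAddCommGroup E]

/-- The Gaussian `y ↦ exp (- s ‖y - x‖² / 2)`. -/
def gauss (s : ℝ) (x y : E) : ℝ := Real.exp (-(s * ‖y - x‖ ^ 2 / 2))

theorem gauss_pos (s : ℝ) (x y : E) : 0 < gauss s x y := Real.exp_pos _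

theorem exists_pow_mul_gauss_le {s : ℝ} (hs : 0 < s) (x : E) (k : ℕ) :
    ∃ C, ∀ y, (1 + ‖y‖) ^ k * gauss s x y ≤ C := by
  refine ⟨(1 + ‖x‖) ^ k * (k.factorial * Real.exp (1 + 1 / (2 * s))), fun y => ?_⟩
  set r := ‖y - x‖ with hr
  have hr0 : 0 ≤ r := norm_nonneg _
  have h1 : 1 + ‖y‖ ≤ (1 + ‖x‖) * (1 + r) := by
    have : ‖y‖ ≤ r + ‖x‖ := by simpa using norm_add_le (y - x) x
    nlinarith [norm_nonneg x, mul_nonneg (norm_nonneg x) hr0]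
  have h2 : (1 + r) ^ k ≤ k.factorial * Real.exp (1 + r) := by
    have := Real.pow_div_factorial_le_exp (1 + r) (by positivity) k
    rwa [div_le_iff₀' (by positivity)] at this
  have h3 : Real.exp (1 + r) * gauss s x y ≤ Real.exp (1 + 1 / (2 * s)) := by
    rw [gauss, ← Real.exp_add, ← hr]
    refine Real.exp_le_exp.2 ?_
    have : 0 ≤ (s * r - 1) ^ 2 / (2 * s) := by positivity
    have e : (s * r - 1) ^ 2 / (2 * s) = s * r ^ 2 / 2 - r + 1 / (2 * s) := by field_simp; ring
    linarith
  have hg := (gauss_pos s x y).le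
  calc (1 + ‖y‖) ^ k * gauss s x y ≤ ((1 + ‖x‖) * (1 + r)) ^ k * gauss s x y := by gcongr
    _ = (1 + ‖x‖) ^ k * ((1 + r) ^ k * gauss s x y) := by rw [mul_pow]; ring
    _ ≤ (1 + ‖x‖) ^ k * (k.factorial * Real.exp (1 + r) * gauss s x y) := by gcongr
    _ = (1 + ‖x‖) ^ k * (k.factorial * (Real.exp (1 + r) * gauss s x y)) := by ring
    _ ≤ _ := by gcongr

variable [InnerProductSpace ℝ E]

theorem contDiff_gauss (s : ℝ) (x : E) {n : WithTop ℕ∞} : ContDiff ℝ n (gauss s x) := by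
  unfold gauss
  exact Real.contDiff_exp.comp ((((contDiff_id.sub contDiff_const).norm_sq ℝ).const_smul s
    |>.div_const 2).neg)

theorem hasFDerivAt_gauss (s : ℝ) (x y : E) :
    HasFDerivAt (gauss s x) (gauss s x y • (-s • innerSL ℝ (y - x))) y := by
  have h1 : HasFDerivAt (fun y => ‖y - x‖ ^ 2) (2 • innerSL ℝ (y - x)) y := by
    have := ((hasFDerivAt_id (𝕜 := ℝ) y).sub_const x).norm_sq
    simpa using! this
  have h2 := (h1.const_smul (-s / 2)).exp
  have e : (fun y => Real.exp ((-s / 2) • ‖y - x‖ ^ 2)) = gauss s x := by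
    funext y; unfold gauss; congr 1; rw [smul_eq_mul]; ring
  have e' : (-s / 2) • (2 • innerSL ℝ (y - x)) = -s • innerSL ℝ (y - x) := by
    rw [← Nat.cast_smul_eq_nsmul ℝ, smul_smul]; congr 1; push_cast; ring
  rw [e'] at h2
  change HasFDerivAt (fun y => Real.exp ((-s / 2) • ‖y - x‖ ^ 2))
    (Real.exp ((-s / 2) • ‖y - x‖ ^ 2) • _) y at h2
  rwa [e, congrFun e y] at h2

/-- The derivatives of a Gaussian times a function of temperate growth are again of this form. -/
theorem exists_norm_iteratedFDeriv_gauss_smul_le (s : ℝ) (x : E) (n : ℕ) :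
    ∀ {F : Type u} [NormedAddCommGroup F] [NormedSpace ℝ F] (p : E → F), p.HasTemperateGrowth →
      ∃ (k : ℕ) (C : ℝ), ∀ y, ‖iteratedFDeriv ℝ n (fun y => gauss s x y • p y) y‖ ≤
        C * ((1 + ‖y‖) ^ k * gauss s x y) := by
  induction n with
  | zero =>
    intro F _ _ p hp
    obtain ⟨k, C, h⟩ := hp.2 0
    refine ⟨k, C, fun y => ?_⟩
    have := h y
    rw [norm_iteratedFDeriv_zero] at this ⊢
    rw [norm_smul, Real.norm_of_nonneg (gauss_pos s x y).le, mul_comm, ← mul_assoc]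
    gcongr
    exact (gauss_pos s x y).le
  | succ n ih =>
    intro F _ _ p hp
    have hi : (fun y : E => innerSL ℝ (y - x)).HasTemperateGrowth := by
      have : (fun y : E => innerSL ℝ (y - x)) =
          (fun y => innerSL ℝ y) - fun _ => innerSL ℝ x := by ext; simp
      rw [this]
      exact ((innerSL ℝ).hasTemperateGrowth).sub (Function.HasTemperateGrowth.const _)
    have hp' : (fderiv ℝ p).HasTemperateGrowth := by
      refine ⟨hp.1.fderiv_right (by simp), fun n => ?_⟩
      simp only [norm_iteratedFDeriv_fderiv]
      exact hp.2 (n + 1)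
    have hq : (fun y => fderiv ℝ p y + ((-s) • ContinuousLinearMap.smulRightL ℝ E F)
        (innerSL ℝ (y - x)) (p y)).HasTemperateGrowth :=
      hp'.add (((-s) • ContinuousLinearMap.smulRightL ℝ E F).bilinear_hasTemperateGrowth
        hi hp)
    obtain ⟨k, C, h⟩ := ih _ hq
    refine ⟨k, C, fun y => ?_⟩
    rw [← norm_iteratedFDeriv_fderiv]
    convert h y using 3
    funext y
    refine (((hasFDerivAt_gauss s x y).smul
      ((hp.1.differentiable (by simp)).differentiableAt (x := y)).hasFDerivAt).fderiv).trans ?_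
    rw [smul_add]
    congr 1
    ext v
    simp [smul_smul]
    rw [← sub_smul, smul_smul]


/-- The Gaussian with a constant coefficient, as a Schwartz function. -/
def gaussSchwartz {s : ℝ} (hs : 0 < s) (x : E) {F : Type u} [NormedAddCommGroup F]
    [NormedSpace ℝ F] (w : F) : 𝓢(E, F) where
  toFun y := gauss s x y • w
  smooth' := (contDiff_gauss s x).smul contDiff_const
  decay' k n := by
    obtain ⟨l, C, h⟩ := exists_norm_iteratedFDeriv_gauss_smul_le s x n (fun _ => w)
      (Function.HasTemperateGrowth.const w)
    obtain ⟨C', h'⟩ := exists_pow_mul_gauss_le hs x (k + l)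
    refine ⟨|C| * C', fun y => ?_⟩
    have hg := (gauss_pos s x y).le
    calc ‖y‖ ^ k * _ ≤ (1 + ‖y‖) ^ k * (|C| * ((1 + ‖y‖) ^ l * gauss s x y)) := by
          gcongr
          · linarith
          · exact (h y).trans (by gcongr; exact le_abs_self C)
      _ = |C| * ((1 + ‖y‖) ^ (k + l) * gauss s x y) := by rw [pow_add]; ring
      _ ≤ |C| * C' := by gcongr; exact h' y

end Gaussian

/-! ### The harmonic oscillator -/

section Oscillator

variable {E : Type*} [NormedAddCommGroup E] [InnerProductSpace ℝ E] [FiniteDimensional ℝ E]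

/-- The annihilation operators `aᵢ = s⁻¹ ∂/∂xᵢ + Qᵢ`, where `Qᵢ` is multiplication by the `i`-th
coordinate centred at `x`. -/
def annihOp (s : ℝ) (x : E) (i : Fin (finrank ℝ E)) : Module.End ℂ 𝓢(E, Cliff E) :=
  ((s⁻¹ : ℝ) : ℂ) • derivOp E i + coordOp x i

/-- The harmonic oscillator `∑ᵢ (2 Qᵢ - aᵢ) aᵢ`, which is `∑ᵢ aᵢ* aᵢ`, shifted so that its
spectrum starts at `0`. -/
def oscillator (s : ℝ) (x : E) : Module.End ℂ 𝓢(E, Cliff E) :=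
  ∑ i, (2 • coordOp x i - annihOp s x i) * annihOp s x i

theorem annihOp_mul_coordOp (s : ℝ) (x : E) (i j : Fin (finrank ℝ E)) :
    annihOp s x i * coordOp x j =
      coordOp x j * annihOp s x i + if i = j then ((s⁻¹ : ℝ) : ℂ) • 1 else 0 := by
  rw [annihOp, add_mul, mul_add, smul_mul_assoc, derivOp_mul_coordOp, smul_add, mul_smul_comm,
    (commute_coordOp x i j).eq]
  split_ifs
  · abel
  · rw [smul_zero]; abel

theorem bottDiracSchwartz_mul_self_eq_oscillator (s : ℝ) (x : E) :
    bottDiracSchwartz s x * bottDiracSchwartz s x =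
      oscillator s x + ((s⁻¹ : ℝ) : ℂ) • (numberOp E + (finrank ℝ E : ℂ) • 1) := by
  have h : ∀ i, (2 • coordOp x i - annihOp s x i) * annihOp s x i =
      coordOp x i * coordOp x i - (((s⁻¹) ^ 2 : ℝ) : ℂ) • (derivOp E i * derivOp E i) -
        ((s⁻¹ : ℝ) : ℂ) • 1 := fun i => by
    have h1 := derivOp_mul_coordOp x i i
    rw [if_pos rfl] at h1
    simp only [annihOp, two_smul, mul_add, sub_mul, add_mul, smul_mul_assoc, mul_smul_comm,
      h1, smul_add, smul_sub]
    rw [Complex.ofReal_pow, sq, mul_smul]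
    abel
  rw [bottDiracSchwartz_mul_self, diracOp_mul_self, bottShift_mul_self, oscillator,
    Finset.sum_congr rfl fun i _ => h i]
  simp only [Finset.sum_sub_distrib, smul_add, smul_neg, Finset.smul_sum, Finset.sum_const,
    Finset.card_univ, Fintype.card_fin, smul_smul]
  rw [← Nat.cast_smul_eq_nsmul ℂ, smul_smul, mul_comm (finrank ℝ E : ℂ)]
  abel

theorem oscillator_eq (s : ℝ) (x : E) : oscillator s x =
    bottDiracSchwartz s x * bottDiracSchwartz s x +
      ((-s⁻¹ : ℝ) : ℂ) • (numberOp E + ((finrank ℝ E : ℝ) : ℂ) • 1) := by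
  rw [bottDiracSchwartz_mul_self_eq_oscillator, Complex.ofReal_neg, neg_smul,
    Complex.ofReal_natCast]
  abel

/-- The linear map that sends `w` to the Gaussian with coefficient `w`. -/
def gaussOp {s : ℝ} (hs : 0 < s) (x : E) : Cliff E →ₗ[ℂ] 𝓢(E, Cliff E) where
  toFun w := gaussSchwartz hs x w
  map_add' _ _ := SchwartzMap.ext fun _ => smul_add _ _ _
  map_smul' _ _ := SchwartzMap.ext fun _ => smul_comm _ _ _

theorem gaussOp_apply {s : ℝ} (hs : 0 < s) (x : E) (w : Cliff E) (y : E) :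
    gaussOp hs x w y = gauss s x y • w := rfl

variable {s : ℝ} (hs : 0 < s) (x : E)

theorem postOp_gaussOp (L : Cliff E →L[ℂ] Cliff E) (w : Cliff E) :
    postOp L (gaussOp hs x w) = gaussOp hs x (L w) :=
  SchwartzMap.ext fun y => (L.restrictScalars ℝ).map_smul (gauss s x y) w

theorem annihOp_gaussOp (i : Fin (finrank ℝ E)) (w : Cliff E) :
    annihOp s x i (gaussOp hs x w) = 0 := by
  refine SchwartzMap.ext fun y => ?_
  have h1 : derivOp E i (gaussOp hs x w) y =
      fderiv ℝ (fun y => gauss s x y • w) y (stdB E i) := derivOp_apply _ _ _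
  have h2 := ((hasFDerivAt_gauss s x y).smul_const w).fderiv
  rw [annihOp, LinearMap.add_apply, add_apply, LinearMap.smul_apply, smul_apply, coordOp_apply,
    h1, h2, gaussOp_apply, coordFun, zero_apply]
  simp only [ContinuousLinearMap.smulRight_apply, smul_apply, innerSL_apply_apply,
    Complex.coe_smul, smul_smul, smul_eq_mul, real_inner_comm]
  rw [← add_smul]
  convert zero_smul ℝ w
  field_simp
  ring

/-- The Schwartz functions of the form polynomial of degree `< m` times Gaussian. -/
def ladder : ℕ → Submodule ℂ 𝓢(E, Cliff E)
  | 0 => ⊥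
  | m + 1 => (LinearMap.range (gaussOp hs x) ⊔ ladder m) ⊔ ⨆ i, (ladder m).map (coordOp x i)

theorem gaussOp_mem_ladder (m : ℕ) (w : Cliff E) : gaussOp hs x w ∈ ladder hs x (m + 1) :=
  (le_sup_left.trans le_sup_left : LinearMap.range (gaussOp hs x) ≤ _)
    (LinearMap.mem_range_self _ w)

theorem ladder_le_succ (m : ℕ) : ladder hs x m ≤ ladder hs x (m + 1) :=
  le_sup_right.trans le_sup_left

theorem ladder_mono : Monotone (ladder hs x) := monotone_nat_of_le_succ (ladder_le_succ hs x)

theorem coordOp_mem_ladder {m : ℕ} {u : 𝓢(E, Cliff E)} (hu : u ∈ ladder hs x m)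
    (i : Fin (finrank ℝ E)) : coordOp x i u ∈ ladder hs x (m + 1) :=
  (le_iSup (fun i => (ladder hs x m).map (coordOp x i)) i |>.trans le_sup_right)
    (Submodule.mem_map_of_mem hu)

theorem ladder_succ_le {m : ℕ} {S : Submodule ℂ 𝓢(E, Cliff E)} (h1 : ∀ w, gaussOp hs x w ∈ S)
    (h2 : ∀ u ∈ ladder hs x m, u ∈ S)
    (h3 : ∀ i, ∀ u ∈ ladder hs x m, coordOp x i u ∈ S) : ladder hs x (m + 1) ≤ S := by
  refine sup_le (sup_le ?_ h2) (iSup_le fun i => ?_)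
  · rintro _ ⟨w, rfl⟩; exact h1 w
  · rintro _ ⟨u, hu, rfl⟩; exact h3 i u hu

instance finiteDimensional_ladder (m : ℕ) : FiniteDimensional ℂ (ladder hs x m) := by
  induction m with
  | zero => exact inferInstanceAs (FiniteDimensional ℂ (⊥ : Submodule ℂ 𝓢(E, Cliff E)))
  | succ m ih => rw [ladder]; infer_instance

theorem postOp_mem_ladder (L : Cliff E →L[ℂ] Cliff E) {m : ℕ} {u : 𝓢(E, Cliff E)}
    (hu : u ∈ ladder hs x m) : postOp L u ∈ ladder hs x m := by
  suffices h : ladder hs x m ≤ (ladder hs x m).comap (postOp L) from h hu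
  clear hu
  induction m with
  | zero => exact bot_le
  | succ m ih =>
    refine ladder_succ_le hs x (fun w => ?_) (fun u hu => ?_) fun i u hu => ?_
    · rw [Submodule.mem_comap, postOp_gaussOp]; exact gaussOp_mem_ladder hs x m _
    · exact ladder_le_succ hs x m (ih hu)
    · have e : postOp L (coordOp x i u) = coordOp x i (postOp L u) :=
        (LinearMap.congr_fun (commute_coordOp_postcomp x i L).eq u).symm
      rw [Submodule.mem_comap, e]
      exact coordOp_mem_ladder hs x (ih hu) i

theorem annihOp_mem_ladder (i : Fin (finrank ℝ E)) {m : ℕ} {u : 𝓢(E, Cliff E)}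
    (hu : u ∈ ladder hs x (m + 1)) : annihOp s x i u ∈ ladder hs x m := by
  suffices h : ladder hs x (m + 1) ≤ (ladder hs x m).comap (annihOp s x i) from h hu
  clear hu
  have h1 : ∀ {m} w, gaussOp hs x w ∈ (ladder hs x m).comap (annihOp s x i) := fun w => by
    rw [Submodule.mem_comap, annihOp_gaussOp]; exact zero_mem _
  induction m with
  | zero =>
    refine ladder_succ_le hs x h1 (fun u hu => ?_) fun j u hu => ?_
    · rw [(Submodule.mem_bot ℂ).1 hu]; exact zero_mem _
    · rw [(Submodule.mem_bot ℂ).1 hu, map_zero]; exact zero_mem _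
  | succ m ih =>
    refine ladder_succ_le hs x h1 (fun u hu => ladder_le_succ hs x m (ih hu)) fun j u hu => ?_
    have e : annihOp s x i (coordOp x j u) = coordOp x j (annihOp s x i u) +
        (if i = j then ((s⁻¹ : ℝ) : ℂ) • (1 : Module.End ℂ 𝓢(E, Cliff E)) else 0) u :=
      LinearMap.congr_fun (annihOp_mul_coordOp s x i j) u
    rw [Submodule.mem_comap, e]
    refine add_mem (coordOp_mem_ladder hs x (ih hu) j) ?_
    split_ifs
    · exact Submodule.smul_mem _ _ hu
    · exact zero_mem _

theorem annihOp_mem_ladder' (i : Fin (finrank ℝ E)) {m : ℕ} {u : 𝓢(E, Cliff E)}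
    (hu : u ∈ ladder hs x m) : annihOp s x i u ∈ ladder hs x m :=
  annihOp_mem_ladder hs x i (ladder_le_succ hs x m hu)

theorem derivOp_mem_ladder (i : Fin (finrank ℝ E)) {m : ℕ} {u : 𝓢(E, Cliff E)}
    (hu : u ∈ ladder hs x m) : derivOp E i u ∈ ladder hs x (m + 1) := by
  have e : derivOp E i = (s : ℂ) • (annihOp s x i - coordOp x i) := by
    rw [annihOp, add_sub_cancel_right, smul_smul, ← Complex.ofReal_mul, mul_inv_cancel₀ hs.ne',
      Complex.ofReal_one, one_smul]
  rw [e]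
  exact Submodule.smul_mem _ _ (sub_mem (ladder_le_succ hs x m (annihOp_mem_ladder' hs x i hu))
    (coordOp_mem_ladder hs x hu i))

theorem bottDiracSchwartz_mem_ladder {m : ℕ} {u : 𝓢(E, Cliff E)} (hu : u ∈ ladder hs x m) :
    bottDiracSchwartz s x u ∈ ladder hs x (m + 1) := by
  rw [bottDiracSchwartz_eq, diracOp_eq_sum, bottShift_eq_sum, LinearMap.add_apply,
    LinearMap.smul_apply, LinearMap.sum_apply, LinearMap.sum_apply]
  exact add_mem (Submodule.smul_mem _ _ (sum_mem fun i _ =>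
    postOp_mem_ladder hs x _ (derivOp_mem_ladder hs x i hu)))
    (sum_mem fun i _ => postOp_mem_ladder hs x _ (coordOp_mem_ladder hs x hu i))

/-- The oscillator acts on the degree filtration as a triangular operator, with the eigenvalue
`2m/s` in degree `m`. -/
theorem oscillator_sub_mem_ladder {m : ℕ} {u : 𝓢(E, Cliff E)} (hu : u ∈ ladder hs x (m + 1)) :
    oscillator s x u - ((2 * m * s⁻¹ : ℝ) : ℂ) • u ∈ ladder hs x m := by
  -- modulo the terms `aᵢ aᵢ`, which lower the degree by two, the oscillator is `2 ∑ᵢ Qᵢ aᵢ`, which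
  -- counts the degree because `[aᵢ, Qⱼ] = s⁻¹ δᵢⱼ`
  set Nop : Module.End ℂ 𝓢(E, Cliff E) := ∑ i, coordOp x i * annihOp s x i with hN
  have hcomm : ∀ j, Nop * coordOp x j = coordOp x j * Nop + ((s⁻¹ : ℝ) : ℂ) • coordOp x j := by
    intro j
    have : ∀ i, coordOp x i * annihOp s x i * coordOp x j =
        coordOp x j * (coordOp x i * annihOp s x i) +
          if i = j then ((s⁻¹ : ℝ) : ℂ) • coordOp x i else 0 := fun i => by
      rw [mul_assoc, annihOp_mul_coordOp, mul_add, ← mul_assoc, (commute_coordOp x i j).eq,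
        mul_assoc]
      split_ifs
      · rw [mul_smul_comm, mul_one]
      · rw [mul_zero]
    rw [hN, Finset.sum_mul, Finset.sum_congr rfl fun i _ => this i, Finset.sum_add_distrib,
      Finset.mul_sum]
    simp
  have hgauss : ∀ w, Nop (gaussOp hs x w) = 0 := fun w => by
    rw [hN, LinearMap.sum_apply]
    refine Finset.sum_eq_zero fun i _ => ?_
    rw [Module.End.mul_apply, annihOp_gaussOp, map_zero]
  have hNop : ∀ m, ∀ u ∈ ladder hs x (m + 1), Nop u - ((m * s⁻¹ : ℝ) : ℂ) • u ∈ ladder hs x m := by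
    intro m
    induction m with
    | zero =>
      suffices h : ladder hs x 1 ≤ LinearMap.ker Nop by
        intro u hu
        rw [LinearMap.mem_ker.1 (h hu)]
        simp
      refine ladder_succ_le hs x hgauss (fun u hu => ?_) fun j u hu => ?_
      · rw [(Submodule.mem_bot ℂ).1 hu]; exact zero_mem _
      · rw [(Submodule.mem_bot ℂ).1 hu, map_zero]; exact zero_mem _
    | succ m ih =>
      suffices h : ladder hs x (m + 2) ≤ (ladder hs x (m + 1)).comap
          (Nop - (((m + 1 : ℕ) * s⁻¹ : ℝ) : ℂ) • 1) from fun u hu => h hu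
      have hpres : ∀ u ∈ ladder hs x (m + 1), Nop u ∈ ladder hs x (m + 1) := fun u hu => by
        have := add_mem (ladder_le_succ hs x m (ih u hu))
          (Submodule.smul_mem _ ((m * s⁻¹ : ℝ) : ℂ) hu)
        rwa [sub_add_cancel] at this
      refine ladder_succ_le hs x (fun w => ?_) (fun u hu => ?_) fun j u hu => ?_
      · rw [Submodule.mem_comap, LinearMap.sub_apply, hgauss]
        exact sub_mem (zero_mem _) (Submodule.smul_mem _ _ (gaussOp_mem_ladder hs x m w))
      · exact sub_mem (hpres u hu) (Submodule.smul_mem _ _ hu)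
      · have e := LinearMap.congr_fun (hcomm j) u
        simp only [LinearMap.add_apply, Module.End.mul_apply, LinearMap.smul_apply] at e
        have e2 : (Nop - (((m + 1 : ℕ) * s⁻¹ : ℝ) : ℂ) • 1) (coordOp x j u) =
            coordOp x j (Nop u - ((m * s⁻¹ : ℝ) : ℂ) • u) := by
          rw [LinearMap.sub_apply, e, map_sub, map_smul, LinearMap.smul_apply,
            Module.End.one_apply]
          push_cast
          rw [add_mul, one_mul, add_smul]
          abel
        rw [Submodule.mem_comap, e2]
        exact coordOp_mem_ladder hs x (ih u hu) j
  have e : oscillator s x u - ((2 * m * s⁻¹ : ℝ) : ℂ) • u =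
      (2 : ℂ) • (Nop u - ((m * s⁻¹ : ℝ) : ℂ) • u) -
        ∑ i, annihOp s x i (annihOp s x i u) := by
    have : oscillator s x = (2 : ℂ) • Nop - ∑ i, annihOp s x i * annihOp s x i := by
      rw [oscillator, hN, Finset.smul_sum, ← Finset.sum_sub_distrib]
      refine Finset.sum_congr rfl fun i _ => ?_
      rw [sub_mul, two_smul, two_smul, add_mul]
    rw [this, smul_sub, smul_smul, LinearMap.sub_apply, LinearMap.sum_apply, LinearMap.smul_apply]
    have e3 : ((2 * m * s⁻¹ : ℝ) : ℂ) = 2 * ((m * s⁻¹ : ℝ) : ℂ) := by push_cast; ring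
    rw [e3]
    simp only [Module.End.mul_apply]
    abel
  rw [e]
  exact sub_mem (Submodule.smul_mem _ _ (hNop m u hu)) (sum_mem fun i _ =>
    annihOp_mem_ladder' hs x i (annihOp_mem_ladder hs x i hu))

theorem oscillator_mem_ladder {m : ℕ} {u : 𝓢(E, Cliff E)} (hu : u ∈ ladder hs x m) :
    oscillator s x u ∈ ladder hs x m := by
  have := add_mem (oscillator_sub_mem_ladder hs x (ladder_le_succ hs x m hu))
    (Submodule.smul_mem _ ((2 * m * s⁻¹ : ℝ) : ℂ) hu)
  rwa [sub_add_cancel] at this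

theorem numberOp_mem_ladder {m : ℕ} {u : 𝓢(E, Cliff E)} (hu : u ∈ ladder hs x m) :
    numberOp E u ∈ ladder hs x m := by
  rw [numberOp, LinearMap.sum_apply]
  exact sum_mem fun i _ => postOp_mem_ladder hs x _ (postOp_mem_ladder hs x _ hu)

theorem bottDiracSchwartz_sq_mem_ladder {m : ℕ} {u : 𝓢(E, Cliff E)} (hu : u ∈ ladder hs x m) :
    bottDiracSchwartz s x (bottDiracSchwartz s x u) ∈ ladder hs x m := by
  rw [← Module.End.mul_apply, bottDiracSchwartz_mul_self_eq_oscillator, LinearMap.add_apply]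
  exact add_mem (oscillator_mem_ladder hs x hu) (Submodule.smul_mem _ _
    (add_mem (numberOp_mem_ladder hs x hu) (Submodule.smul_mem _ _ hu)))

/-- A finite-dimensional space of Schwartz functions that is invariant under the Bott-Dirac
operator. -/
def invLadder (m : ℕ) : Submodule ℂ 𝓢(E, Cliff E) :=
  ladder hs x m ⊔ (ladder hs x m).map (bottDiracSchwartz s x)

instance finiteDimensional_invLadder (m : ℕ) : FiniteDimensional ℂ (invLadder hs x m) := by
  rw [invLadder]; infer_instance

theorem bottDiracSchwartz_mem_invLadder {m : ℕ} {u : 𝓢(E, Cliff E)} (hu : u ∈ invLadder hs x m) :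
    bottDiracSchwartz s x u ∈ invLadder hs x m := by
  obtain ⟨v, hv, _, ⟨w, hw, rfl⟩, rfl⟩ := Submodule.mem_sup.1 hu
  rw [map_add, add_comm]
  exact Submodule.add_mem_sup (bottDiracSchwartz_sq_mem_ladder hs x hw)
    (Submodule.mem_map_of_mem hv)

theorem ladder_le_invLadder (m : ℕ) : ladder hs x m ≤ invLadder hs x m := le_sup_left

theorem invLadder_le (m : ℕ) : invLadder hs x m ≤ ladder hs x (m + 1) := by
  refine sup_le (ladder_le_succ hs x m) ?_
  rintro _ ⟨u, hu, rfl⟩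
  exact bottDiracSchwartz_mem_ladder hs x hu

theorem invLadder_mono : Monotone (invLadder hs x) := fun _ _ h =>
  sup_le_sup (ladder_mono hs x h) (Submodule.map_mono (ladder_mono hs x h))

end Oscillator

/-! ### Density of the polynomials times Gaussians -/

/-- An integrable function with vanishing Fourier transform vanishes almost everywhere. -/
theorem ae_eq_zero_of_fourier_eq_zero {V F : Type*} [NormedAddCommGroup V] [InnerProductSpace ℝ V]
    [FiniteDimensional ℝ V] [MeasurableSpace V] [BorelSpace V] [NormedAddCommGroup F]
    [NormedSpace ℂ F] [CompleteSpace F] {k : V → F} (hk : Integrable k)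
    (h : ∀ ξ, FourierTransform.fourier k ξ = 0) : k =ᵐ[volume] 0 := by
  refine ae_eq_zero_of_integral_contDiff_smul_eq_zero hk.locallyIntegrable fun g hg hgc => ?_
  have hg' : ContDiff ℝ (⊤ : ℕ∞) fun y => (g y : ℂ) := Complex.ofRealCLM.contDiff.comp hg
  set φ : 𝓢(V, ℂ) := (hgc.comp_left (g := Complex.ofReal) rfl).toSchwartzMap hg' with hφ
  obtain ⟨ψ, hψ⟩ : ∃ ψ : 𝓢(V, ℂ), (FourierTransform.fourier ψ : 𝓢(V, ℂ)) = φ :=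
    ⟨FourierTransformInv.fourierInv φ, FourierTransform.fourier_fourierInv_eq φ⟩
  have e : ∀ y, FourierTransform.fourier (ψ : V → ℂ) y = (g y : ℂ) := fun y =>
    congrArg (fun f : 𝓢(V, ℂ) => f y) hψ
  have h1 := VectorFourier.integral_fourierIntegral_smul_eq_flip (L := innerₗ V)
    (μ := volume) (ν := volume) Real.continuous_fourierChar continuous_inner
    ψ.integrable hk
  have h2 : ∀ x, VectorFourier.fourierIntegral Real.fourierChar volume (innerₗ V).flip k x = 0 :=
    fun x => by rw [flip_innerₗ]; exact h x
  simp only [h2, smul_zero, integral_zero] at h1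
  rw [← h1]
  refine integral_congr_ae (Eventually.of_forall fun y => ?_)
  exact (Complex.coe_smul _ _).symm.trans (congrArg (· • k y) (e y).symm)

/-- If all moments of a function with exponential moments vanish along a coordinate `q`, then so
does its Fourier transform in this direction. -/
theorem integral_cexp_smul_eq_zero_of_moments {X F : Type*} [MeasurableSpace X] {μ : Measure X}
    [NormedAddCommGroup F] [NormedSpace ℂ F] {k : X → F} {q r : X → ℝ}
    (hk : ∀ n : ℕ, AEStronglyMeasurable (fun y => ((q y ^ n : ℝ) : ℂ) • k y) μ)
    (hqr : ∀ y, |q y| ≤ r y) (hr : Integrable (fun y => Real.exp (r y) * ‖k y‖) μ)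
    (h0 : ∀ n : ℕ, ∫ y, ((q y ^ n : ℝ) : ℂ) • k y ∂μ = 0) :
    ∫ y, Complex.exp (Complex.I * (q y : ℂ)) • k y ∂μ = 0 := by
  have hF : ∀ (n : ℕ) (y : X), ((n.factorial : ℂ)⁻¹ * (Complex.I * (q y : ℂ)) ^ n) • k y =
      ((n.factorial : ℂ)⁻¹ * Complex.I ^ n) • ((q y ^ n : ℝ) : ℂ) • k y := fun n y => by
    rw [smul_smul]; congr 1; push_cast; ring
  have hexp : ∀ y, HasSum (fun n : ℕ => ((n.factorial : ℝ)⁻¹ * r y ^ n) * ‖k y‖)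
      (Real.exp (r y) * ‖k y‖) := fun y => by
    refine HasSum.mul_right _ ?_
    rw [Real.exp_eq_exp_ℝ]
    exact NormedSpace.exp_series_hasSum_exp' (𝕂 := ℝ) (r y)
  have hexp' : ∀ y, HasSum (fun n : ℕ => (n.factorial : ℂ)⁻¹ * (Complex.I * (q y : ℂ)) ^ n)
      (Complex.exp (Complex.I * (q y : ℂ))) := fun y => by
    rw [Complex.exp_eq_exp_ℂ]
    exact NormedSpace.exp_series_hasSum_exp' (𝕂 := ℂ) (Complex.I * (q y : ℂ))
  have hsum := hasSum_integral_of_dominated_convergence (μ := μ)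
    (F := fun (n : ℕ) y => ((n.factorial : ℂ)⁻¹ * (Complex.I * (q y : ℂ)) ^ n) • k y)
    (f := fun y => Complex.exp (Complex.I * (q y : ℂ)) • k y)
    (fun n y => ((n.factorial : ℝ)⁻¹ * r y ^ n) * ‖k y‖)
    (fun n => by
      simp only [hF]
      exact (hk n).const_smul _)
    (fun n => Eventually.of_forall fun y => by
      rw [norm_smul, norm_mul, norm_pow, norm_mul, Complex.norm_I, one_mul, Complex.norm_real,
        norm_inv, Complex.norm_natCast]
      gcongr
      exact hqr y)
    (Eventually.of_forall fun y => (hexp y).summable)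
    (by simpa only [fun y => (hexp y).tsum_eq] using hr)
    (Eventually.of_forall fun y => (hexp' y).smul_const _)
  refine hsum.unique ?_
  simp only [hF, integral_smul, h0, smul_zero]
  exact hasSum_zero

section Density

universe u

variable {E : Type u} [NormedAddCommGroup E] [InnerProductSpace ℝ E] [FiniteDimensional ℝ E]

/-- Multiplication by a linear function on Schwartz functions. -/
def linearOp (x ξ : E) : Module.End ℂ 𝓢(E, Cliff E) :=
  ∑ i, ((inner ℝ (stdB E i) ξ : ℝ) : ℂ) • coordOp x i

theorem linearOp_apply (x ξ : E) (u : 𝓢(E, Cliff E)) (y : E) :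
    linearOp x ξ u y = ((inner ℝ ξ (y - x) : ℝ) : ℂ) • u y := by
  rw [linearOp, LinearMap.sum_apply, sum_apply, ← (stdB E).sum_inner_mul_inner ξ (y - x),
    Complex.ofReal_sum, Finset.sum_smul]
  refine Finset.sum_congr rfl fun i _ => ?_
  rw [LinearMap.smul_apply, smul_apply, coordOp_apply, coordFun, smul_smul, Complex.ofReal_mul,
    real_inner_comm]

theorem linearOp_pow_gaussOp_mem {s : ℝ} (hs : 0 < s) (x ξ : E) (w : Cliff E) (n : ℕ) :
    (linearOp x ξ ^ n) (gaussOp hs x w) ∈ ladder hs x (n + 1) := by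
  induction n with
  | zero => exact gaussOp_mem_ladder hs x 0 w
  | succ n ih =>
    rw [pow_succ', Module.End.mul_apply, linearOp, LinearMap.sum_apply]
    exact sum_mem fun i _ => Submodule.smul_mem _ _ (coordOp_mem_ladder hs x ih i)

theorem linearOp_pow_gaussOp_apply {s : ℝ} (hs : 0 < s) (x ξ : E) (w : Cliff E) (n : ℕ) (y : E) :
    (linearOp x ξ ^ n) (gaussOp hs x w) y =
      (((inner ℝ ξ (y - x)) ^ n * gauss s x y : ℝ) : ℂ) • w := by
  induction n with
  | zero => simp [gaussOp_apply]
  | succ n ih =>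
    rw [pow_succ', Module.End.mul_apply, linearOp_apply, ih, smul_smul, ← Complex.ofReal_mul,
      pow_succ', mul_assoc]

variable [MeasurableSpace E] [BorelSpace E]

theorem integrable_gauss {s : ℝ} (hs : 0 < s) (x : E) : Integrable (gauss s x) := by
  obtain ⟨C, hC⟩ := exists_pow_mul_gauss_le hs x (finrank ℝ E + 1)
  have h1 : Integrable fun y : E => C * (1 + ‖y‖) ^ (-((finrank ℝ E + 1 : ℕ) : ℝ)) :=
    (integrable_one_add_norm (by push_cast; linarith)).const_mul C
  refine h1.mono' (contDiff_gauss s x (n := 0)).continuous.aestronglyMeasurable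
    (Eventually.of_forall fun y => ?_)
  have h2 : 0 < 1 + ‖y‖ := by positivity
  rw [Real.norm_of_nonneg (gauss_pos s x y).le, Real.rpow_neg h2.le, Real.rpow_natCast,
    ← div_eq_mul_inv, le_div_iff₀ (by positivity), mul_comm]
  exact hC y

theorem memLp_exp_mul_gauss {s : ℝ} (hs : 0 < s) (x : E) (c : ℝ) :
    MemLp (fun y => Real.exp (c * ‖y - x‖) * gauss s x y) 2 := by
  have hc : Continuous fun y => Real.exp (c * ‖y - x‖) * gauss s x y :=
    (by fun_prop : Continuous fun y : E => Real.exp (c * ‖y - x‖)).mul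
      (contDiff_gauss s x (n := 0)).continuous
  rw [memLp_two_iff_integrable_sq hc.aestronglyMeasurable]
  refine ((integrable_gauss hs x).const_mul (Real.exp (2 * c ^ 2 / s))).mono'
    (hc.pow 2).aestronglyMeasurable (Eventually.of_forall fun y => ?_)
  rw [Real.norm_of_nonneg (by positivity), gauss, ← Real.exp_add, ← Real.exp_add,
    ← Real.exp_nat_mul]
  refine Real.exp_le_exp.2 ?_
  generalize ‖y - x‖ = r
  have : 0 ≤ (s * r - 2 * c) ^ 2 / (2 * s) := by positivity
  have e : (s * r - 2 * c) ^ 2 / (2 * s) = s * r ^ 2 / 2 - 2 * c * r + 2 * c ^ 2 / s := by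
    field_simp; ring
  push_cast
  linarith

theorem integrable_exp_mul_gauss_smul {s : ℝ} (hs : 0 < s) (x : E) (c : ℝ) (h : L2 E) :
    Integrable fun y => ((Real.exp (c * ‖y - x‖) * gauss s x y : ℝ) : ℂ) • h y := by
  rw [← memLp_one_iff_integrable]
  exact (Lp.memLp h).smul (MemLp.ofReal (K := ℂ) (memLp_exp_mul_gauss hs x c))

theorem inner_schwartzIncl_left (u : 𝓢(E, Cliff E)) (h : L2 E) :
    inner ℂ (schwartzIncl E u) h = ∫ y, inner ℂ (u y) (h y) := by
  rw [L2.inner_def]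
  refine integral_congr_ae ?_
  filter_upwards [schwartzIncl_ae u] with y hy
  rw [hy]

variable {s : ℝ} (hs : 0 < s) (x : E)

theorem integrable_pow_mul_gauss_smul {s : ℝ} (hs : 0 < s) (x ξ : E) (n : ℕ) (h : L2 E) :
    Integrable fun y => (((inner ℝ ξ (y - x)) ^ n * gauss s x y : ℝ) : ℂ) • h y := by
  refine (((integrable_exp_mul_gauss_smul hs x ‖ξ‖ h).norm).const_mul (n.factorial : ℝ)).mono'
    ?_ (Eventually.of_forall fun y => ?_)
  · have hc : Continuous fun y : E => (((inner ℝ ξ (y - x)) ^ n * gauss s x y : ℝ) : ℂ) :=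
      Complex.continuous_ofReal.comp ((by fun_prop : Continuous fun y : E =>
        (inner ℝ ξ (y - x)) ^ n).mul (contDiff_gauss s x (n := 0)).continuous)
    exact hc.aestronglyMeasurable.smul (Lp.aestronglyMeasurable h)
  · have hg := (gauss_pos s x y).le
    rw [norm_smul, norm_smul, Complex.norm_real, Complex.norm_real, norm_mul, norm_mul, norm_pow,
      Real.norm_of_nonneg hg, Real.norm_of_nonneg (Real.exp_pos _).le, ← mul_assoc, ← mul_assoc]
    gcongr
    have h1 : ‖inner ℝ ξ (y - x)‖ ≤ ‖ξ‖ * ‖y - x‖ := norm_inner_le_norm _ _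
    have h2 := Real.pow_div_factorial_le_exp (‖ξ‖ * ‖y - x‖) (by positivity) n
    rw [div_le_iff₀' (by positivity)] at h2
    exact (pow_le_pow_left₀ (norm_nonneg _) h1 n).trans h2

/-- The moments of a function orthogonal to all polynomials times Gaussians vanish. -/
theorem integral_pow_mul_gauss_smul_eq_zero {h : L2 E}
    (hh : ∀ m, ∀ u ∈ ladder hs x m, inner ℂ (schwartzIncl E u) h = 0) (ξ : E) (n : ℕ) :
    ∫ y, (((inner ℝ ξ (y - x)) ^ n * gauss s x y : ℝ) : ℂ) • h y = 0 := by
  refine ext_inner_left ℂ fun w => ?_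
  have h1 := hh _ _ (linearOp_pow_gaussOp_mem hs x ξ w n)
  rw [inner_schwartzIncl_left] at h1
  rw [inner_zero_right, ← integral_inner (integrable_pow_mul_gauss_smul hs x ξ n h), ← h1]
  refine integral_congr_ae (Eventually.of_forall fun y => ?_)
  simp only [linearOp_pow_gaussOp_apply, inner_smul_left, inner_smul_right, Complex.conj_ofReal]

theorem integral_cexp_gauss_smul_eq_zero {h : L2 E}
    (hh : ∀ m, ∀ u ∈ ladder hs x m, inner ℂ (schwartzIncl E u) h = 0) (ξ : E) :
    ∫ y, Complex.exp (Complex.I * ((inner ℝ ξ (y - x) : ℝ) : ℂ)) •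
      ((gauss s x y : ℂ) • h y) = 0 := by
  have e : ∀ (n : ℕ) (y : E), (((inner ℝ ξ (y - x) : ℝ) ^ n : ℝ) : ℂ) • ((gauss s x y : ℂ) • h y) =
      (((inner ℝ ξ (y - x)) ^ n * gauss s x y : ℝ) : ℂ) • h y := fun n y => by
    rw [smul_smul, Complex.ofReal_mul]
  refine integral_cexp_smul_eq_zero_of_moments (r := fun y => ‖ξ‖ * ‖y - x‖) (fun n => ?_)
    (fun y => abs_real_inner_le_norm _ _) ?_ fun n => ?_
  · simp only [e]
    exact (integrable_pow_mul_gauss_smul hs x ξ n h).aestronglyMeasurable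
  · refine (integrable_exp_mul_gauss_smul hs x ‖ξ‖ h).norm.congr
      (Eventually.of_forall fun y => ?_)
    simp only [norm_smul, Complex.norm_real, norm_mul]
    rw [Real.norm_of_nonneg (Real.exp_pos _).le, mul_assoc]
  · simp only [e]
    exact integral_pow_mul_gauss_smul_eq_zero hs x hh ξ n

/-- Polynomials times Gaussians are dense in `L²`. -/
theorem eq_zero_of_inner_ladder {h : L2 E}
    (hh : ∀ m, ∀ u ∈ ladder hs x m, inner ℂ (schwartzIncl E u) h = 0) : h = 0 := by
  have hk : Integrable fun y => (gauss s x y : ℂ) • h y := by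
    simpa using integrable_pow_mul_gauss_smul hs x 0 0 h
  have h0 := ae_eq_zero_of_fourier_eq_zero hk fun ξ => by
    rw [Real.fourier_eq]
    have h1 := integral_cexp_gauss_smul_eq_zero hs x hh (-(2 * Real.pi) • ξ)
    have e : ∀ y : E, Real.fourierChar (-inner ℝ y ξ) • (gauss s x y : ℂ) • h y =
        Complex.exp (-2 * Real.pi * Complex.I * (inner ℝ x ξ : ℝ)) •
          Complex.exp (Complex.I * (inner ℝ (-(2 * Real.pi) • ξ) (y - x) : ℝ)) •
            (gauss s x y : ℂ) • h y := fun y => by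
      rw [smul_smul, ← Complex.exp_add, Circle.smul_def, Real.fourierChar_apply]
      congr 2
      rw [inner_smul_left, inner_sub_right, real_inner_comm x ξ, real_inner_comm y ξ]
      simp
      ring
    simp only [e]
    rw [integral_smul, h1, smul_zero]
  rw [Lp.eq_zero_iff_ae_eq_zero]
  filter_upwards [h0] with y hy
  exact (smul_eq_zero.1 hy).resolve_left (by exact_mod_cast (gauss_pos s x y).ne')

end Density

/-! ### Diagonalization and compact resolvent -/

section Abstract

variable {H : Type*} [NormedAddCommGroup H] [InnerProductSpace ℂ H]

/-- A symmetric unbounded operator is diagonalizable on each finite-dimensional invariant subspace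
of its domain. -/
theorem le_span_eigenvectors_of_invariant {T : H →ₗ.[ℂ] H}
    (hT : ∀ u v : T.domain, inner ℂ (T u) (v : H) = inner ℂ (u : H) (T v)) {K : Submodule ℂ H}
    [FiniteDimensional ℂ K] (hK : K ≤ T.domain) (hinv : ∀ u : T.domain, (u : H) ∈ K → T u ∈ K) :
    K ≤ Submodule.span ℂ {u : H | u ∈ K ∧ ∃ v : T.domain, (v : H) = u ∧ ∃ l : ℝ,
      T v = (l : ℂ) • u} := by
  set L : K →ₗ[ℂ] K := (T.toFun ∘ₗ Submodule.inclusion hK).codRestrict K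
    fun u => hinv (Submodule.inclusion hK u) u.2 with hL
  have hL' : ∀ u : K, (L u : H) = T ⟨u, hK u.2⟩ := fun u => rfl
  have hsymm : L.IsSymmetric := fun u v => hT ⟨u, hK u.2⟩ ⟨v, hK v.2⟩
  have htop : ⨆ μ, Module.End.eigenspace L μ = ⊤ :=
    Submodule.orthogonal_eq_bot_iff.1 hsymm.orthogonalComplement_iSup_eigenspaces_eq_bot
  intro u hu
  have h1 : (⟨u, hu⟩ : K) ∈ ⨆ μ, Module.End.eigenspace L μ := by rw [htop]; trivial
  set S := Submodule.span ℂ {u : H | u ∈ K ∧ ∃ v : T.domain, (v : H) = u ∧ ∃ l : ℝ,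
      T v = (l : ℂ) • u}
  suffices h : ⨆ μ, Module.End.eigenspace L μ ≤ S.comap K.subtype from h h1
  refine iSup_le fun μ v hv => ?_
  rw [Submodule.mem_comap, Submodule.subtype_apply]
  by_cases hv0 : v = 0
  · rw [hv0]; exact zero_mem _
  have hμ := hsymm.conj_eigenvalue_eq_self
    (Module.End.hasEigenvalue_of_hasEigenvector ⟨hv, hv0⟩)
  refine Submodule.subset_span ⟨v.2, ⟨v, hK v.2⟩, rfl, μ.re, ?_⟩
  rw [Complex.conj_eq_iff_re.1 hμ, ← hL', Module.End.mem_eigenspace_iff.1 hv]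
  rfl

/-- If a symmetric operator acts in a triangular way on a filtration, with the eigenvalue `n c` in
degree `n`, then it is at least `m c` on the orthogonal complement of the `m`-th step. -/
theorem le_re_inner_of_filtration {V : Type*} [AddCommGroup V] [Module ℂ V] {ι : V →ₗ[ℂ] H}
    {A : Module.End ℂ V} (hA : ∀ u v, inner ℂ (ι (A u)) (ι v) = inner ℂ (ι u) (ι (A v)))
    {L : ℕ → Submodule ℂ V} (h0 : L 0 = ⊥) (hmono : Monotone L)
    [∀ n, FiniteDimensional ℂ (L n)] {c : ℝ} (hc : 0 ≤ c)
    (h : ∀ n, ∀ u ∈ L (n + 1), A u - ((n * c : ℝ) : ℂ) • u ∈ L n) (m n : ℕ) :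
    ∀ u ∈ L n, m * c * ‖ι u - ((L m).map ι).starProjection (ι u)‖ ^ 2 ≤
      (inner ℂ (ι (A u)) (ι u)).re := by
  have hpres : ∀ n, ∀ u ∈ L n, A u ∈ L n := fun n u hu => by
    have := add_mem (h n u (hmono n.le_succ hu)) (Submodule.smul_mem _ ((n * c : ℝ) : ℂ) hu)
    rwa [sub_add_cancel] at this
  induction n with
  | zero =>
    intro u hu
    rw [h0, Submodule.mem_bot] at hu
    simp [hu]
  | succ n ih =>
    intro u hu
    obtain ⟨u', hu', e'⟩ : ∃ u' ∈ L n, ι u' = ((L n).map ι).starProjection (ι u) :=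
      Submodule.starProjection_apply_mem ((L n).map ι) (ι u)
    set v := u - u' with hv
    have hvL : v ∈ L (n + 1) := sub_mem hu (hmono n.le_succ hu')
    have horth : ∀ w ∈ L n, inner ℂ (ι v) (ι w) = 0 := fun w hw => by
      rw [hv, map_sub, e']
      exact Submodule.starProjection_inner_eq_zero _ _ (Submodule.mem_map_of_mem hw)
    have horth' : ∀ w ∈ L n, inner ℂ (ι w) (ι v) = 0 := fun w hw =>
      inner_eq_zero_symm.1 (horth w hw)
    -- the part of `u` orthogonal to `L n` is an exact eigenvector, by symmetry
    have hz : ι (A v) = ((n * c : ℝ) : ℂ) • ι v := by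
      have hzL := h n v hvL
      have : inner ℂ (ι (A v - ((n * c : ℝ) : ℂ) • v)) (ι (A v - ((n * c : ℝ) : ℂ) • v)) = 0 := by
        nth_rw 1 [map_sub]
        rw [inner_sub_left, hA, map_smul, inner_smul_left, horth _ (hpres n _ hzL),
          horth _ hzL, mul_zero, sub_zero]
      rw [inner_self_eq_zero, map_sub, map_smul, sub_eq_zero] at this
      exact this
    have hsplit : u = u' + v := by rw [hv]; abel
    have hinner : (inner ℂ (ι (A u)) (ι u)).re =
        (inner ℂ (ι (A u')) (ι u')).re + n * c * ‖ι v‖ ^ 2 := by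
      rw [hsplit, map_add, map_add, map_add, inner_add_left, inner_add_right, inner_add_right, hz,
        inner_smul_left, inner_smul_left, horth _ hu', horth' _ (hpres n _ hu'), mul_zero,
        add_zero, zero_add, Complex.add_re, Complex.conj_ofReal, Complex.re_ofReal_mul]
      congr 2
      exact (norm_sq_eq_re_inner (𝕜 := ℂ) (ι v)).symm
    rw [hinner]
    have ih' := ih u' hu'
    have hnc : 0 ≤ n * c * ‖ι v‖ ^ 2 := by positivity
    rcases le_or_gt m n with hmn | hmn
    · have hproj : ((L m).map ι).starProjection (ι v) = 0 := by
        rw [Submodule.starProjection_apply_eq_zero_iff, Submodule.mem_orthogonal]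
        rintro _ ⟨w, hw, rfl⟩
        exact horth' w (hmono hmn hw)
      obtain ⟨w, hw, ew⟩ : ∃ w ∈ L m, ι w = ((L m).map ι).starProjection (ι u') :=
        Submodule.starProjection_apply_mem ((L m).map ι) (ι u')
      have e : ι u - ((L m).map ι).starProjection (ι u) = ι (u' - w) + ι v := by
        rw [hsplit, map_add, map_add, hproj, map_sub ι u' w, ew]; abel
      have hpyth : ‖ι (u' - w) + ι v‖ ^ 2 = ‖ι (u' - w)‖ ^ 2 + ‖ι v‖ ^ 2 := by
        rw [norm_add_sq (𝕜 := ℂ), horth' _ (sub_mem hu' (hmono hmn hw))]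
        simp
      rw [e, hpyth, mul_add]
      rw [← ew, ← map_sub] at ih'
      refine add_le_add ih' ?_
      gcongr
    · have hproj : ((L m).map ι).starProjection (ι u) = ι u :=
        Submodule.starProjection_eq_self_iff.2 (Submodule.mem_map_of_mem (hmono hmn hu))
      rw [hproj, sub_self, norm_zero]
      have : 0 ≤ m * c * ‖ι u' - ((L m).map ι).starProjection (ι u')‖ ^ 2 := by positivity
      simpa using add_nonneg (this.trans ih') hnc

theorem resolventFun_eq_res : resolventFun = res (-Complex.I) (by simp) := by
  ext t
  change ((t : ℂ) + Complex.I)⁻¹ = ((t : ℂ) - -Complex.I)⁻¹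
  rw [sub_neg_eq_add]

end Abstract

section Diagonal

variable {E : Type*} [NormedAddCommGroup E] [InnerProductSpace ℝ E] [FiniteDimensional ℝ E]
  [MeasurableSpace E] [BorelSpace E]

theorem bottDirac_symm (s : ℝ) (x : E) (u v : (bottDirac s x).domain) :
    inner ℂ (bottDirac s x u) (v : L2 E) = inner ℂ (u : L2 E) (bottDirac s x v) := by
  obtain ⟨_, ⟨u, rfl⟩⟩ := u
  obtain ⟨_, ⟨v, rfl⟩⟩ := v
  rw [bottDirac_apply, bottDirac_apply]
  exact formalAdjoint_bottDiracSchwartz s x u v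

variable {s : ℝ} (hs : 0 < s) (x : E)

theorem map_invLadder_le_span (m : ℕ) : (invLadder hs x m).map (schwartzIncl E) ≤
    Submodule.span ℂ {u : L2 E | u ∈ (invLadder hs x m).map (schwartzIncl E) ∧
      ∃ v : (bottDirac s x).domain, (v : L2 E) = u ∧ ∃ l : ℝ,
        bottDirac s x v = (l : ℂ) • u} := by
  refine le_span_eigenvectors_of_invariant (bottDirac_symm s x) ?_ ?_
  · rintro _ ⟨u, -, rfl⟩
    exact LinearMap.mem_range_self _ u
  · rintro ⟨_, v, rfl⟩ ⟨u, hu, e⟩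
    obtain rfl := schwartzIncl_injective e
    rw [bottDirac_apply]
    exact Submodule.mem_map_of_mem (bottDiracSchwartz_mem_invLadder hs x hu)

/-- The Bott-Dirac operator is essentially self-adjoint: it has an orthogonal basis of
eigenvectors. -/
theorem isDiagonal_bottDirac {s : ℝ} (hs : 0 < s) (x : E) : IsDiagonal (bottDirac s x) where
  symm := bottDirac_symm s x
  dense := by
    rw [Submodule.topologicalClosure_eq_top_iff, Submodule.eq_bot_iff]
    intro h hh
    refine eq_zero_of_inner_ladder hs x fun m u hu => ?_
    refine (Submodule.mem_orthogonal _ _).1 hh _ ?_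
    have h1 := map_invLadder_le_span hs x m
      (Submodule.mem_map_of_mem (ladder_le_invLadder hs x m hu))
    refine Submodule.span_mono ?_ h1
    rintro v ⟨-, hv⟩
    exact hv

/-- The Schwartz functions that lie in one of the finite-dimensional invariant subspaces. -/
def core : Submodule ℂ (L2 E) := ⨆ m, (invLadder hs x m).map (schwartzIncl E)

theorem mem_core {u : L2 E} :
    u ∈ core hs x ↔ ∃ m, u ∈ (invLadder hs x m).map (schwartzIncl E) :=
  Submodule.mem_iSup_of_directed _ (Monotone.directed_le fun _ _ h =>
    Submodule.map_mono (invLadder_mono hs x h))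

theorem dense_core : Dense (core hs x : Set (L2 E)) := by
  rw [Submodule.dense_iff_topologicalClosure_eq_top, Submodule.topologicalClosure_eq_top_iff,
    Submodule.eq_bot_iff]
  intro h hh
  refine eq_zero_of_inner_ladder hs x fun m u hu => (Submodule.mem_orthogonal _ _).1 hh _ ?_
  exact (mem_core hs x).2 ⟨m, Submodule.mem_map_of_mem (ladder_le_invLadder hs x m hu)⟩

theorem calculus_mem_map_invLadder (ψ : ℝ →ᵇ ℂ) {m : ℕ} {u : L2 E}
    (hu : u ∈ (invLadder hs x m).map (schwartzIncl E)) :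
    (isDiagonal_bottDirac hs x).calculus ψ u ∈ (invLadder hs x m).map (schwartzIncl E) := by
  have h := map_invLadder_le_span hs x m hu
  clear hu
  induction h using Submodule.span_induction with
  | mem v hv =>
    obtain ⟨hvK, v, rfl, l, hl⟩ := hv
    rw [(isDiagonal_bottDirac hs x).calculus_eigenvector hl]
    exact Submodule.smul_mem _ _ hvK
  | zero => rw [map_zero]; exact zero_mem _
  | add a b _ _ ha hb => rw [map_add]; exact add_mem ha hb
  | smul c a _ ha => rw [map_smul]; exact Submodule.smul_mem _ _ ha

theorem formalAdjoint_numberOp : FormalAdjoint (numberOp E) (numberOp E) := by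
  have h := FormalAdjoint.sum (s := Finset.univ)
    fun i => (formalAdjoint_hatOp (E := E) i).mul (formalAdjoint_leftOp i)
  have e : ∀ i, leftOp E i * -hatOp E i = hatOp E i * leftOp E i := fun i => by
    rw [mul_neg, leftOp_mul_hatOp, neg_neg]
  rw [numberOp]
  rwa [Finset.sum_congr rfl fun i _ => e i] at h

theorem formalAdjoint_oscillator (s : ℝ) (x : E) :
    FormalAdjoint (oscillator s x) (oscillator s x) := by
  rw [oscillator_eq]
  have h1 : FormalAdjoint (1 : Module.End ℂ 𝓢(E, Cliff E)) 1 := fun u v => rfl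
  exact ((formalAdjoint_bottDiracSchwartz s x).mul (formalAdjoint_bottDiracSchwartz s x)).add
    ((formalAdjoint_numberOp.add (h1.ofReal_smul _)).ofReal_smul _)

/-- `B² = H + s⁻¹ (N + d)` dominates the oscillator `H`, because `N ≥ -d`. -/
theorem re_inner_oscillator_le {s : ℝ} (hs : 0 < s) (x : E) (u : 𝓢(E, Cliff E)) :
    (inner ℂ (schwartzIncl E (oscillator s x u)) (schwartzIncl E u)).re ≤
      ‖schwartzIncl E (bottDiracSchwartz s x u)‖ ^ 2 := by
  rw [(formalAdjoint_bottDiracSchwartz s x).norm_sq, formalAdjoint_oscillator, oscillator_eq]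
  have h2 := (abs_le.1 (abs_re_inner_numberOp_le u)).1
  have h3 : RCLike.re (inner ℂ (schwartzIncl E u) (schwartzIncl E u)) = ‖schwartzIncl E u‖ ^ 2 :=
    inner_self_eq_norm_sq (𝕜 := ℂ) _
  simp only [LinearMap.add_apply, LinearMap.smul_apply, map_add, map_smul, inner_add_right,
    inner_smul_right, Complex.add_re, Complex.re_ofReal_mul, Module.End.one_apply]
  rw [RCLike.re_to_complex] at h3
  rw [h3]
  have : 0 ≤ s⁻¹ * ((inner ℂ (schwartzIncl E u) (schwartzIncl E (numberOp E u))).re +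
    finrank ℝ E * ‖schwartzIncl E u‖ ^ 2) := mul_nonneg (by positivity) (by linarith)
  rw [neg_mul]
  exact add_le_of_nonpos_right (neg_nonpos.2 this)

/-- The image of the unit ball under the resolvent is close to the span of the low degrees: in high
degrees the oscillator, hence also the square of the Bott-Dirac operator, is large. -/
theorem norm_sub_starProjection_calculus_le {u : L2 E} (hu : u ∈ core hs x) (m : ℕ) :
    2 * m * s⁻¹ * ‖(isDiagonal_bottDirac hs x).calculus resolventFun u -
      ((ladder hs x m).map (schwartzIncl E)).starProjection
        ((isDiagonal_bottDirac hs x).calculus resolventFun u)‖ ^ 2 ≤ ‖u‖ ^ 2 := by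
  obtain ⟨n, hn⟩ := (mem_core hs x).1 hu
  obtain ⟨v, hv, e⟩ := calculus_mem_map_invLadder hs x resolventFun hn
  have hvu : schwartzIncl E (bottDiracSchwartz s x v) + Complex.I • schwartzIncl E v = u := by
    have h := (isDiagonal_bottDirac hs x).apply_calculus_res (z := -Complex.I) (by simp)
      (u := u) (v := ⟨schwartzIncl E v, LinearMap.mem_range_self _ v⟩) (by rw [← resolventFun_eq_res]; exact e)
    rw [bottDirac_apply, neg_smul, sub_neg_eq_add] at h
    exact h
  have h1 := le_re_inner_of_filtration (ι := schwartzIncl E) (formalAdjoint_oscillator s x)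
    (L := ladder hs x) rfl (ladder_mono hs x) (c := 2 * s⁻¹) (by positivity)
    (fun n u hu => by
      have := oscillator_sub_mem_ladder hs x hu
      rwa [mul_assoc, mul_left_comm] at this) m (n + 1) v (invLadder_le hs x n hv)
  have h2 := re_inner_oscillator_le hs x v
  have h3 := norm_bottDiracSchwartz_add_smul_sq s x (Or.inl rfl) v
  rw [hvu] at h3
  rw [← e, h3]
  refine le_trans (le_of_eq ?_) ((h1.trans h2).trans (le_add_of_nonneg_right (sq_nonneg _)))
  ring

/-- The Bott-Dirac operator has compact resolvent. -/
theorem isCompactOperator_calculus_resolventFun :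
    IsCompactOperator ((isDiagonal_bottDirac hs x).calculus resolventFun) := by
  set R := (isDiagonal_bottDirac hs x).calculus resolventFun with hR
  set P : ℕ → L2 E →L[ℂ] L2 E := fun m =>
    ((ladder hs x m).map (schwartzIncl E)).starProjection with hP
  have hbd : ∀ m : ℕ, ‖P (m + 1) ∘L R - R‖ ≤ √(s / (2 * ((m + 1 : ℕ) : ℝ))) := fun m => by
    refine opNorm_le_of_dense (dense_core hs x) (Real.sqrt_nonneg _) fun u hu => ?_
    have h := norm_sub_starProjection_calculus_le hs x hu (m + 1)
    rw [sub_apply, ContinuousLinearMap.comp_apply, norm_sub_rev]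
    refine le_of_sq_le_sq ?_ (by positivity)
    rw [mul_pow, Real.sq_sqrt (by positivity)]
    change 2 * ((m + 1 : ℕ) : ℝ) * s⁻¹ * ‖R u - P (m + 1) (R u)‖ ^ 2 ≤ _ at h
    generalize ‖R u - P (m + 1) (R u)‖ = a at h
    generalize ‖u‖ = b at h
    have hm : 0 < 2 * ((m + 1 : ℕ) : ℝ) := by positivity
    generalize 2 * ((m + 1 : ℕ) : ℝ) = c at h hm
    calc a ^ 2 = s / c * (c * s⁻¹ * a ^ 2) := by field_simp
      _ ≤ s / c * b ^ 2 := by gcongr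
  have hlim : Tendsto (fun m => P (m + 1) ∘L R) atTop (𝓝 R) := by
    rw [tendsto_iff_norm_sub_tendsto_zero]
    refine squeeze_zero (fun _ => norm_nonneg _) hbd ?_
    have h1 : Tendsto (fun m : ℕ => s / 2 / ((m + 1 : ℕ) : ℝ)) atTop (𝓝 0) :=
      (tendsto_const_div_atTop_nhds_zero_nat (s / 2)).comp (tendsto_add_atTop_nat 1)
    have h2 := (Real.continuous_sqrt.tendsto 0).comp h1
    rw [Real.sqrt_zero] at h2
    refine h2.congr fun m => ?_
    simp only [Function.comp_apply]
    rw [div_div]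
  refine isCompactOperator_of_tendsto hlim (Eventually.of_forall fun m => ?_)
  have h1 : IsCompactOperator (P (m + 1)) := by
    have : ProperSpace ((ladder hs x (m + 1)).map (schwartzIncl E)) :=
      FiniteDimensional.proper ℂ _
    have := (isCompactOperator_of_locallyCompactSpace_dom
      ((ladder hs x (m + 1)).map (schwartzIncl E)).orthogonalProjectionOnto).clm_comp
      ((ladder hs x (m + 1)).map (schwartzIncl E)).subtypeL
    exact this
  exact h1.comp_clm R

/-- The functions `t ↦ (t + i)⁻¹ p(t)`, with `p` bounded, give compact operators. -/
theorem isCompactOperator_calculus_resolventFun_mul (p : ℝ →ᵇ ℂ) :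
    IsCompactOperator ((isDiagonal_bottDirac hs x).calculus (resolventFun * p)) := by
  rw [map_mul]
  exact (isCompactOperator_calculus_resolventFun hs x).comp_clm _

end Diagonal

/-! ### Relative bounds between Bott-Dirac operators -/

section RelativeBounds

variable {E : Type*} [NormedAddCommGroup E] [InnerProductSpace ℝ E] [FiniteDimensional ℝ E]
  [MeasurableSpace E] [BorelSpace E]

theorem norm_schwartzIncl_le {u v : 𝓢(E, Cliff E)} {c : ℝ} (h : ∀ y, ‖u y‖ ≤ c * ‖v y‖) :
    ‖schwartzIncl E u‖ ≤ c * ‖schwartzIncl E v‖ := by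
  refine Lp.norm_le_mul_norm_of_ae_le_mul ?_
  filter_upwards [schwartzIncl_ae u, schwartzIncl_ae v] with y h1 h2
  rw [h1, h2]
  exact h y

theorem norm_bottDiracSchwartz_sub_right_le (s : ℝ) (x y : E) (u : 𝓢(E, Cliff E)) :
    ‖schwartzIncl E (bottDiracSchwartz s y u) - schwartzIncl E (bottDiracSchwartz s x u)‖ ≤
      ‖x - y‖ * ‖schwartzIncl E u‖ := by
  rw [← map_sub]
  refine norm_schwartzIncl_le fun z => le_of_eq ?_
  have e : (bottDiracSchwartz s y u - bottDiracSchwartz s x u) z = leftMul (x - y) (u z) := by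
    rw [bottDiracSchwartz_eq, bottDiracSchwartz_eq, LinearMap.add_apply, LinearMap.add_apply,
      add_sub_add_left_eq_sub, sub_apply, bottShift_apply, bottShift_apply]
    have h : z - y = (x - y) + (z - x) := by abel
    rw [h, leftMul_add, add_apply, add_sub_cancel_right]
  rw [e, norm_leftMul]

/-- The dependence of the Bott-Dirac operator on the base point is Lipschitz. -/
theorem relBound_right {s : ℝ} (hs : 0 < s) (x y : E) :
    RelBound (bottDirac s x) (bottDirac s y) (isDiagonal_bottDirac hs y) 1 ‖x - y‖ where
  domain_le := le_refl _
  nonneg := norm_nonneg _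
  bound := by
    rintro u - ⟨_, v, rfl⟩ hv
    rw [map_one, one_apply_eq_self] at hv
    change schwartzIncl E v = u at hv
    rw [bottDirac_apply, bottDirac_apply, ← hv]
    exact norm_bottDiracSchwartz_sub_right_le s x y v

theorem bottDirac_add_smul_of_calculus {s : ℝ} (hs : 0 < s) (x : E) {z : ℂ} (hz : z.im ≠ 0)
    {u : L2 E} {v : 𝓢(E, Cliff E)}
    (h : schwartzIncl E v = (isDiagonal_bottDirac hs x).calculus (res z hz) u) :
    schwartzIncl E (bottDiracSchwartz s x v) + (-z) • schwartzIncl E v = u := by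
  have h := (isDiagonal_bottDirac hs x).apply_calculus_res hz (u := u)
    (v := ⟨schwartzIncl E v, LinearMap.mem_range_self _ v⟩) h
  rw [bottDirac_apply, sub_eq_add_neg, ← neg_smul] at h
  exact h

/-- The dependence of the Bott-Dirac operator on `s` is continuous in the graph norm. -/
theorem relBound_left {s' : ℝ} (hs' : 1 ≤ s') (s : ℝ) (x : E) :
    RelBound (bottDirac s x) (bottDirac s' x) (isDiagonal_bottDirac (one_pos.trans_le hs') x)
      resolventFun (|s'⁻¹ - s⁻¹| * (s' * (1 + finrank ℝ E))) where
  domain_le := le_refl _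
  nonneg := by positivity
  bound := by
    rintro u - ⟨_, v, rfl⟩ hv
    rw [resolventFun_eq_res] at hv
    have h1 := bottDirac_add_smul_of_calculus (one_pos.trans_le hs') x _ hv
    rw [neg_neg] at h1
    have h2 := norm_diracOp_le hs' x v
    rw [h1] at h2
    rw [bottDirac_apply, bottDirac_apply, ← map_sub, bottDiracSchwartz_sub_left, map_smul,
      norm_smul, Complex.norm_real, Real.norm_eq_abs, mul_assoc]
    gcongr

end RelativeBounds

/-! ### Decay away from the base point -/

section Decay

variable {E : Type*} [NormedAddCommGroup E] [InnerProductSpace ℝ E] [FiniteDimensional ℝ E]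
  [MeasurableSpace E] [BorelSpace E]

theorem inner_chi {A : Set E} (hA : MeasurableSet A) (u v : L2 E) :
    inner ℂ (chi A hA u) v = inner ℂ u (chi A hA v) := by
  rw [L2.inner_def, L2.inner_def]
  refine integral_congr_ae ?_
  filter_upwards [chi_ae hA u, chi_ae hA v] with y h1 h2
  rw [h1, h2]
  by_cases h : y ∈ A <;> simp [h]

theorem norm_one_sub_chiBall_le {R : ℝ} (hR : 0 < R) (x : E) (u : 𝓢(E, Cliff E)) :
    ‖(1 - chiBall x R : L2 E →L[ℂ] L2 E) (schwartzIncl E u)‖ ≤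
      R⁻¹ * ‖schwartzIncl E (bottShift x u)‖ := by
  refine Lp.norm_le_mul_norm_of_ae_le_mul ?_
  rw [sub_apply, one_apply_eq_self]
  filter_upwards [schwartzIncl_ae u, schwartzIncl_ae (bottShift x u),
    chi_ae (measurableSet_ball (x := x) (ε := R)) (schwartzIncl E u),
    Lp.coeFn_sub (schwartzIncl E u) (chiBall x R (schwartzIncl E u))] with y h1 h2 h3 h4
  rw [h4, Pi.sub_apply, chiBall, h3, h2, bottShift_apply, norm_leftMul]
  by_cases hy : y ∈ Metric.ball x R
  · rw [Set.indicator_of_mem hy, sub_self, norm_zero]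
    positivity
  · rw [Set.indicator_of_notMem hy, sub_zero, h1, ← mul_assoc]
    refine le_mul_of_one_le_left (norm_nonneg _) ?_
    rw [Metric.mem_ball, not_lt, dist_eq_norm] at hy
    rwa [one_le_inv_mul₀ hR]

/-- The resolvent decays away from the base point, at a rate that does not depend on the
dimension. -/
theorem norm_calculus_resolventFun_comp_le {s : ℝ} (hs : 1 ≤ s)
    (hsd : 2 * (finrank ℝ E : ℝ) ≤ s) (x : E) {R : ℝ} (hR : 0 < R) :
    ‖(isDiagonal_bottDirac (one_pos.trans_le hs) x).calculus resolventFun ∘L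
      (1 - chiBall x R)‖ ≤ R⁻¹ := by
  set hB := isDiagonal_bottDirac (one_pos.trans_le hs) x
  have hstar : star (resolventFun) = res Complex.I (by simp) := by
    ext t
    change star (((t : ℂ) + Complex.I)⁻¹) = ((t : ℂ) - Complex.I)⁻¹
    simp [sub_eq_add_neg]
  have hadj : ContinuousLinearMap.adjoint (hB.calculus resolventFun ∘L
      (1 - chiBall x R : L2 E →L[ℂ] L2 E)) =
      (1 - chiBall x R) ∘L hB.calculus (res Complex.I (by simp)) := by
    rw [← hstar, map_star, ContinuousLinearMap.star_eq_adjoint, ContinuousLinearMap.adjoint_comp]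
    congr 1
    symm
    rw [ContinuousLinearMap.eq_adjoint_iff]
    intro u v
    rw [sub_apply, sub_apply, one_apply_eq_self, one_apply_eq_self, inner_sub_left,
      inner_sub_right, chiBall, inner_chi]
  rw [← LinearIsometryEquiv.norm_map ContinuousLinearMap.adjoint, hadj]
  refine opNorm_le_of_dense hB.dense_eigenSpan (by positivity) fun u hu => ?_
  obtain ⟨v, hv⟩ := eigenSpan_le_domain _
    (hB.calculus_mem_eigenSpan (res Complex.I (by simp)) hu)
  rw [ContinuousLinearMap.comp_apply, ← hv]
  refine (norm_one_sub_chiBall_le hR x v).trans ?_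
  gcongr
  have h := norm_bottShift_le hs hsd x (Or.inr rfl) v
  rwa [bottDirac_add_smul_of_calculus (one_pos.trans_le hs) x (by simp) hv] at h

/-- The function `t ↦ (t + i) a² / (a² + t²)`, the quotient of the cutoff by `(t + i)⁻¹`. -/
def cutoffQuotient (a : ℝ) (ha : 1 ≤ a) : ℝ →ᵇ ℂ :=
  BoundedContinuousFunction.ofNormedAddCommGroup
    (fun t : ℝ => ((t : ℂ) + Complex.I) * ((a ^ 2 / (a ^ 2 + t ^ 2) : ℝ) : ℂ))
    ((Complex.continuous_ofReal.add continuous_const).mul (Complex.continuous_ofReal.comp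
      (Continuous.div (by fun_prop) (by fun_prop) fun t => by positivity))) (a ^ 2)
    (fun t => by
      have h1 : ‖(t : ℂ) + Complex.I‖ ≤ a ^ 2 + t ^ 2 := by
        have h2 : ‖(t : ℂ) + Complex.I‖ ^ 2 = t ^ 2 + 1 := by
          rw [← Complex.normSq_eq_norm_sq, Complex.normSq_apply]; simp; ring
        refine le_of_sq_le_sq ?_ (by positivity)
        rw [h2]
        have h3 : 1 ≤ a ^ 2 := one_le_pow₀ ha
        nlinarith [sq_nonneg t, h3]
      rw [norm_mul, Complex.norm_real, Real.norm_of_nonneg (by positivity), ← mul_div_assoc,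
        div_le_iff₀ (by positivity), mul_comm]
      gcongr)

theorem norm_cutoffQuotient_le (a : ℝ) (ha : 1 ≤ a) : ‖cutoffQuotient a ha‖ ≤ a ^ 2 :=
  BoundedContinuousFunction.norm_ofNormedAddCommGroup_le _ (by positivity) _

theorem cutoff_eq_resolventFun_mul (a : ℝ) (ha : 1 ≤ a) :
    cutoff a (one_pos.trans_le ha) = resolventFun * cutoffQuotient a ha := by
  ext t
  change _ = ((t : ℂ) + Complex.I)⁻¹ * (((t : ℂ) + Complex.I) * _)
  rw [inv_mul_cancel_left₀ (ofReal_add_I_ne_zero t), cutoff_apply]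

theorem norm_calculus_cutoff_comp_le {s : ℝ} (hs : 1 ≤ s)
    (hsd : 2 * (finrank ℝ E : ℝ) ≤ s) (x : E) {R : ℝ} (hR : 0 < R) {a : ℝ} (ha : 1 ≤ a) :
    ‖(isDiagonal_bottDirac (one_pos.trans_le hs) x).calculus (cutoff a (one_pos.trans_le ha)) ∘L
      (1 - chiBall x R)‖ ≤ a ^ 2 * R⁻¹ := by
  rw [cutoff_eq_resolventFun_mul a ha, mul_comm, map_mul, ContinuousLinearMap.mul_def,
    ContinuousLinearMap.comp_assoc]
  refine (ContinuousLinearMap.opNorm_comp_le _ _).trans ?_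
  gcongr
  · exact (IsDiagonal.norm_calculus_le _ _).trans (norm_cutoffQuotient_le a ha)
  · exact norm_calculus_resolventFun_comp_le hs hsd x hR

theorem isCompactOperator_calculus_cutoff {s : ℝ} (hs : 0 < s) (x : E) {a : ℝ} (ha : 1 ≤ a) :
    IsCompactOperator ((isDiagonal_bottDirac hs x).calculus (cutoff a (one_pos.trans_le ha))) := by
  rw [cutoff_eq_resolventFun_mul a ha]
  exact isCompactOperator_calculus_resolventFun_mul hs x _

end Decay

/-! ### Weighted estimates for the wave group -/

section WeightedAbstract

variable {H : Type*} [NormedAddCommGroup H] [InnerProductSpace ℂ H] [CompleteSpace H]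
  {T : H →ₗ.[ℂ] H} (hT : IsDiagonal T) (N : H →L[ℂ] H)

/-- A weighted norm estimate, with weight `N`, passes to integrals of functions. -/
theorem norm_weight_calculus_le_integral {Ω : Type*} [MeasurableSpace Ω]
    {μ : Measure Ω} {k : Ω → ℝ →ᵇ ℂ} {ψ : ℝ →ᵇ ℂ} {g G : Ω → ℝ} (hg : Integrable g μ)
    (hk : ∀ t, AEStronglyMeasurable (fun ω => k ω t) μ) (hkg : ∀ ω, ‖k ω‖ ≤ g ω)
    (hψ : ∀ t, ψ t = ∫ ω, k ω t ∂μ) (hG : Integrable G μ) {v : H}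
    (hC : ∀ ω, ‖N (hT.calculus (k ω) v)‖ ≤ G ω) : ‖N (hT.calculus ψ v)‖ ≤ ∫ ω, G ω ∂μ := by
  have h1 : ‖inner ℂ (N (hT.calculus ψ v)) (N (hT.calculus ψ v))‖ ≤
      ‖N (hT.calculus ψ v)‖ * ∫ ω, G ω ∂μ := by
    set u := N (hT.calculus ψ v) with hu
    rw [show inner ℂ u u = inner ℂ (ContinuousLinearMap.adjoint N u) (hT.calculus ψ v) from by
      rw [ContinuousLinearMap.adjoint_inner_left],
      (hT.inner_calculus_eq_integral hg hk hkg hψ _ v).2, ← integral_const_mul]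
    refine norm_integral_le_of_norm_le (hG.const_mul _) (Eventually.of_forall fun ω => ?_)
    rw [ContinuousLinearMap.adjoint_inner_left]
    exact (norm_inner_le_norm _ _).trans (by gcongr; exact hC ω)
  rw [inner_self_eq_norm_sq_to_K, norm_pow, RCLike.norm_ofReal, abs_norm, sq] at h1
  rcases (norm_nonneg (N (hT.calculus ψ v))).eq_or_lt' with h0 | h0
  · rw [h0]
    exact integral_nonneg fun ω => (norm_nonneg _).trans (hC ω)
  · exact le_of_mul_le_mul_left h1 h0

theorem norm_weight_calculus_le_of_tendsto {ψs : ℕ → ℝ →ᵇ ℂ} {ψ : ℝ →ᵇ ℂ} {M C : ℝ} {Cs : ℕ → ℝ}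
    (hM : ∀ n, ‖ψs n‖ ≤ M) (h : ∀ t, Tendsto (fun n => ψs n t) atTop (𝓝 (ψ t))) {v : H}
    (hCs : Tendsto Cs atTop (𝓝 C)) (hC : ∀ᶠ n in atTop, ‖N (hT.calculus (ψs n) v)‖ ≤ Cs n) :
    ‖N (hT.calculus ψ v)‖ ≤ C :=
  le_of_tendsto_of_tendsto ((N.continuous.tendsto _).comp (hT.tendsto_calculus hM h v)).norm hCs hC

theorem norm_weight_calculus_mul_le {φ ψ : ℝ →ᵇ ℂ} {C C' : ℝ} (hC : 0 ≤ C)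
    (h : ∀ v, ‖N (hT.calculus φ v)‖ ≤ C * ‖N v‖) (h' : ∀ v, ‖N (hT.calculus ψ v)‖ ≤ C' * ‖N v‖)
    (v : H) : ‖N (hT.calculus (φ * ψ) v)‖ ≤ C * C' * ‖N v‖ := by
  rw [map_mul, ContinuousLinearMap.mul_def, ContinuousLinearMap.comp_apply, mul_assoc]
  exact (h _).trans (by gcongr; exact h' v)

theorem norm_weight_calculus_pow_le {φ : ℝ →ᵇ ℂ} {C : ℝ} (hC : 0 ≤ C)
    (h : ∀ v, ‖N (hT.calculus φ v)‖ ≤ C * ‖N v‖) (n : ℕ) (v : H) :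
    ‖N (hT.calculus (φ ^ n) v)‖ ≤ C ^ n * ‖N v‖ := by
  induction n generalizing v with
  | zero => simp
  | succ n ih =>
    rw [pow_succ, pow_succ]
    exact norm_weight_calculus_mul_le hT N (by positivity) ih h v

/-- The function `t ↦ exp (i τ t)`. -/
def expFun (τ : ℝ) : ℝ →ᵇ ℂ :=
  BoundedContinuousFunction.ofNormedAddCommGroup
    (fun t : ℝ => Complex.exp ((τ * t : ℝ) * Complex.I)) (by fun_prop) 1
    (fun t => (Complex.norm_exp_ofReal_mul_I _).le)

theorem expFun_apply (τ t : ℝ) : expFun τ t = Complex.exp ((τ * t : ℝ) * Complex.I) := rfl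

theorem norm_expFun_le (τ : ℝ) : ‖expFun τ‖ ≤ 1 :=
  BoundedContinuousFunction.norm_ofNormedAddCommGroup_le _ zero_le_one _

variable {N}

/-- A weighted resolvent estimate on the imaginary axis gives a weighted estimate for the wave
group, by the exponential formula `exp (i τ t) = lim (1 - i τ t / n)⁻ⁿ`. -/
theorem norm_weight_calculus_expFun_le {ρ : ℝ}
    (h : ∀ (b : ℝ) (hb : ((b : ℂ) * Complex.I).im ≠ 0), ρ < |b| → ∀ v,
      (|b| - ρ) * ‖N (hT.calculus (res (b * Complex.I) hb) v)‖ ≤ ‖N v‖) (τ : ℝ) (v : H) :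
    ‖N (hT.calculus (expFun τ) v)‖ ≤ Real.exp (ρ * |τ|) * ‖N v‖ := by
  rcases eq_or_ne τ 0 with rfl | hτ
  · have : expFun 0 = 1 := by ext t; simp [expFun_apply]
    rw [this, map_one]
    simp
  have hb : ∀ n : ℕ, (((-((n + 1 : ℕ) : ℝ) / τ : ℝ) : ℂ) * Complex.I).im ≠ 0 := fun n => by
    refine mul_I_im_ne_zero (div_ne_zero (neg_ne_zero.2 ?_) hτ)
    positivity
  set b : ℕ → ℝ := fun n => -((n + 1 : ℕ) : ℝ) / τ with hbdef
  have habs : ∀ n, |b n| = ((n + 1 : ℕ) : ℝ) / |τ| := fun n => by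
    rw [hbdef, abs_div, abs_neg, abs_of_nonneg (by positivity)]
  have hbpos : ∀ n, 0 < |b n| := fun n => by rw [habs]; positivity
  -- the function `t ↦ (1 - i τ t / n)⁻¹`
  set φ : ℕ → ℝ →ᵇ ℂ := fun n => (-((b n : ℂ) * Complex.I)) • res (b n * Complex.I) (hb n) with hφ
  have hφn : ∀ n, ‖φ n‖ ≤ 1 := fun n => by
    rw [hφ, norm_smul, norm_neg, norm_mul, Complex.norm_I, mul_one, Complex.norm_real]
    have h1 := norm_res_le (b n * Complex.I) (hb n)
    have h2 : ((b n : ℂ) * Complex.I).im = b n := by simp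
    rw [h2] at h1
    calc ‖b n‖ * _ ≤ |b n| * |b n|⁻¹ := by rw [Real.norm_eq_abs]; gcongr
      _ = 1 := mul_inv_cancel₀ (hbpos n).ne'
  have hφt : ∀ n t, φ n t = (1 + (-((τ * t : ℝ) * Complex.I)) / ((n + 1 : ℕ) : ℂ))⁻¹ :=
    fun n t => by
      change (-((b n : ℂ) * Complex.I)) * ((t : ℂ) - b n * Complex.I)⁻¹ = _
      have h1 : ((b n : ℂ) * Complex.I) ≠ 0 := fun h0 => hb n (by rw [h0]; rfl)
      have h2 : (τ : ℂ) ≠ 0 := by exact_mod_cast hτ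
      have h3 : ((n + 1 : ℕ) : ℂ) ≠ 0 := by exact_mod_cast n.succ_ne_zero
      have h4 : (b n : ℂ) = -((n + 1 : ℕ) : ℂ) / τ := by rw [hbdef]; push_cast; ring
      have e : 1 + (-((τ * t : ℝ) * Complex.I)) / ((n + 1 : ℕ) : ℂ) =
          ((t : ℂ) - b n * Complex.I) * (-((b n : ℂ) * Complex.I))⁻¹ := by
        rw [eq_mul_inv_iff_mul_eq₀ (neg_ne_zero.2 h1), h4]
        field_simp
        push_cast
        ring_nf
        rw [Complex.I_sq]
        ring
      rw [e, mul_inv, inv_inv, mul_comm]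
  have hC0 : Tendsto (fun n : ℕ => ((1 - ρ * |τ| / ((n + 1 : ℕ) : ℝ))⁻¹) ^ (n + 1)) atTop
      (𝓝 (Real.exp (ρ * |τ|))) := by
    have h1 := ((Real.tendsto_one_add_div_pow_exp (-(ρ * |τ|))).comp
      (tendsto_add_atTop_nat 1)).inv₀ (Real.exp_pos _).ne'
    rw [← Real.exp_neg, neg_neg] at h1
    refine h1.congr fun n => ?_
    simp only [Function.comp_apply, neg_div, ← sub_eq_add_neg, inv_pow]
  have hlarge : ∀ᶠ n : ℕ in atTop, ρ * |τ| < ((n + 1 : ℕ) : ℝ) := by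
    filter_upwards [(tendsto_natCast_atTop_atTop (R := ℝ)).eventually_gt_atTop (ρ * |τ|)] with n hn
    push_cast
    linarith
  refine norm_weight_calculus_le_of_tendsto hT N (ψs := fun n => φ n ^ (n + 1)) (M := 1)
    (fun n => ?_) (fun t => ?_) (hC0.mul_const ‖N v‖) ?_
  · exact (norm_pow_le' _ n.succ_pos).trans (pow_le_one₀ (norm_nonneg _) (hφn n))
  · have h1 := ((Complex.tendsto_one_add_div_pow_exp (-((τ * t : ℝ) * Complex.I))).comp
      (tendsto_add_atTop_nat 1)).inv₀ (Complex.exp_ne_zero _)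
    rw [← Complex.exp_neg, neg_neg] at h1
    refine h1.congr fun n => ?_
    change _ = (φ n t) ^ (n + 1)
    rw [hφt, inv_pow]
    rfl
  · filter_upwards [hlarge] with n hn
    have hτ' : 0 < |τ| := abs_pos.2 hτ
    have hρb : ρ < |b n| := by rw [habs, lt_div_iff₀ hτ']; exact hn
    have hpos : 0 < 1 - ρ * |τ| / ((n + 1 : ℕ) : ℝ) := by
      rw [sub_pos, div_lt_one (by positivity)]; exact hn
    refine norm_weight_calculus_pow_le hT N (inv_nonneg.2 hpos.le) (fun v => ?_) _ v
    have h1 := h (b n) (hb n) hρb v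
    rw [hφ, map_smul, smul_apply, map_smul, norm_smul, norm_neg, norm_mul, Complex.norm_I, mul_one,
      Complex.norm_real, Real.norm_eq_abs, le_inv_mul_iff₀ hpos]
    refine le_trans (le_of_eq ?_) h1
    rw [← mul_assoc]
    congr 1
    rw [habs]
    field_simp

/-- The function `t ↦ sinc ((t - w) / δ)`. -/
def sincShift (δ w : ℝ) : ℝ →ᵇ ℂ :=
  BoundedContinuousFunction.ofNormedAddCommGroup (fun t : ℝ => (Real.sinc ((t - w) / δ) : ℂ))
    (Complex.continuous_ofReal.comp (Real.continuous_sinc.comp (by fun_prop))) 1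
    (fun t => by
      rw [Complex.norm_real]
      exact Real.abs_sinc_le_one _)

theorem ofReal_sinc_eq_integral (r : ℝ) :
    (Real.sinc r : ℂ) = ∫ a in (-1 : ℝ)..1, (1 / 2 : ℂ) * Complex.exp ((a * r : ℝ) * Complex.I) := by
  have h1 := intervalIntegral.smul_integral_comp_mul_right (a := -1) (b := 1)
    (fun t : ℝ => Complex.exp (t * Complex.I)) r
  rw [neg_one_mul, one_mul, integral_exp_mul_I_eq_sinc] at h1
  rw [intervalIntegral.integral_const_mul]
  rcases eq_or_ne r 0 with rfl | hr
  · simp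
    norm_num
  · have hr' : (r : ℂ) ≠ 0 := by exact_mod_cast hr
    have h2 : (r : ℂ) * ∫ a in (-1 : ℝ)..1, Complex.exp ((a * r : ℝ) * Complex.I) =
        r * (2 * Real.sinc r) := by
      rw [← Complex.real_smul, h1]; ring
    rw [mul_left_cancel₀ hr' h2]
    ring

/-- The Fourier transform of `sinc` is supported in `[-1, 1]`, so that a weighted estimate for the
wave group up to time `1/δ` is enough. -/
theorem norm_weight_calculus_sincShift_le {ρ : ℝ} (hρ : 0 ≤ ρ)
    (h : ∀ (τ : ℝ) (v : H), ‖N (hT.calculus (expFun τ) v)‖ ≤ Real.exp (ρ * |τ|) * ‖N v‖)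
    {δ : ℝ} (hδ : 0 < δ) (w : ℝ) (v : H) :
    ‖N (hT.calculus (sincShift δ w) v)‖ ≤ Real.exp (ρ / δ) * ‖N v‖ := by
  have hc : ∀ a w : ℝ, ‖(1 / 2 : ℂ) * Complex.exp ((-(a * (w / δ)) : ℝ) * Complex.I)‖ = 1 / 2 :=
    fun a w => by rw [norm_mul, Complex.norm_exp_ofReal_mul_I]; simp
  have hμ : (volume.restrict (Set.Ioc (-1 : ℝ) 1)).real Set.univ = 2 := by
    rw [measureReal_restrict_apply MeasurableSet.univ, Set.univ_inter, Real.volume_real_Ioc]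
    norm_num
  refine (norm_weight_calculus_le_integral hT N (μ := volume.restrict (Set.Ioc (-1 : ℝ) 1))
    (k := fun a => ((1 / 2 : ℂ) * Complex.exp ((-(a * (w / δ)) : ℝ) * Complex.I)) •
      (if a ∈ Set.Ioc (-1 : ℝ) 1 then expFun (a / δ) else 0)) (g := fun _ => 1 / 2)
    (G := fun _ => 1 / 2 * (Real.exp (ρ / δ) * ‖N v‖)) (integrable_const _) (fun t => ?_)
    (fun a => ?_) (fun t => ?_) (integrable_const _) fun a => ?_).trans_eq ?_
  · refine (Continuous.aestronglyMeasurable (f := fun a : ℝ =>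
      ((1 / 2 : ℂ) * Complex.exp ((-(a * (w / δ)) : ℝ) * Complex.I)) * expFun (a / δ) t) ?_).congr
      ?_
    · simp only [expFun_apply]; fun_prop
    · filter_upwards [ae_restrict_mem measurableSet_Ioc] with a ha
      rw [if_pos ha]
      rfl
  · rw [norm_smul, hc]
    refine mul_le_of_le_one_right (by norm_num) ?_
    split_ifs
    · exact norm_expFun_le _
    · simp
  · change (Real.sinc ((t - w) / δ) : ℂ) = _
    rw [ofReal_sinc_eq_integral, intervalIntegral.integral_of_le (by norm_num)]
    refine setIntegral_congr_fun measurableSet_Ioc fun a ha => ?_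
    simp only [if_pos ha]
    change _ = _ * expFun (a / δ) t
    rw [expFun_apply, mul_assoc, ← Complex.exp_add]
    congr 2
    push_cast
    field_simp
    ring
  · rw [map_smul, smul_apply, map_smul, norm_smul, hc]
    refine mul_le_mul_of_nonneg_left ?_ (by norm_num)
    split_ifs with ha
    · refine (h _ v).trans ?_
      gcongr
      rw [abs_div, abs_of_pos hδ, ← mul_div_assoc]
      gcongr
      exact mul_le_of_le_one_right hρ (abs_le.2 ⟨ha.1.le, ha.2⟩)
    · rw [map_zero, zero_apply, map_zero, norm_zero]
      positivity
  · rw [integral_const, hμ, smul_eq_mul]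
    ring

/-- The function `t ↦ fejer ((t - w) / δ)`. -/
def fejerShift (δ w : ℝ) : ℝ →ᵇ ℂ :=
  (((∫ v : ℝ, Real.sinc v ^ 2)⁻¹ : ℝ) : ℂ) • (sincShift δ w * sincShift δ w)

theorem fejerShift_apply (δ w t : ℝ) : fejerShift δ w t = (fejer ((t - w) / δ) : ℂ) := by
  change (((∫ v : ℝ, Real.sinc v ^ 2)⁻¹ : ℝ) : ℂ) *
    ((Real.sinc ((t - w) / δ) : ℂ) * (Real.sinc ((t - w) / δ) : ℂ)) = _
  rw [fejer]
  push_cast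
  ring

theorem norm_fejerShift_le (δ w : ℝ) : ‖fejerShift δ w‖ ≤ (∫ v : ℝ, Real.sinc v ^ 2)⁻¹ := by
  have h0 := integral_sinc_sq_pos
  have h1 : ‖sincShift δ w‖ ≤ 1 :=
    BoundedContinuousFunction.norm_ofNormedAddCommGroup_le _ zero_le_one _
  rw [fejerShift, norm_smul, Complex.norm_real, Real.norm_of_nonneg (by positivity)]
  refine mul_le_of_le_one_right (by positivity) ((norm_mul_le _ _).trans ?_)
  exact mul_le_one₀ h1 (norm_nonneg _) h1

theorem norm_weight_calculus_fejerShift_le {ρ : ℝ} (hρ : 0 ≤ ρ)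
    (h : ∀ (τ : ℝ) (v : H), ‖N (hT.calculus (expFun τ) v)‖ ≤ Real.exp (ρ * |τ|) * ‖N v‖)
    {δ : ℝ} (hδ : 0 < δ) (w : ℝ) (v : H) : ‖N (hT.calculus (fejerShift δ w) v)‖ ≤
      (∫ v : ℝ, Real.sinc v ^ 2)⁻¹ * (Real.exp (ρ * (2 / δ)) * ‖N v‖) := by
  have h0 := integral_sinc_sq_pos
  have h1 := norm_weight_calculus_mul_le hT N (Real.exp_pos _).le
    (norm_weight_calculus_sincShift_le hT hρ h hδ w)
    (norm_weight_calculus_sincShift_le hT hρ h hδ w) v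
  rw [← Real.exp_add] at h1
  rw [fejerShift, map_smul, smul_apply, map_smul, norm_smul, Complex.norm_real,
    Real.norm_of_nonneg (by positivity)]
  refine mul_le_mul_of_nonneg_left (h1.trans_eq ?_) (by positivity)
  congr 2
  ring

/-- The smoothed bounded transform is a limit of superpositions of translated Fejér kernels: if all
of these vanish between two operators, so does the smoothed bounded transform. -/
theorem comp_calculus_smoothed_comp_eq_zero {δ : ℝ} (hδ : 0 < δ) {X Y : H →L[ℂ] H}
    (h : ∀ w, X ∘L hT.calculus (fejerShift δ w) ∘L Y = 0) :
    X ∘L hT.calculus (complexify (smoothed δ)) ∘L Y = 0 := by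
  have h0 := integral_sinc_sq_pos
  set m : ℝ := (∫ v : ℝ, Real.sinc v ^ 2)⁻¹ with hm
  set K : ℝ → ℝ → ℝ := fun t w => δ⁻¹ * (boundedTransform w * fejer ((t - w) / δ)) with hK
  have hKc : ∀ t, Continuous (K t) := fun t => continuous_const.mul
    (boundedTransform.continuous.mul (continuous_fejer.comp (by fun_prop)))
  have hKc' : ∀ w, Continuous fun t => K t w := fun w => continuous_const.mul
    (continuous_const.mul (continuous_fejer.comp (by fun_prop)))
  have hfm : ∀ v, fejer v ≤ m := fun v => by
    rw [fejer, ← hm]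
    refine mul_le_of_le_one_right (by positivity) ?_
    rw [← sq_abs]
    exact pow_le_one₀ (abs_nonneg _) (Real.abs_sinc_le_one v)
  have hK1 : ∀ t w, ‖K t w‖ ≤ δ⁻¹ * fejer ((t - w) / δ) := fun t w => by
    rw [hK, norm_mul, Real.norm_of_nonneg (by positivity)]
    gcongr
    exact norm_boundedTransform_mul_fejer_le _ _
  have hK2 : ∀ t w, ‖K t w‖ ≤ δ⁻¹ * m := fun t w =>
    (hK1 t w).trans (by gcongr; exact hfm _)
  have e1 : ∀ g : ℝ → ℝ, ∀ t, ∫ w, g w * fejer ((t - w) / δ) = δ * ∫ v, g (t - δ * v) * fejer v :=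
    fun g t => by
      have h1 := Measure.integral_comp_mul_left (fun x => g (t - x) * fejer (x / δ)) δ
      rw [abs_of_pos (inv_pos.2 hδ)] at h1
      simp only [mul_div_cancel_left₀ _ hδ.ne', smul_eq_mul] at h1
      rw [h1, mul_inv_cancel_left₀ hδ.ne',
        ← integral_sub_left_eq_self (fun x => g x * fejer ((t - x) / δ)) volume t]
      simp
  have hfi : ∀ t, Integrable fun w => δ⁻¹ * fejer ((t - w) / δ) := fun t =>
    ((integrable_fejer.comp_div hδ.ne').comp_sub_left t).const_mul _
  have hKi : ∀ t, Integrable (K t) := fun t =>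
    (hfi t).mono' (hKc t).aestronglyMeasurable (Eventually.of_forall (hK1 t))
  have hKint : ∀ t, ∫ w, K t w = smoothed δ t := fun t => by
    rw [hK, integral_const_mul, e1 (fun w => boundedTransform w), inv_mul_cancel_left₀ hδ.ne']
    rfl
  have hfint : ∀ t, ∫ w, δ⁻¹ * fejer ((t - w) / δ) = 1 := fun t => by
    have := e1 (fun _ => 1) t
    simp only [one_mul, integral_fejer, mul_one] at this
    rw [integral_const_mul, this, inv_mul_cancel₀ hδ.ne']
  -- the superpositions over bounded intervals
  set ψs : ℕ → ℝ →ᵇ ℂ := fun n => BoundedContinuousFunction.ofNormedAddCommGroup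
    (fun t => ((∫ w in Set.Ioc (-(n : ℝ)) n, K t w : ℝ) : ℂ))
    (Complex.continuous_ofReal.comp (continuous_of_dominated (bound := fun _ => δ⁻¹ * m)
      (fun t => (hKc t).aestronglyMeasurable) (fun t => Eventually.of_forall (hK2 t))
      (integrable_const _) (Eventually.of_forall hKc'))) 1
    (fun t => by
      rw [Complex.norm_real, ← hfint t]
      refine (norm_integral_le_of_norm_le (hfi t).integrableOn
        (Eventually.of_forall (hK1 t))).trans ?_
      exact setIntegral_le_integral (hfi t) (Eventually.of_forall fun w =>
        mul_nonneg (inv_nonneg.2 hδ.le) (fejer_nonneg _))) with hψs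
  have hlim : ∀ t, Tendsto (fun n => ψs n t) atTop (𝓝 (complexify (smoothed δ) t)) := fun t => by
    have h1 := (aecover_Ioc (μ := volume) (l := atTop)
      (tendsto_neg_atTop_atBot.comp (tendsto_natCast_atTop_atTop (R := ℝ)))
      (tendsto_natCast_atTop_atTop (R := ℝ))).integral_tendsto_of_countably_generated (hKi t)
    rw [hKint] at h1
    exact (Complex.continuous_ofReal.tendsto _).comp h1
  have hzero : ∀ n u, X (hT.calculus (ψs n) (Y u)) = 0 := fun n u => by
    refine ext_inner_left ℂ fun g => ?_
    rw [inner_zero_right, ← ContinuousLinearMap.adjoint_inner_left,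
      (hT.inner_calculus_eq_integral (μ := volume.restrict (Set.Ioc (-(n : ℝ)) n))
        (k := fun w => ((δ⁻¹ * boundedTransform w : ℝ) : ℂ) • fejerShift δ w)
        (g := fun _ => δ⁻¹ * m) (integrable_const _) (fun t => ?_) (fun w => ?_) (fun t => ?_)
        _ _).2]
    · refine (integral_congr_ae (Eventually.of_forall fun w => ?_)).trans (integral_zero _ _)
      have := congrArg (fun A : H →L[ℂ] H => A u) (h w)
      simp only [ContinuousLinearMap.comp_apply, zero_apply] at this
      simp only [map_smul, smul_apply, inner_smul_right]
      rw [ContinuousLinearMap.adjoint_inner_left, this, inner_zero_right, mul_zero]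
    · refine (Complex.continuous_ofReal.comp (hKc t)).aestronglyMeasurable.congr
        (Eventually.of_forall fun w => ?_)
      change ((K t w : ℝ) : ℂ) = ((δ⁻¹ * boundedTransform w : ℝ) : ℂ) * fejerShift δ w t
      rw [fejerShift_apply, ← Complex.ofReal_mul, mul_assoc]
    · rw [norm_smul, Complex.norm_real, norm_mul, Real.norm_of_nonneg (inv_nonneg.2 hδ.le), mul_assoc]
      gcongr
      calc _ ≤ 1 * m := by
            gcongr
            · exact abs_boundedTransform_le w
            · exact norm_fejerShift_le δ w
        _ = m := one_mul m
    · change ((∫ w in Set.Ioc (-(n : ℝ)) n, K t w : ℝ) : ℂ) = _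
      rw [← integral_complex_ofReal]
      refine integral_congr_ae (Eventually.of_forall fun w => ?_)
      change ((K t w : ℝ) : ℂ) = ((δ⁻¹ * boundedTransform w : ℝ) : ℂ) * fejerShift δ w t
      rw [fejerShift_apply, ← Complex.ofReal_mul, mul_assoc]
  ext u
  have h1 := (X.continuous.tendsto _).comp (hT.tendsto_calculus (M := 1) (fun n =>
    BoundedContinuousFunction.norm_ofNormedAddCommGroup_le _ zero_le_one _) hlim (Y u))
  refine tendsto_nhds_unique h1 (tendsto_const_nhds.congr fun n => ?_)
  exact (hzero n u).symm

end WeightedAbstract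

/-! ### Finite propagation -/

/-- The derivatives of a smooth periodic function are bounded. -/
theorem hasTemperateGrowth_of_periodic {F : Type*} [NormedAddCommGroup F] [NormedSpace ℝ F]
    {θ : ℝ → F} {c : ℝ} (hc : c ≠ 0) (hθ : Function.Periodic θ c) (hs : ContDiff ℝ (⊤ : ℕ∞) θ) :
    θ.HasTemperateGrowth := by
  refine ⟨hs, fun n => ?_⟩
  have hper : Function.Periodic (iteratedFDeriv ℝ n θ) c := fun t => by
    rw [← iteratedFDeriv_comp_add_right]
    congr 1
    exact funext hθ
  have hcont : Continuous (iteratedFDeriv ℝ n θ) := hs.continuous_iteratedFDeriv (mod_cast le_top)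
  obtain ⟨C, hC⟩ := isBounded_iff_forall_norm_le.1 (hper.isBounded_of_continuous hc hcont)
  exact ⟨0, C, fun t => by simpa using hC _ ⟨t, rfl⟩⟩

section Weights

variable {E : Type*} [NormedAddCommGroup E] [InnerProductSpace ℝ E]

/-- The exponential weight `exp (a q)`, where the linear function `q(y) = ⟨e, y - p⟩` is replaced
by the bounded function `M sin (q / M)`: this has slope at most `1`, is close to `q` where `|q|` is
small compared to `M`, and gives a bounded weight with bounded derivatives. -/
def weight (a M : ℝ) (e p : E) : E →ᵇ ℝ :=
  BoundedContinuousFunction.ofNormedAddCommGroup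
    (fun y => Real.exp (a * (M * Real.sin (inner ℝ e (y - p) / M)))) (by fun_prop)
    (Real.exp |a * M|)
    (fun y => by
      rw [Real.norm_of_nonneg (Real.exp_pos _).le]
      refine Real.exp_le_exp.2 ((le_abs_self _).trans ?_)
      rw [← mul_assoc, abs_mul]
      exact mul_le_of_le_one_right (abs_nonneg _) (Real.abs_sin_le_one _))

theorem weight_apply (a M : ℝ) (e p y : E) :
    weight a M e p y = Real.exp (a * (M * Real.sin (inner ℝ e (y - p) / M))) := rfl

theorem weight_pos (a M : ℝ) (e p y : E) : 0 < weight a M e p y := Real.exp_pos _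

theorem hasTemperateGrowth_weight (a : ℝ) {M : ℝ} (hM : M ≠ 0) (e p : E) :
    (fun y => (weight a M e p y : ℂ)).HasTemperateGrowth := by
  have h1 : (fun t : ℝ => Real.exp (a * (M * Real.sin (t / M)))).HasTemperateGrowth := by
    refine hasTemperateGrowth_of_periodic (c := 2 * Real.pi * M)
      (mul_ne_zero (by positivity) hM) (fun t => ?_) ?_
    · rw [add_div, mul_div_cancel_right₀ _ hM, Real.sin_add_two_pi]
    · exact Real.contDiff_exp.comp (contDiff_const.mul (contDiff_const.mul
        (Real.contDiff_sin.comp (contDiff_id.div_const M))))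
  have h2 : (fun y : E => inner ℝ e (y - p)).HasTemperateGrowth := by
    have : (fun y : E => inner ℝ e (y - p)) = (fun y => inner ℝ e y) - fun _ => inner ℝ e p := by
      ext y; simp [inner_sub_right]
    rw [this]
    exact (Function.hasTemperateGrowth_inner_right _).sub (Function.HasTemperateGrowth.const _)
  exact (Function.Complex.hasTemperateGrowth_ofReal.comp h1).comp h2

theorem hasFDerivAt_weight (a : ℝ) {M : ℝ} (hM : M ≠ 0) (e p y : E) :
    HasFDerivAt (fun y => (weight a M e p y : ℂ)) (Complex.ofRealCLM ∘L
      ((weight a M e p y * (a * Real.cos (inner ℝ e (y - p) / M))) • innerSL ℝ e)) y := by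
  have h1 : HasFDerivAt (fun y : E => inner ℝ e (y - p)) (innerSL ℝ e) y :=
    (innerSL ℝ e).hasFDerivAt.comp y ((hasFDerivAt_id y).sub_const p)
  have h2 : HasDerivAt (fun t : ℝ => Real.exp (a * (M * Real.sin (t / M))))
      (weight a M e p y * (a * Real.cos (inner ℝ e (y - p) / M))) (inner ℝ e (y - p)) := by
    have := ((((hasDerivAt_id' (inner ℝ e (y - p))).div_const M).sin.const_mul M).const_mul a).exp
    convert this using 1
    rw [weight_apply]
    field_simp
  have h3 : HasFDerivAt (fun y => weight a M e p y)
      ((weight a M e p y * (a * Real.cos (inner ℝ e (y - p) / M))) • innerSL ℝ e) y :=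
    h2.comp_hasFDerivAt (f := fun y : E => inner ℝ e (y - p)) y h1
  exact Complex.ofRealCLM.hasFDerivAt.comp y h3

variable [FiniteDimensional ℝ E]

/-- Multiplication of Schwartz functions by the weight. -/
def weightOp (a M : ℝ) (e p : E) : Module.End ℂ 𝓢(E, Cliff E) :=
  (SchwartzMap.smulLeftCLM (Cliff E) fun y => (weight a M e p y : ℂ)).toLinearMap

theorem weightOp_apply (a : ℝ) {M : ℝ} (hM : M ≠ 0) (e p : E) (u : 𝓢(E, Cliff E)) (y : E) :
    weightOp a M e p u y = (weight a M e p y : ℂ) • u y :=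
  SchwartzMap.smulLeftCLM_apply_apply (hasTemperateGrowth_weight a hM e p) u y

theorem sum_inner_smul_hatMul (e : E) :
    ∑ i, ((inner ℝ e (stdB E i) : ℝ) : ℂ) • hatMul (stdB E i) = hatMul e := by
  have h := (stdB E).sum_repr' e
  have hsum : ∀ s : Finset (Fin (finrank ℝ E)),
      hatMul (∑ i ∈ s, inner ℝ (stdB E i) e • stdB E i) =
        ∑ i ∈ s, ((inner ℝ e (stdB E i) : ℝ) : ℂ) • hatMul (stdB E i) := by
    intro s
    induction s using Finset.cons_induction with
    | empty => simpa using hatMul_smul 0 (0 : E)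
    | cons a s ha ih =>
      rw [Finset.sum_cons, Finset.sum_cons, hatMul_add, ih, hatMul_smul, real_inner_comm]
  rw [← hsum, h]

/-- The commutator of the Dirac operator with a weight is Clifford multiplication by the gradient of
the weight. -/
theorem diracOp_weightOp_apply (a : ℝ) {M : ℝ} (hM : M ≠ 0) (e p : E) (u : 𝓢(E, Cliff E)) (y : E) :
    diracOp E (weightOp a M e p u) y = weightOp a M e p (diracOp E u) y +
      ((a * Real.cos (inner ℝ e (y - p) / M) : ℝ) : ℂ) • hatMul e (weightOp a M e p u y) := by
  have hd : ∀ v : 𝓢(E, Cliff E), diracOp E v y = ∑ i, hatMul (stdB E i) (fderiv ℝ v y (stdB E i)) :=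
    fun v => diracOp_apply v y
  have h1 : (weightOp a M e p u : E → Cliff E) = fun y => (weight a M e p y : ℂ) • u y :=
    funext fun y => weightOp_apply a hM e p u y
  have h2 := ((hasFDerivAt_weight a hM e p y).smul (u.hasFDerivAt y)).fderiv
  have h3 : ∀ v, fderiv ℝ (weightOp a M e p u) y v = (weight a M e p y : ℂ) • fderiv ℝ u y v +
      ((weight a M e p y * (a * Real.cos (inner ℝ e (y - p) / M)) * inner ℝ e v : ℝ) : ℂ) • u y :=
    fun v => by
      rw [h1]
      refine (congrFun (congrArg DFunLike.coe h2) v).trans ?_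
      simp
  rw [hd, weightOp_apply a hM, weightOp_apply a hM, hd, ← sum_inner_smul_hatMul e]
  simp only [h3, map_add, map_smul, Finset.sum_add_distrib, Finset.smul_sum, sum_apply, smul_apply]
  congr 1
  refine Finset.sum_congr rfl fun i _ => ?_
  rw [smul_smul, smul_smul]
  congr 1
  push_cast
  ring

theorem bottDiracSchwartz_weightOp_apply (s : ℝ) (x : E) (a : ℝ) {M : ℝ} (hM : M ≠ 0) (e p : E)
    (u : 𝓢(E, Cliff E)) (y : E) :
    bottDiracSchwartz s x (weightOp a M e p u) y = weightOp a M e p (bottDiracSchwartz s x u) y +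
      ((s⁻¹ * (a * Real.cos (inner ℝ e (y - p) / M)) : ℝ) : ℂ) •
        hatMul e (weightOp a M e p u y) := by
  simp only [bottDiracSchwartz_eq, LinearMap.add_apply, LinearMap.smul_apply, map_add, map_smul,
    add_apply, smul_apply, diracOp_weightOp_apply a hM, bottShift_apply, weightOp_apply a hM,
    smul_add, smul_smul, Complex.ofReal_mul, mul_assoc]
  abel

variable [MeasurableSpace E] [BorelSpace E]

/-- The norm estimate `|b| ‖u‖ ≤ ‖(B - i b) u‖` for the symmetric operator `B`. -/
theorem abs_mul_norm_le (s : ℝ) (x : E) (b : ℝ) (u : 𝓢(E, Cliff E)) :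
    |b| * ‖schwartzIncl E u‖ ≤
      ‖schwartzIncl E (bottDiracSchwartz s x u + (-((b : ℂ) * Complex.I)) • u)‖ := by
  have h3 := norm_add_I_smul_sq (c := Complex.I) (a := schwartzIncl E (bottDiracSchwartz s x u))
    (b := (-b : ℂ) • schwartzIncl E u) (by
      rw [inner_smul_right, inner_smul_left, formalAdjoint_bottDiracSchwartz s x u u]
      simp) (Or.inl rfl)
  have e1 : schwartzIncl E (bottDiracSchwartz s x u + (-((b : ℂ) * Complex.I)) • u) =
      schwartzIncl E (bottDiracSchwartz s x u) + Complex.I • (-b : ℂ) • schwartzIncl E u := by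
    rw [map_add, map_smul, smul_smul]
    congr 2
    ring
  refine (sq_le_sq₀ (by positivity) (norm_nonneg _)).1 ?_
  rw [e1, h3, norm_smul, norm_neg, Complex.norm_real, Real.norm_eq_abs]
  exact le_add_of_nonneg_left (sq_nonneg _)

theorem norm_commutator_weightOp_le {s : ℝ} (hs : 0 < s) (x : E) {a : ℝ} (ha : 0 ≤ a) {M : ℝ}
    (hM : M ≠ 0) {e : E} (he : ‖e‖ ≤ 1) (p : E) (z : ℂ) (u : 𝓢(E, Cliff E)) :
    ‖schwartzIncl E (bottDiracSchwartz s x (weightOp a M e p u) + z • weightOp a M e p u -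
      weightOp a M e p (bottDiracSchwartz s x u + z • u))‖ ≤
      a * s⁻¹ * ‖schwartzIncl E (weightOp a M e p u)‖ := by
  refine norm_schwartzIncl_le fun y => ?_
  have h1 : (bottDiracSchwartz s x (weightOp a M e p u) + z • weightOp a M e p u -
      weightOp a M e p (bottDiracSchwartz s x u + z • u)) y =
      ((s⁻¹ * (a * Real.cos (inner ℝ e (y - p) / M)) : ℝ) : ℂ) •
        hatMul e (weightOp a M e p u y) := by
    rw [map_add, map_smul, sub_apply, add_apply, add_apply,
      bottDiracSchwartz_weightOp_apply s x a hM]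
    abel
  have hcos : |Real.cos (inner ℝ e (y - p) / M)| * ‖e‖ ≤ 1 :=
    mul_le_one₀ (Real.abs_cos_le_one _) (norm_nonneg _) he
  rw [h1, norm_smul, norm_hatMul, Complex.norm_real, Real.norm_eq_abs, abs_mul, abs_mul,
    abs_of_nonneg ha, abs_of_nonneg (inv_nonneg.2 hs.le)]
  generalize |Real.cos (inner ℝ e (y - p) / M)| = k at hcos ⊢
  have h2 : 0 ≤ a * s⁻¹ * ‖weightOp a M e p u y‖ := by positivity
  calc s⁻¹ * (a * k) * (‖e‖ * ‖weightOp a M e p u y‖)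
      = a * s⁻¹ * ‖weightOp a M e p u y‖ * (k * ‖e‖) := by ring
    _ ≤ a * s⁻¹ * ‖weightOp a M e p u y‖ := mul_le_of_le_one_right h2 hcos

/-- Conjugation by the weight changes the Bott-Dirac operator by an operator of norm `≤ a / s`, so
that its resolvents on the imaginary axis obey a weighted estimate. -/
theorem norm_weightOp_le {s : ℝ} (hs : 0 < s) (x : E) {a : ℝ} (ha : 0 ≤ a) {M : ℝ} (hM : M ≠ 0)
    {e : E} (he : ‖e‖ ≤ 1) (p : E) (b : ℝ) (u : 𝓢(E, Cliff E)) :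
    (|b| - a * s⁻¹) * ‖schwartzIncl E (weightOp a M e p u)‖ ≤
      ‖schwartzIncl E (weightOp a M e p
        (bottDiracSchwartz s x u + (-((b : ℂ) * Complex.I)) • u))‖ := by
  have h1 := norm_commutator_weightOp_le hs x ha hM he p (-((b : ℂ) * Complex.I)) u
  have h2 := abs_mul_norm_le s x b (weightOp a M e p u)
  rw [map_sub] at h1
  rw [sub_mul]
  exact sub_le_iff_le_add.2 ((h2.trans (norm_le_norm_add_norm_sub' _ _)).trans
    (add_le_add_right h1 _))

end Weights

/-- On a bounded interval `M sin (q / M)` is as close to `q` as desired, for large `M`. -/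
theorem exists_le_mul_sin {D η : ℝ} (hη : 0 < η) (hD : η < D) :
    ∃ M : ℝ, 0 < M ∧ ∀ q, D - η ≤ q → q ≤ D + η → D - 2 * η ≤ M * Real.sin (q / M) := by
  set Q : ℝ := D + η with hQ
  have hQ0 : 0 < Q := by linarith
  set k : ℝ := 1 + Q / η with hk
  have hk1 : 1 ≤ k := by rw [hk]; linarith [div_pos hQ0 hη]
  have hkη : Q ≤ η * k := by rw [hk, mul_add, mul_div_cancel₀ _ hη.ne']; linarith
  have hk0 : 0 < k := by linarith
  refine ⟨Q * k, by positivity, fun q h1 h2 => ?_⟩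
  have hq : 0 < q := by linarith
  set t := q / (Q * k) with ht
  have hqt : q = Q * k * t := by rw [ht]; field_simp
  have ht0 : 0 < t := by positivity
  have htk : k * t ≤ 1 := by
    have : Q * (k * t) ≤ Q * 1 := by linarith
    exact le_of_mul_le_mul_left this hQ0
  have ht1 : t ≤ 1 := by nlinarith
  have hs := Real.sin_gt_sub_cube ht0
  have h3 : Q * k * t ^ 3 ≤ η := by
    have e1 : Q * t ≤ η := by nlinarith
    have e2 : k * t * t ≤ 1 := mul_le_one₀ htk ht0.le ht1
    calc Q * k * t ^ 3 = Q * t * (k * t * t) := by ring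
      _ ≤ Q * t * 1 := by gcongr
      _ ≤ η := by linarith
  have h4 : Q * k * (t - t ^ 3 / 6) ≤ Q * k * Real.sin t := by gcongr
  linarith

section Propagation

variable {E : Type*} [NormedAddCommGroup E] [InnerProductSpace ℝ E]

theorem weight_le {a : ℝ} (ha : 0 ≤ a) {M : ℝ} (hM : 0 < M) {e : E} (he : ‖e‖ ≤ 1) {p y : E} {η : ℝ}
    (hy : ‖y - p‖ ≤ η) : weight a M e p y ≤ Real.exp (a * η) := by
  rw [weight_apply]
  refine Real.exp_le_exp.2 (mul_le_mul_of_nonneg_left ?_ ha)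
  set q : ℝ := inner ℝ e (y - p)
  have h1 : |q| ≤ η := (abs_real_inner_le_norm _ _).trans
    ((mul_le_of_le_one_left (norm_nonneg _) he).trans hy)
  calc M * Real.sin (q / M) ≤ M * |q / M| := by
        gcongr
        exact (le_abs_self _).trans Real.abs_sin_le_abs
    _ = |q| := by rw [abs_div, abs_of_pos hM]; field_simp
    _ ≤ η := h1

variable [FiniteDimensional ℝ E] [MeasurableSpace E] [BorelSpace E]

theorem memLp_ofReal_smul (w : E →ᵇ ℝ) (u : L2 E) :
    MemLp (fun y => (w y : ℂ) • u y) 2 (volume : Measure E) :=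
  MemLp.of_le_mul (c := ‖w‖) (Lp.memLp u)
    ((Complex.continuous_ofReal.comp w.continuous).aestronglyMeasurable.smul
      (Lp.aestronglyMeasurable u))
    (Eventually.of_forall fun y => by
      rw [norm_smul, Complex.norm_real]
      gcongr
      exact w.norm_coe_le_norm y)

/-- Multiplication by a bounded continuous real function, as a bounded operator on
`L²(E, Cliff_ℂ(E))`. -/
def weightMul (w : E →ᵇ ℝ) : L2 E →L[ℂ] L2 E :=
  LinearMap.mkContinuous
    { toFun := fun u => (memLp_ofReal_smul w u).toLp _
      map_add' := fun u v => by
        rw [← MemLp.toLp_add, MemLp.toLp_eq_toLp_iff]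
        filter_upwards [Lp.coeFn_add u v] with y hy
        rw [hy, Pi.add_apply, Pi.add_apply, smul_add]
      map_smul' := fun c u => by
        rw [RingHom.id_apply, ← MemLp.toLp_const_smul, MemLp.toLp_eq_toLp_iff]
        filter_upwards [Lp.coeFn_smul c u] with y hy
        rw [hy, Pi.smul_apply, Pi.smul_apply, smul_comm] }
    ‖w‖ (fun u => by
      refine Lp.norm_le_mul_norm_of_ae_le_mul ?_
      filter_upwards [MemLp.coeFn_toLp (memLp_ofReal_smul w u)] with y hy
      change ‖(memLp_ofReal_smul w u).toLp _ y‖ ≤ _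
      rw [hy, norm_smul, Complex.norm_real]
      gcongr
      exact w.norm_coe_le_norm y)

theorem weightMul_ae (w : E →ᵇ ℝ) (u : L2 E) :
    weightMul w u =ᵐ[volume] fun y => (w y : ℂ) • u y := MemLp.coeFn_toLp (memLp_ofReal_smul w u)

theorem weightMul_schwartzIncl (a : ℝ) {M : ℝ} (hM : M ≠ 0) (e p : E) (u : 𝓢(E, Cliff E)) :
    weightMul (weight a M e p) (schwartzIncl E u) = schwartzIncl E (weightOp a M e p u) := by
  refine Lp.ext ?_
  filter_upwards [weightMul_ae (weight a M e p) (schwartzIncl E u), schwartzIncl_ae u,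
    schwartzIncl_ae (weightOp a M e p u)] with y h1 h2 h3
  rw [h1, h2, h3, weightOp_apply a hM]

theorem norm_weightMul_calculus_res_le {s : ℝ} (hs : 0 < s) (x : E) {a : ℝ} (ha : 0 ≤ a) {M : ℝ}
    (hM : M ≠ 0) {e : E} (he : ‖e‖ ≤ 1) (p : E) (b : ℝ) (hb : ((b : ℂ) * Complex.I).im ≠ 0)
    (v : L2 E) :
    (|b| - a * s⁻¹) * ‖weightMul (weight a M e p)
      ((isDiagonal_bottDirac hs x).calculus (res (b * Complex.I) hb) v)‖ ≤
      ‖weightMul (weight a M e p) v‖ := by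
  set hB := isDiagonal_bottDirac hs x
  refine hB.dense_eigenSpan.induction (P := fun v => (|b| - a * s⁻¹) *
    ‖weightMul (weight a M e p) (hB.calculus (res (b * Complex.I) hb) v)‖ ≤
      ‖weightMul (weight a M e p) v‖) (fun u hu => ?_)
    (isClosed_le (by fun_prop) (by fun_prop)) v
  obtain ⟨v, hv⟩ := eigenSpan_le_domain _ (hB.calculus_mem_eigenSpan (res (b * Complex.I) hb) hu)
  have h := bottDirac_add_smul_of_calculus hs x hb hv
  rw [← hv, ← h, ← map_smul, ← map_add, weightMul_schwartzIncl a hM, weightMul_schwartzIncl a hM]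
  exact norm_weightOp_le hs x ha hM he p b v

theorem norm_weightMul_chi_le {w : E →ᵇ ℝ} (hw : ∀ y, 0 ≤ w y) {A : Set E} (hA : MeasurableSet A)
    {c : ℝ} (hc : 0 ≤ c) (h : ∀ y ∈ A, w y ≤ c) (u : L2 E) :
    ‖weightMul w (chi A hA u)‖ ≤ c * ‖u‖ := by
  refine Lp.norm_le_mul_norm_of_ae_le_mul ?_
  filter_upwards [weightMul_ae w (chi A hA u), chi_ae hA u] with y h1 h2
  rw [h1, h2, norm_smul, Complex.norm_real, Real.norm_of_nonneg (hw y)]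
  by_cases hy : y ∈ A
  · rw [Set.indicator_of_mem hy]
    gcongr
    exact h y hy
  · rw [Set.indicator_of_notMem hy, norm_zero, mul_zero]
    positivity

theorem norm_chi_le_weightMul {w : E →ᵇ ℝ} {A : Set E} (hA : MeasurableSet A)
    {c : ℝ} (hc : 0 < c) (h : ∀ y ∈ A, c ≤ w y) (u : L2 E) :
    ‖chi A hA u‖ ≤ c⁻¹ * ‖weightMul w u‖ := by
  refine Lp.norm_le_mul_norm_of_ae_le_mul ?_
  filter_upwards [weightMul_ae w u, chi_ae hA u] with y h1 h2
  rw [h1, h2, norm_smul, Complex.norm_real]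
  by_cases hy : y ∈ A
  · have h3 := h y hy
    rw [Set.indicator_of_mem hy, Real.norm_of_nonneg (hc.le.trans h3), ← mul_assoc]
    exact le_mul_of_one_le_left (norm_nonneg _) ((one_le_inv_mul₀ hc).2 h3)
  · rw [Set.indicator_of_notMem hy, norm_zero]
    positivity

/-- The translated Fejér kernels of the Bott-Dirac operator, like every function with Fourier
transform supported in `[-2 / δ, 2 / δ]`, have propagation at most `2 / (δ s)`: the weighted
estimates lose a factor `exp (2 a / (δ s))` and gain almost `exp (a D)` at distance `D`, where `a`
is arbitrary. -/
theorem chi_comp_calculus_fejerShift_comp_chi {s : ℝ} (hs : 0 < s) (x : E) {δ : ℝ} (hδ : 0 < δ)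
    {p q : E} (hpq : s⁻¹ * (2 / δ) < dist q p) :
    ∃ η > 0, ∀ w, chi (Metric.ball q η) measurableSet_ball ∘L
      (isDiagonal_bottDirac hs x).calculus (fejerShift δ w) ∘L
        chi (Metric.ball p η) measurableSet_ball = 0 := by
  set hB := isDiagonal_bottDirac hs x
  set D := dist q p with hD
  -- radii that leave a gain of `exp (-a η)` in the estimate below
  set η := (D - s⁻¹ * (2 / δ)) / 4 with hη
  have hη0 : 0 < η := by rw [hη]; linarith
  have hsδ : 0 < s⁻¹ * (2 / δ) := by positivity
  have hD0 : 0 < D := hsδ.trans hpq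
  obtain ⟨M, hM0, hM⟩ := exists_le_mul_sin hη0 (show η < D by rw [hη]; linarith)
  refine ⟨η, hη0, fun w => ?_⟩
  set e : E := D⁻¹ • (q - p) with he
  have he1 : ‖e‖ = 1 := by
    rw [he, norm_smul, norm_inv, Real.norm_of_nonneg hD0.le, ← dist_eq_norm, ← hD,
      inv_mul_cancel₀ hD0.ne']
  have hinner : inner ℝ e (q - p) = D := by
    rw [he, inner_smul_left, real_inner_self_eq_norm_sq, ← dist_eq_norm, ← hD]
    simp only [conj_trivial]
    field_simp
  set m := (∫ v : ℝ, Real.sinc v ^ 2)⁻¹ with hm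
  have hm0 : 0 < m := inv_pos.2 integral_sinc_sq_pos
  have key : ∀ a : ℝ, 0 ≤ a → ∀ u, ‖(chi (Metric.ball q η) measurableSet_ball ∘L
      hB.calculus (fejerShift δ w) ∘L chi (Metric.ball p η) measurableSet_ball) u‖ ≤
      m * Real.exp (-(a * η)) * ‖u‖ := fun a ha u => by
    have hV : ∀ y ∈ Metric.ball q η, Real.exp (a * (D - 2 * η)) ≤ weight a M e p y := by
      intro y hy
      rw [Metric.mem_ball, dist_eq_norm] at hy
      have h1 : |inner ℝ e (y - q)| ≤ η := (abs_real_inner_le_norm _ _).trans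
        (by rw [he1, one_mul]; exact hy.le)
      have h2 : (inner ℝ e (y - p) : ℝ) = D + inner ℝ e (y - q) := by
        rw [← hinner, ← inner_add_right]
        congr 1
        abel
      rw [abs_le] at h1
      rw [weight_apply]
      refine Real.exp_le_exp.2 (mul_le_mul_of_nonneg_left (hM _ ?_ ?_) ha) <;> rw [h2] <;> linarith
    have hU : ∀ y ∈ Metric.ball p η, weight a M e p y ≤ Real.exp (a * η) := fun y hy =>
      weight_le ha hM0 he1.le (by rw [← dist_eq_norm]; exact (Metric.mem_ball.1 hy).le)
    have hρ : 0 ≤ a * s⁻¹ := by positivity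
    have h1 := norm_weight_calculus_fejerShift_le hB (N := weightMul (weight a M e p)) hρ
      (norm_weight_calculus_expFun_le hB fun b hb _ v =>
        norm_weightMul_calculus_res_le hs x ha hM0.ne' he1.le p b hb v) hδ w
      (chi (Metric.ball p η) measurableSet_ball u)
    have h2 := norm_weightMul_chi_le (fun y => (weight_pos a M e p y).le)
      (measurableSet_ball (x := p) (ε := η)) (Real.exp_pos _).le hU u
    have h3 := norm_chi_le_weightMul (measurableSet_ball (x := q) (ε := η)) (Real.exp_pos _) hV
      (hB.calculus (fejerShift δ w) (chi (Metric.ball p η) measurableSet_ball u))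
    rw [ContinuousLinearMap.comp_apply, ContinuousLinearMap.comp_apply]
    refine h3.trans ((mul_le_mul_of_nonneg_left (h1.trans (mul_le_mul_of_nonneg_left
      (mul_le_mul_of_nonneg_left h2 (Real.exp_pos _).le) hm0.le))
      (inv_pos.2 (Real.exp_pos _)).le).trans_eq ?_)
    rw [← Real.exp_neg]
    have e1 : Real.exp (-(a * η)) =
        Real.exp (-(a * (D - 2 * η))) * (Real.exp (a * s⁻¹ * (2 / δ)) * Real.exp (a * η)) := by
      rw [← Real.exp_add, ← Real.exp_add]
      congr 1
      rw [hη]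
      ring
    rw [e1]
    ring
  have hlim : Tendsto (fun a : ℝ => Real.exp (-(a * η))) atTop (𝓝 0) :=
    Real.tendsto_exp_neg_atTop_nhds_zero.comp (tendsto_id.atTop_mul_const hη0)
  ext1 u
  rw [zero_apply, ← norm_le_zero_iff]
  have hlim' : Tendsto (fun a : ℝ => m * Real.exp (-(a * η)) * ‖u‖) atTop (𝓝 0) := by
    simpa using (hlim.const_mul m).mul_const ‖u‖
  exact ge_of_tendsto hlim' ((eventually_ge_atTop 0).mono fun a ha => key a ha u)

theorem propagation_calculus_smoothed_le {s : ℝ} (hs : 0 < s) (x : E) {δ : ℝ} (hδ : 0 < δ) :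
    propagation ((isDiagonal_bottDirac hs x).calculus (complexify (smoothed δ))) ≤
      ENNReal.ofReal (s⁻¹ * (2 / δ)) := by
  refine iSup₂_le fun pq hpq => ?_
  by_contra! hlt
  rw [edist_dist, ENNReal.ofReal_lt_ofReal_iff_of_nonneg (by positivity)] at hlt
  obtain ⟨η, hη, h⟩ := chi_comp_calculus_fejerShift_comp_chi hs x hδ hlt
  exact hpq _ _ Metric.isOpen_ball Metric.isOpen_ball (Metric.mem_ball_self hη)
    (Metric.mem_ball_self hη) (comp_calculus_smoothed_comp_eq_zero _ hδ h)

end Propagation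

/-! ### Consequences of the perturbation estimates -/

section Abstract

theorem norm_comp_le_of_le {H : Type*} [NormedAddCommGroup H] [InnerProductSpace ℂ H]
    {S T : H →L[ℂ] H} {a b : ℝ} (hS : ‖S‖ ≤ a) (hT : ‖T‖ ≤ b) :
    ‖S ∘L T‖ ≤ a * b :=
  (ContinuousLinearMap.opNorm_comp_le _ _).trans
    (mul_le_mul hS hT (norm_nonneg _) ((norm_nonneg _).trans hS))

variable {H : Type*} [NormedAddCommGroup H] [InnerProductSpace ℂ H] [CompleteSpace H]

theorem isCompactOperator_of_approx {T : H →L[ℂ] H}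
    (h : ∀ η > 0, ∃ S : H →L[ℂ] H, IsCompactOperator S ∧ ‖T - S‖ ≤ η) : IsCompactOperator T := by
  have hcl : IsClosed {S : H →L[ℂ] H | IsCompactOperator S} := isClosed_setOfPred_isCompactOperator
  refine hcl.closure_subset (Metric.mem_closure_iff.2 fun ε hε => ?_)
  obtain ⟨S, hS, hTS⟩ := h (ε / 2) (half_pos hε)
  exact ⟨S, hS, by rw [dist_eq_norm]; linarith⟩

theorem comp_eq_add_comp {A : H →ₗ.[ℂ] H} (hA : IsDiagonal A) (T : H →L[ℂ] H) (θ : ℝ →ᵇ ℂ) :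
    T = T ∘L hA.calculus (1 - θ) + T ∘L hA.calculus θ := by
  rw [← ContinuousLinearMap.comp_add, ← map_add, sub_add_cancel, map_one,
    ContinuousLinearMap.one_def, ContinuousLinearMap.comp_id]

variable {A A' : H →ₗ.[ℂ] H} (hA : IsDiagonal A) {hA' : IsDiagonal A'} {κ : ℝ}

theorem norm_complexify_smoothed_le (δ : ℝ) : ‖complexify (smoothed δ)‖ ≤ 1 :=
  (BoundedContinuousFunction.norm_le zero_le_one).2 fun t => by
    rw [complexify_apply, Complex.norm_real]
    exact ((smoothed δ).norm_coe_le_norm t).trans (norm_smoothed_le δ)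

theorem IsDiagonal.norm_calculus_smoothed_le (δ : ℝ) :
    ‖hA.calculus (complexify (smoothed δ))‖ ≤ 1 :=
  (hA.norm_calculus_le _).trans (norm_complexify_smoothed_le δ)

theorem norm_calculus_smoothed_sub_le (hA' : IsDiagonal A') (δ : ℝ) :
    ‖hA.calculus (complexify (smoothed δ)) - hA'.calculus (complexify (smoothed δ))‖ ≤ 2 := by
  have h1 := hA.norm_calculus_smoothed_le δ
  have h2 := hA'.norm_calculus_smoothed_le δ
  exact (norm_sub_le _ _).trans (by linarith)

theorem norm_complexify_smoothed_sq_sub_one_le (δ : ℝ) :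
    ‖(complexify (smoothed δ) ^ 2 - 1 : ℝ →ᵇ ℂ)‖ ≤ 2 := by
  refine (BoundedContinuousFunction.norm_le zero_le_two).2 fun t => ?_
  have h1 : ‖complexify (smoothed δ) t‖ ≤ 1 :=
    ((complexify (smoothed δ)).norm_coe_le_norm t).trans (norm_complexify_smoothed_le δ)
  change ‖complexify (smoothed δ) t ^ 2 - 1‖ ≤ 2
  refine (norm_sub_le _ _).trans ?_
  rw [norm_pow, norm_one]
  have := pow_le_one₀ (n := 2) (norm_nonneg _) h1
  linarith

/-- On the range of a cutoff, a relatively bounded perturbation is a bounded one. -/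
theorem RelBound.norm_smoothed_sub_comp_cutoff_mul_le (h : RelBound A A' hA' resolventFun κ)
    (δ : ℝ) {a : ℝ} (ha : 1 ≤ a) {g : ℝ →ᵇ ℂ} (hg : ‖g‖ ≤ 1) :
    ‖(hA.calculus (complexify (smoothed δ)) - hA'.calculus (complexify (smoothed δ))) ∘L
      hA'.calculus (cutoff a (one_pos.trans_le ha) * g)‖ ≤ κ * a ^ 2 := by
  rw [cutoff_eq_resolventFun_mul a ha, mul_assoc, map_mul, ContinuousLinearMap.mul_def,
    ← ContinuousLinearMap.comp_assoc]
  refine norm_comp_le_of_le (h.norm_smoothed_sub_comp_calculus_le hA δ)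
    ((hA'.norm_calculus_le _).trans ((norm_mul_le _ _).trans ?_))
  exact (mul_le_of_le_one_right (norm_nonneg _) hg).trans (norm_cutoffQuotient_le a ha)

theorem RelBound.norm_smoothed_sub_comp_cutoff_le (h : RelBound A A' hA' resolventFun κ)
    (δ : ℝ) {a : ℝ} (ha : 1 ≤ a) :
    ‖(hA.calculus (complexify (smoothed δ)) - hA'.calculus (complexify (smoothed δ))) ∘L
      hA'.calculus (cutoff a (one_pos.trans_le ha))‖ ≤ κ * a ^ 2 := by
  simpa using h.norm_smoothed_sub_comp_cutoff_mul_le hA δ ha (g := 1) (by simp)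

/-- Relatively small perturbations change `ψ² - 1` little in norm, although not `ψ` itself, because
`ψ² - 1` vanishes at infinity. -/
theorem RelBound.norm_smoothed_sq_sub_le (h : RelBound A A' hA' resolventFun κ) (δ : ℝ) {a η : ℝ}
    (ha : 1 ≤ a)
    (hη : ‖(complexify (smoothed δ) ^ 2 - 1) * (1 - cutoff a (one_pos.trans_le ha))‖ ≤ η) :
    ‖hA.calculus (complexify (smoothed δ)) ^ 2 - hA'.calculus (complexify (smoothed δ)) ^ 2‖ ≤
      2 * η + 6 * κ + 2 * (κ * a ^ 2) := by
  set ψ := complexify (smoothed δ)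
  set θ := cutoff a (one_pos.trans_le ha)
  have hκ := h.nonneg
  -- write `h = ψ² - 1`, so that `h(A) - h(A')` is the sum of `(h (1 - θ))(A) - (h (1 - θ))(A')`, of
  -- `h(A) (θ(A) - θ(A'))`, and of `(h(A) - h(A')) θ(A')`, which is expanded by the product rule
  have e : hA.calculus ψ ^ 2 - hA'.calculus ψ ^ 2 =
      hA.calculus ((ψ ^ 2 - 1) * (1 - θ)) - hA'.calculus ((ψ ^ 2 - 1) * (1 - θ)) +
      hA.calculus (ψ ^ 2 - 1) ∘L (hA.calculus θ - hA'.calculus θ) +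
      (hA.calculus ψ ∘L ((hA.calculus ψ - hA'.calculus ψ) ∘L hA'.calculus θ) +
        (hA.calculus ψ - hA'.calculus ψ) ∘L hA'.calculus (θ * ψ)) := by
    simp only [map_mul, map_sub, map_pow, map_one, ← ContinuousLinearMap.mul_def]
    have hcomm : hA'.calculus θ * hA'.calculus ψ = hA'.calculus ψ * hA'.calculus θ := by
      rw [← map_mul, mul_comm, map_mul]
    rw [hcomm]
    noncomm_ring
  have h1 := (hA.norm_calculus_le _).trans hη
  have h2 := (hA'.norm_calculus_le _).trans hη
  have h3 := norm_comp_le_of_le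
    ((hA.norm_calculus_le _).trans (norm_complexify_smoothed_sq_sub_one_le δ))
    (h.norm_cutoff_sub_le_of_resolventFun hA (one_pos.trans_le ha) ha)
  have h4 := norm_comp_le_of_le (hA.norm_calculus_smoothed_le δ)
    (h.norm_smoothed_sub_comp_cutoff_le hA δ ha)
  have h5 := h.norm_smoothed_sub_comp_cutoff_mul_le hA δ ha (norm_complexify_smoothed_le δ)
  rw [e]
  refine (norm_add₃_le.trans (add_le_add (add_le_add ((norm_sub_le _ _).trans (add_le_add h1 h2)) h3)
    ((norm_add_le _ _).trans (add_le_add h4 h5)))).trans_eq ?_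
  ring

theorem isCompactOperator_smoothed_sq_sub_one (δ : ℝ)
    (hc : ∀ a (ha : 1 ≤ a), IsCompactOperator (hA.calculus (cutoff a (one_pos.trans_le ha)))) :
    IsCompactOperator (hA.calculus (complexify (smoothed δ)) ^ 2 - 1 : H →L[ℂ] H) := by
  refine isCompactOperator_of_approx fun η hη => ?_
  obtain ⟨a, ha, hN⟩ :=
    exists_norm_mul_one_sub_cutoff_le (tendsto_complexify_smoothed_sq_sub_one δ) hη
  refine ⟨hA.calculus (complexify (smoothed δ) ^ 2 - 1) ∘L hA.calculus (cutoff a (one_pos.trans_le ha)),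
    (hc a ha).clm_comp (hA.calculus (complexify (smoothed δ) ^ 2 - 1)), ?_⟩
  refine le_trans (le_of_eq ?_) ((hA.norm_calculus_le _).trans (hN a (one_pos.trans_le ha) le_rfl))
  rw [← ContinuousLinearMap.mul_def, ← map_mul, ← map_one hA.calculus, ← map_pow, ← map_sub,
    ← map_sub, mul_sub, mul_one]

theorem RelBound.isCompactOperator_smoothed_sub (h : RelBound A A' hA' 1 κ) (δ : ℝ)
    (hc : ∀ a (ha : 1 ≤ a), IsCompactOperator (hA'.calculus (cutoff a (one_pos.trans_le ha)))) :
    IsCompactOperator (hA.calculus (complexify (smoothed δ)) -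
      hA'.calculus (complexify (smoothed δ)) : H →L[ℂ] H) := by
  refine isCompactOperator_of_approx fun η hη => ?_
  obtain ⟨a, ha, hN⟩ :=
    exists_norm_sub_comp_one_sub_cutoff_le (tendsto_complexify_smoothed_sub δ) κ hη
  refine ⟨(hA.calculus (complexify (smoothed δ)) - hA'.calculus (complexify (smoothed δ))) ∘L
    hA'.calculus (cutoff a (one_pos.trans_le ha)), (hc a ha).clm_comp
      (hA.calculus (complexify (smoothed δ)) - hA'.calculus (complexify (smoothed δ))), ?_⟩
  refine le_trans (le_of_eq ?_) (hN a (one_pos.trans_le ha) le_rfl hA h le_rfl)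
  congr 1
  exact sub_eq_of_eq_add (comp_eq_add_comp hA' _ _)

theorem RelBound.norm_smoothed_sub_le (h : RelBound A A' hA' 1 κ) (δ : ℝ) :
    ‖hA.calculus (complexify (smoothed δ)) - hA'.calculus (complexify (smoothed δ))‖ ≤ κ := by
  have := h.norm_smoothed_sub_comp_calculus_le hA δ
  rwa [map_one, ContinuousLinearMap.one_def, ContinuousLinearMap.comp_id] at this

theorem RelBound.norm_boundedTransform_sub_le (h : RelBound A A' hA' 1 κ) :
    ‖hA.calculus (complexify boundedTransform) - hA'.calculus (complexify boundedTransform)‖ ≤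
      κ := by
  have := h.norm_boundedTransformShift_sub_comp_calculus_le hA 0
  rwa [map_one, ContinuousLinearMap.one_def, ContinuousLinearMap.comp_id,
    ← complexify_boundedTransform] at this

/-- If `T (1 - θ)(A)` and `θ(A) X` are small, then so is `T X`. -/
theorem norm_comp_le_of_cutoff (hA : IsDiagonal A) {T X : H →L[ℂ] H} {θ : ℝ →ᵇ ℂ} {η c C : ℝ}
    (h1 : ‖T ∘L hA.calculus (1 - θ)‖ ≤ η) (h2 : ‖hA.calculus θ ∘L X‖ ≤ c) (hT : ‖T‖ ≤ C)
    (hX : ‖X‖ ≤ 2) : ‖T ∘L X‖ ≤ 2 * η + C * c := by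
  have e : T ∘L X = (T ∘L hA.calculus (1 - θ)) ∘L X + T ∘L (hA.calculus θ ∘L X) := by
    rw [← ContinuousLinearMap.comp_assoc, ← ContinuousLinearMap.add_comp, ← comp_eq_add_comp]
  rw [e]
  refine (norm_add_le _ _).trans (add_le_add ?_ (norm_comp_le_of_le hT h2))
  rw [mul_comm]
  exact norm_comp_le_of_le h1 hX

/-- The norm estimate behind the equicontinuity of differences: `A₁`, `A₂` and `A₁'`, `A₂'` are
bounded perturbations of each other, and `A₁`, `A₁'` and `A₂`, `A₂'` relatively bounded ones. -/
theorem norm_sub_sub_sub_le {A₁ A₂ A₁' A₂' : H →ₗ.[ℂ] H} (h₁ : IsDiagonal A₁) (h₂ : IsDiagonal A₂)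
    {h₁' : IsDiagonal A₁'} {h₂' : IsDiagonal A₂'} {δ a η κ r : ℝ} (ha : 1 ≤ a)
    (hr₁ : RelBound A₁ A₁' h₁' resolventFun κ) (hr₂ : RelBound A₂ A₂' h₂' resolventFun κ)
    (hb' : RelBound A₁' A₂' h₂' 1 r)
    (hη : ‖(h₁.calculus (complexify (smoothed δ)) - h₂.calculus (complexify (smoothed δ))) ∘L
      h₂.calculus (1 - cutoff a (one_pos.trans_le ha))‖ ≤ η)
    (hη' : ‖(h₁'.calculus (complexify (smoothed δ)) - h₂'.calculus (complexify (smoothed δ))) ∘L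
      h₂'.calculus (1 - cutoff a (one_pos.trans_le ha))‖ ≤ η) :
    ‖(h₁.calculus (complexify (smoothed δ)) - h₂.calculus (complexify (smoothed δ))) -
      (h₁'.calculus (complexify (smoothed δ)) - h₂'.calculus (complexify (smoothed δ)))‖ ≤
      2 * η + 6 * κ + 2 * (κ * a ^ 2) + 2 * (r / a) := by
  set ψ := complexify (smoothed δ)
  set θ := cutoff a (one_pos.trans_le ha)
  -- at high energies of `A₂` and `A₂'` both differences are small; at low energies compare `A₁` with
  -- `A₁'` and `A₂` with `A₂'`, where the cutoff of `A₂'` may be replaced by that of `A₁'`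
  have e : (h₁.calculus ψ - h₂.calculus ψ) - (h₁'.calculus ψ - h₂'.calculus ψ) =
      ((h₁.calculus ψ - h₂.calculus ψ) ∘L h₂.calculus (1 - θ) -
        (h₁'.calculus ψ - h₂'.calculus ψ) ∘L h₂'.calculus (1 - θ)) +
      (h₁.calculus ψ - h₂.calculus ψ) ∘L (h₂.calculus θ - h₂'.calculus θ) +
      (((h₁.calculus ψ - h₁'.calculus ψ) ∘L h₁'.calculus θ -
        (h₂.calculus ψ - h₂'.calculus ψ) ∘L h₂'.calculus θ) -
        (h₁.calculus ψ - h₁'.calculus ψ) ∘L (h₁'.calculus θ - h₂'.calculus θ)) := by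
    simp only [map_sub, map_one, ← ContinuousLinearMap.mul_def]
    noncomm_ring
  have k1 := norm_comp_le_of_le (norm_calculus_smoothed_sub_le h₁ h₂ δ)
    (hr₂.norm_cutoff_sub_le_of_resolventFun h₂ (one_pos.trans_le ha) ha)
  have k2 := hr₁.norm_smoothed_sub_comp_cutoff_le h₁ δ ha
  have k3 := hr₂.norm_smoothed_sub_comp_cutoff_le h₂ δ ha
  have k4 := norm_comp_le_of_le (norm_calculus_smoothed_sub_le h₁ h₁' δ)
    (hb'.norm_cutoff_sub_le h₁' (one_pos.trans_le ha))
  rw [e]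
  refine (norm_add₃_le.trans (add_le_add (add_le_add ((norm_sub_le _ _).trans (add_le_add hη hη'))
    k1) ((norm_sub_le _ _).trans (add_le_add ((norm_sub_le _ _).trans (add_le_add k2 k3))
    k4)))).trans_eq ?_
  ring

end Abstract

/-! ### Dependence on the parameters and decay -/

section Concrete

variable {E : Type*} [NormedAddCommGroup E] [InnerProductSpace ℝ E] [FiniteDimensional ℝ E]
  [MeasurableSpace E] [BorelSpace E]

theorem RelBound.mono {H : Type*} [NormedAddCommGroup H] [InnerProductSpace ℂ H] [CompleteSpace H]
    {A A' : H →ₗ.[ℂ] H} {hA' : IsDiagonal A'} {m : ℝ →ᵇ ℂ} {κ κ' : ℝ}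
    (h : RelBound A A' hA' m κ) (hκ : κ ≤ κ') : RelBound A A' hA' m κ' where
  domain_le := h.domain_le
  nonneg := h.nonneg.trans hκ
  bound u hu v hv := (h.bound u hu v hv).trans (by gcongr)

/-- On `[1, ∞)` the Bott-Dirac operator is Lipschitz in `s` for the graph norm, uniformly in the
base point. -/
theorem relBound_left_of_abs_sub_le {s s' : ℝ} (hs : 1 ≤ s) (hs' : 1 ≤ s') (x : E) {ρ : ℝ}
    (h : |s - s'| ≤ ρ) :
    RelBound (bottDirac s x) (bottDirac s' x) (isDiagonal_bottDirac (one_pos.trans_le hs') x)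
      resolventFun (ρ * (1 + finrank ℝ E)) := by
  refine (relBound_left hs' s x).mono ?_
  rw [← mul_assoc]
  gcongr
  have h0 : 0 < s := one_pos.trans_le hs
  have h0' : 0 < s' := one_pos.trans_le hs'
  have e : s'⁻¹ - s⁻¹ = (s - s') / (s * s') := by field_simp
  rw [e, abs_div, abs_of_pos (mul_pos h0 h0')]
  calc |s - s'| / (s * s') * s' = |s - s'| / s := by field_simp
    _ ≤ |s - s'| := div_le_self (abs_nonneg _) hs
    _ ≤ ρ := h

theorem uniformEquicontinuousOn_of_norm_sub_le {ι F : Type*} [NormedAddCommGroup F]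
    {f : ι → ℝ → F} {K : Set ℝ} (h : ∀ η > 0, ∃ ρ > 0, ∀ s ∈ K, ∀ s' ∈ K, |s - s'| ≤ ρ →
      ∀ i, ‖f i s - f i s'‖ ≤ η) : UniformEquicontinuousOn f K := by
  intro U hU
  obtain ⟨ε, hε, hεU⟩ := Metric.mem_uniformity_dist.1 hU
  obtain ⟨ρ, hρ, hρ'⟩ := h (ε / 2) (half_pos hε)
  rw [eventually_inf_principal]
  filter_upwards [Metric.dist_mem_uniformity hρ] with p hp hpK i
  refine hεU ?_
  rw [dist_eq_norm]
  have hp' : |p.1 - p.2| ≤ ρ := le_of_lt (by simpa [Real.dist_eq] using hp)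
  linarith [hρ' p.1 hpK.1 p.2 hpK.2 hp' i]

/-- A modulus of continuity: with `ρ (1 + d)` as the relative bound, the error terms of
`norm_smoothed_sq_sub_le` and `norm_sub_sub_sub_le` are small for small `ρ`. -/
theorem exists_rate {d a η : ℝ} (hd : 0 ≤ d) (hη : 0 < η) :
    ∃ ρ > 0, 6 * (ρ * (1 + d)) + 2 * (ρ * (1 + d) * a ^ 2) ≤ η := by
  refine ⟨η / ((1 + d) * (6 + 2 * a ^ 2)), by positivity, le_of_eq ?_⟩
  field_simp

theorem uniformEquicontinuousOn_smoothed_sq_sub_one (δ : ℝ) {K : Set ℝ} (hK : K ⊆ Set.Ici 1) :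
    UniformEquicontinuousOn
      (fun (x : E) (s : ℝ) => funCalc (bottDirac s x) (smoothed δ) ^ 2 - 1) K := by
  refine uniformEquicontinuousOn_of_norm_sub_le fun η hη => ?_
  obtain ⟨a, ha, hN⟩ := exists_norm_mul_one_sub_cutoff_le
    (tendsto_complexify_smoothed_sq_sub_one δ) (show 0 < η / 4 by positivity)
  obtain ⟨ρ, hρ, hρη⟩ := exists_rate (d := finrank ℝ E) (a := a) (Nat.cast_nonneg _) (half_pos hη)
  refine ⟨ρ, hρ, fun s hs s' hs' hss x => ?_⟩
  have h0 : 0 < s := one_pos.trans_le (hK hs)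
  have h0' : 0 < s' := one_pos.trans_le (hK hs')
  rw [sub_sub_sub_cancel_right, (isDiagonal_bottDirac h0 x).funCalc_eq_calculus,
    (isDiagonal_bottDirac h0' x).funCalc_eq_calculus]
  refine ((relBound_left_of_abs_sub_le (hK hs) (hK hs') x hss).norm_smoothed_sq_sub_le
    (isDiagonal_bottDirac h0 x) δ ha (hN a _ le_rfl)).trans ?_
  linarith

theorem uniformEquicontinuousOn_smoothed_sub (δ : ℝ) {r : ℝ} {K : Set ℝ}
    (hK : K ⊆ Set.Ici 1) :
    UniformEquicontinuousOn (fun (p : {p : E × E // ‖p.1 - p.2‖ ≤ r}) (s : ℝ) =>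
      funCalc (bottDirac s p.1.1) (smoothed δ) - funCalc (bottDirac s p.1.2) (smoothed δ)) K := by
  refine uniformEquicontinuousOn_of_norm_sub_le fun η hη => ?_
  obtain ⟨N, hN1, hN⟩ := exists_norm_sub_comp_one_sub_cutoff_le
    (tendsto_complexify_smoothed_sub δ) r (show 0 < η / 8 by positivity)
  set a := max N (8 * r / η) with ha'
  have ha : 1 ≤ a := hN1.trans (le_max_left _ _)
  have ha0 := one_pos.trans_le ha
  have hra : 2 * (r / a) ≤ η / 4 := by
    have h1 : 8 * r / η ≤ a := le_max_right _ _
    rw [div_le_iff₀ hη] at h1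
    have : r / a ≤ η / 8 := by rw [div_le_iff₀ ha0]; linarith
    linarith
  obtain ⟨ρ, hρ, hρη⟩ := exists_rate (d := finrank ℝ E) (a := a) (Nat.cast_nonneg _) (half_pos hη)
  refine ⟨ρ, hρ, fun s hs s' hs' hss ⟨⟨x, y⟩, hxy⟩ => ?_⟩
  have h0 : 0 < s := one_pos.trans_le (hK hs)
  have h0' : 0 < s' := one_pos.trans_le (hK hs')
  change ‖x - y‖ ≤ r at hxy
  change ‖funCalc (bottDirac s x) _ - funCalc (bottDirac s y) _ -
    (funCalc (bottDirac s' x) _ - funCalc (bottDirac s' y) _)‖ ≤ η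
  rw [(isDiagonal_bottDirac h0 x).funCalc_eq_calculus,
    (isDiagonal_bottDirac h0' x).funCalc_eq_calculus,
    (isDiagonal_bottDirac h0 y).funCalc_eq_calculus,
    (isDiagonal_bottDirac h0' y).funCalc_eq_calculus]
  refine (norm_sub_sub_sub_le (isDiagonal_bottDirac h0 x) (isDiagonal_bottDirac h0 y) ha
    (relBound_left_of_abs_sub_le (hK hs) (hK hs') x hss)
    (relBound_left_of_abs_sub_le (hK hs) (hK hs') y hss)
    ((relBound_right h0' x y).mono hxy)
    (hN a _ (le_max_left _ _) _ (relBound_right h0 x y) hxy)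
    (hN a _ (le_max_left _ _) _ (relBound_right h0' x y) hxy)).trans ?_
  linarith

/-- Strong continuity in `s`: the vectors of low energy are dense, and on them the relatively small
perturbations are small. -/
theorem continuousOn_funCalc_smoothed (δ : ℝ) (x : E) (u : L2 E) :
    ContinuousOn (fun s : ℝ => funCalc (bottDirac s x) (smoothed δ) u) (Set.Ici 1) := by
  refine Metric.continuousOn_iff.2 fun s' hs' ε hε => ?_
  have hs'1 : 1 ≤ s' := hs'
  have h0' := one_pos.trans_le hs'1
  set hA' := isDiagonal_bottDirac h0' x with hA'_def
  have hpos : ∀ n : ℕ, (1 : ℝ) ≤ (n + 1 : ℕ) := fun n => by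
    push_cast; linarith [n.cast_nonneg (α := ℝ)]
  have hlim := hA'.tendsto_calculus (ψ := 1) (M := 1)
    (ψs := fun n : ℕ => cutoff ((n + 1 : ℕ) : ℝ) (one_pos.trans_le (hpos n)))
    (fun n => norm_cutoff_le _) (fun t => ?_) u
  · rw [map_one, one_apply_eq_self] at hlim
    obtain ⟨n, hn⟩ := ((Metric.tendsto_atTop.1 hlim (ε / 8) (by positivity)).imp fun n h => h n le_rfl)
    set a : ℝ := ((n + 1 : ℕ) : ℝ)
    have ha : 1 ≤ a := hpos n
    rw [dist_comm, dist_eq_norm] at hn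
    set d : ℝ := (finrank ℝ E : ℝ)
    have hd0 : 0 ≤ d := Nat.cast_nonneg _
    set C : ℝ := (1 + d) * a ^ 2 * (‖u‖ + 1) with hC
    have hC0 : 0 < C := by positivity
    refine ⟨ε / 4 / C, by positivity, fun s hs hss => ?_⟩
    have hs1 : 1 ≤ s := hs
    set hA := isDiagonal_bottDirac (one_pos.trans_le hs1) x with hA_def
    rw [Real.dist_eq] at hss
    have hrel := relBound_left_of_abs_sub_le hs1 hs'1 x hss.le
    have k1 := ((hA.calculus (complexify (smoothed δ)) - hA'.calculus (complexify (smoothed δ))) ∘L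
      hA'.calculus (cutoff a (one_pos.trans_le ha))).le_of_opNorm_le
        (hrel.norm_smoothed_sub_comp_cutoff_le hA δ ha) u
    have k2 := (hA.calculus (complexify (smoothed δ)) -
      hA'.calculus (complexify (smoothed δ))).le_of_opNorm_le
        (norm_calculus_smoothed_sub_le hA hA' δ)
        (u - hA'.calculus (cutoff a (one_pos.trans_le ha)) u)
    rw [dist_eq_norm, hA.funCalc_eq_calculus, hA'.funCalc_eq_calculus, ← sub_apply]
    have k3 : ε / 4 / C * (1 + d) * a ^ 2 * ‖u‖ ≤ ε / 4 := by
      calc ε / 4 / C * (1 + d) * a ^ 2 * ‖u‖ = ε / 4 / C * ((1 + d) * a ^ 2 * ‖u‖) := by ring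
        _ ≤ ε / 4 / C * C := by rw [hC]; gcongr; linarith
        _ = ε / 4 := by field_simp
    rw [ContinuousLinearMap.comp_apply] at k1
    rw [map_sub] at k2
    have k4 := norm_le_norm_add_norm_sub'
      ((hA.calculus (complexify (smoothed δ)) - hA'.calculus (complexify (smoothed δ))) u)
      ((hA.calculus (complexify (smoothed δ)) - hA'.calculus (complexify (smoothed δ)))
        (hA'.calculus (cutoff a (one_pos.trans_le ha)) u))
    refine (k4.trans (add_le_add (k1.trans k3) (k2.trans
      (mul_le_mul_of_nonneg_left hn.le zero_le_two)))).trans_lt ?_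
    linarith
  · have h2 : Tendsto (fun n : ℕ => ((n + 1 : ℕ) : ℝ) ^ 2) atTop atTop :=
      (tendsto_pow_atTop two_ne_zero).comp
        (tendsto_natCast_atTop_atTop.comp (tendsto_add_atTop_nat 1))
    have h3 : Tendsto (fun n : ℕ => 1 - t ^ 2 / (((n + 1 : ℕ) : ℝ) ^ 2 + t ^ 2)) atTop (𝓝 (1 - 0)) :=
      (tendsto_const_nhds.div_atTop (h2.atTop_add tendsto_const_nhds)).const_sub 1
    rw [sub_zero] at h3
    refine ((Complex.continuous_ofReal.tendsto 1).comp h3).congr fun n => ?_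
    rw [cutoff_apply, Function.comp_apply]
    congr 1
    have : ((n + 1 : ℕ) : ℝ) ^ 2 + t ^ 2 ≠ 0 := by positivity
    field_simp
    ring

theorem adjoint_funCalc_smoothed {s : ℝ} (hs : 0 < s) (δ : ℝ) (x : E) :
    ContinuousLinearMap.adjoint (funCalc (bottDirac s x) (smoothed δ)) =
      funCalc (bottDirac s x) (smoothed δ) := by
  rw [(isDiagonal_bottDirac hs x).funCalc_eq_calculus, ← ContinuousLinearMap.star_eq_adjoint,
    ← map_star]
  congr 1
  ext t
  exact Complex.conj_ofReal _

theorem norm_one_sub_chiBall_opNorm_le (x : E) (R : ℝ) :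
    ‖(1 - chiBall x R : L2 E →L[ℂ] L2 E)‖ ≤ 2 := by
  have h1 : ‖chiBall x R‖ ≤ 1 := ContinuousLinearMap.opNorm_le_bound _ zero_le_one fun u => by
    rw [one_mul]
    refine Lp.norm_le_norm_of_ae_le ?_
    filter_upwards [chi_ae (measurableSet_ball (x := x) (ε := R)) u] with y hy
    rw [chiBall, hy]
    exact norm_indicator_le_norm_self _ _
  have h2 : ‖(1 : L2 E →L[ℂ] L2 E)‖ ≤ 1 := ContinuousLinearMap.norm_id_le
  exact (norm_sub_le _ _).trans (by linarith)

/-- The choice of the radius for a cutoff at `a`. -/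
theorem two_mul_add_lt {a R ε : ℝ} (hε : 0 < ε) (ha : 1 ≤ a) (hR : 16 * a ^ 2 / ε ≤ R) :
    2 * (ε / 8) + 2 * (a ^ 2 * R⁻¹) < ε := by
  have h0 : 0 < 16 * a ^ 2 / ε := by positivity
  have h1 : 0 < R := h0.trans_le hR
  have h2 : a ^ 2 * R⁻¹ ≤ ε / 16 := by
    rw [div_le_iff₀ hε] at hR
    rw [← div_eq_mul_inv, div_le_iff₀ h1]
    linarith
  linarith

/-- The radius depends only on the rate at which `ψ² - 1` vanishes at infinity: by
`norm_calculus_cutoff_comp_le` it does not depend on the dimension. -/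
theorem exists_norm_smoothed_sq_sub_one_comp_lt (δ : ℝ) {ε : ℝ} (hε : 0 < ε) :
    ∃ R₁ > 0, ∀ (E : Type*) [NormedAddCommGroup E] [InnerProductSpace ℝ E] [FiniteDimensional ℝ E]
      [MeasurableSpace E] [BorelSpace E], ∀ R ≥ R₁, ∀ s ≥ 1, 2 * (finrank ℝ E : ℝ) ≤ s →
      ∀ x : E, ‖(funCalc (bottDirac s x) (smoothed δ) ^ 2 - 1) ∘L (1 - chiBall x R)‖ < ε := by
  obtain ⟨a, ha, hN⟩ := exists_norm_mul_one_sub_cutoff_le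
    (tendsto_complexify_smoothed_sq_sub_one δ) (show 0 < ε / 8 by positivity)
  refine ⟨16 * a ^ 2 / ε, by positivity, fun E _ _ _ _ _ R hR s hs hsd x => ?_⟩
  have hR0 : 0 < R := lt_of_lt_of_le (by positivity) hR
  set hA := isDiagonal_bottDirac (one_pos.trans_le hs) x
  have e : funCalc (bottDirac s x) (smoothed δ) ^ 2 - 1 =
      hA.calculus (complexify (smoothed δ) ^ 2 - 1) := by
    rw [hA.funCalc_eq_calculus, map_sub, map_pow, map_one]
  rw [e]
  refine (norm_comp_le_of_cutoff hA (θ := cutoff a (one_pos.trans_le ha)) ?_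
    (norm_calculus_cutoff_comp_le hs hsd x hR0 ha) ((hA.norm_calculus_le _).trans
    (norm_complexify_smoothed_sq_sub_one_le δ)) (norm_one_sub_chiBall_opNorm_le x R)).trans_lt
    (two_mul_add_lt hε ha hR)
  rw [← ContinuousLinearMap.mul_def, ← map_mul]
  exact (hA.norm_calculus_le _).trans (hN a _ le_rfl)

theorem exists_norm_smoothed_sub_comp_lt (δ : ℝ) {ε : ℝ} (hε : 0 < ε) (r : ℝ) :
    ∃ R₂ > 0, ∀ (E : Type*) [NormedAddCommGroup E] [InnerProductSpace ℝ E] [FiniteDimensional ℝ E]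
      [MeasurableSpace E] [BorelSpace E], ∀ R ≥ R₂, ∀ s ≥ 1, 2 * (finrank ℝ E : ℝ) ≤ s →
      ∀ x y : E, ‖x - y‖ ≤ r →
      ‖(funCalc (bottDirac s x) (smoothed δ) - funCalc (bottDirac s y) (smoothed δ)) ∘L
        (1 - chiBall x R)‖ < ε := by
  obtain ⟨a, ha, hN⟩ := exists_norm_sub_comp_one_sub_cutoff_le
    (tendsto_complexify_smoothed_sub δ) r (show 0 < ε / 8 by positivity)
  refine ⟨16 * a ^ 2 / ε, by positivity, fun E _ _ _ _ _ R hR s hs hsd x y hxy => ?_⟩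
  have hR0 : 0 < R := lt_of_lt_of_le (by positivity) hR
  have h0 := one_pos.trans_le hs
  rw [(isDiagonal_bottDirac h0 x).funCalc_eq_calculus,
    (isDiagonal_bottDirac h0 y).funCalc_eq_calculus]
  refine (norm_comp_le_of_cutoff (isDiagonal_bottDirac h0 x) ?_
    (norm_calculus_cutoff_comp_le hs hsd x hR0 ha) (norm_calculus_smoothed_sub_le _ _ δ)
    (norm_one_sub_chiBall_opNorm_le x R)).trans_lt (two_mul_add_lt hε ha hR)
  rw [norm_sub_rev] at hxy
  have h := hN a (one_pos.trans_le ha) le_rfl (isDiagonal_bottDirac h0 y) (relBound_right h0 y x) hxy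
  rwa [← neg_sub, ContinuousLinearMap.neg_comp, norm_neg]

end Concrete

end BottDirac

end

theorem proposition5p1 (ε : ℝ) (hε : 0 < ε) :
    ∃ (Ψ : ℝ →ᵇ ℝ) (R₀ c : ℝ) (R₁ : ℝ → ℝ) (R₂ : ℝ → ℝ → ℝ),
      (∀ t, Ψ (-t) = -Ψ t) ∧ (∀ t, Ψ t ∈ Set.Icc (-1 : ℝ) 1) ∧ Tendsto Ψ atTop (𝓝 1) ∧
      0 < R₀ ∧ 0 < c ∧ (∀ ε₁ > 0, 0 < R₁ ε₁) ∧ (∀ ε₂ > 0, ∀ r > 0, 0 < R₂ ε₂ r) ∧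
      ∀ (E : Type*) [NormedAddCommGroup E] [InnerProductSpace ℝ E] [FiniteDimensional ℝ E]
        [MeasurableSpace E] [BorelSpace E], Even (Module.finrank ℝ E) →
        -- the functional calculus of each `B_{s,x}` is well defined
        -- (equivalently, `B_{s,x}` is essentially self-adjoint)
        (∀ s ≥ 1, ∀ x : E, ∃! Φ : (ℝ →ᵇ ℂ) →⋆ₐ[ℂ] (L2 E →L[ℂ] L2 E),
          IsFunctionalCalculus (bottDirac s x) Φ) ∧
        -- `Ψ(B_{s,x})` approximates `F_{s,x}`
        (∀ s ≥ 1, ∀ x : E, ‖boundedBottDirac s x - funCalc (bottDirac s x) Ψ‖ < ε) ∧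
        -- small propagation
        (∀ s ≥ 1, ∀ x : E,
          propagation (funCalc (bottDirac s x) Ψ) ≤ ENNReal.ofReal (s⁻¹ * R₀)) ∧
        -- compactness of `Ψ(B_{s,x})² - 1`
        (∀ s ≥ 1, ∀ x : E,
          IsCompactOperator (funCalc (bottDirac s x) Ψ ^ 2 - 1 : L2 E →L[ℂ] L2 E)) ∧
        -- compactness of differences
        (∀ s ≥ 1, ∀ x y : E,
          IsCompactOperator
            (funCalc (bottDirac s x) Ψ - funCalc (bottDirac s y) Ψ : L2 E →L[ℂ] L2 E)) ∧
        -- Lipschitz dependence on the base point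
        (∀ s ≥ 1, ∀ x y : E, ‖boundedBottDirac s x - boundedBottDirac s y‖ ≤ 3 * ‖x - y‖) ∧
        (∀ s ≥ 1, ∀ x y : E,
          ‖funCalc (bottDirac s x) Ψ - funCalc (bottDirac s y) Ψ‖ ≤ c * ‖x - y‖) ∧
        -- strong-* continuity in `s`
        (∀ (x : E) (u : L2 E),
          ContinuousOn (fun s : ℝ => funCalc (bottDirac s x) Ψ u) (Set.Ici 1) ∧
          ContinuousOn (fun s : ℝ => ContinuousLinearMap.adjoint (funCalc (bottDirac s x) Ψ) u)
            (Set.Ici 1)) ∧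
        -- norm equi-continuity of `Ψ(B_{s,x})² - 1`
        (∀ K ⊆ Set.Ici (1 : ℝ), IsCompact K →
          UniformEquicontinuousOn (fun (x : E) (s : ℝ) => funCalc (bottDirac s x) Ψ ^ 2 - 1) K) ∧
        -- norm equi-continuity of differences
        (∀ r ≥ 0, ∀ K ⊆ Set.Ici (1 : ℝ), IsCompact K →
          UniformEquicontinuousOn (fun (p : {p : E × E // ‖p.1 - p.2‖ ≤ r}) (s : ℝ) =>
            funCalc (bottDirac s p.1.1) Ψ - funCalc (bottDirac s p.1.2) Ψ) K) ∧
        -- decay of `Ψ(B_{s,x})² - 1` away from `x`, uniformly in `s`, `x` and `E`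
        (∀ ε₁ > 0, ∀ R ≥ R₁ ε₁, ∀ s ≥ 1, 2 * (Module.finrank ℝ E : ℝ) ≤ s → ∀ x : E,
          ‖(funCalc (bottDirac s x) Ψ ^ 2 - 1) ∘L (1 - chiBall x R)‖ < ε₁) ∧
        -- decay of differences away from `x`, uniformly in `s`, `x`, `y` and `E`
        (∀ ε₂ > 0, ∀ r > 0, ∀ R ≥ R₂ ε₂ r, ∀ s ≥ 1, 2 * (Module.finrank ℝ E : ℝ) ≤ s →
          ∀ x y : E, ‖x - y‖ ≤ r →
          ‖(funCalc (bottDirac s x) Ψ - funCalc (bottDirac s y) Ψ) ∘L (1 - chiBall x R)‖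
            < ε₂) := by
  obtain ⟨δ, hδ, hδε⟩ := exists_abs_boundedTransform_sub_smoothed_le (half_pos hε)
  choose! R₁ hR₁ hR₁' using fun (ε₁ : ℝ) (hε₁ : 0 < ε₁) =>
    exists_norm_smoothed_sq_sub_one_comp_lt δ hε₁
  choose! R₂ hR₂ hR₂' using fun (ε₂ : ℝ) (hε₂ : 0 < ε₂) => exists_norm_smoothed_sub_comp_lt δ hε₂
  refine ⟨smoothed δ, 2 / δ, 1, R₁, R₂, smoothed_neg δ, smoothed_mem_Icc δ,
    tendsto_smoothed_atTop δ, by positivity, one_pos, hR₁, fun ε₂ h r _ => hR₂ ε₂ h r, ?_⟩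
  intro E _ _ _ _ _ _
  have hB : ∀ s ≥ 1, ∀ x : E, IsDiagonal (bottDirac s x) := fun s hs x =>
    isDiagonal_bottDirac (one_pos.trans_le hs) x
  refine ⟨fun s hs x => (hB s hs x).existsUnique_isFunctionalCalculus, fun s hs x => ?_,
    fun s hs x => ?_, fun s hs x => ?_, fun s hs x y => ?_, fun s hs x y => ?_, fun s hs x y => ?_,
    fun x u => ⟨continuousOn_funCalc_smoothed δ x u, ?_⟩,
    fun K hK _ => uniformEquicontinuousOn_smoothed_sq_sub_one δ hK,
    fun r _ K hK _ => uniformEquicontinuousOn_smoothed_sub δ hK,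
    fun ε₁ h R hR s hs hsd x => ?_, fun ε₂ h r hr R hR s hs hsd x y hxy => ?_⟩
  · rw [boundedBottDirac, (hB s hs x).funCalc_eq_calculus, (hB s hs x).funCalc_eq_calculus,
      ← map_sub]
    refine (((hB s hs x).norm_calculus_le _).trans
      ((BoundedContinuousFunction.norm_le (half_pos hε).le).2 fun t => ?_)).trans_lt (half_lt_self hε)
    rw [BoundedContinuousFunction.sub_apply, complexify_apply, complexify_apply,
      ← Complex.ofReal_sub, Complex.norm_real]
    exact hδε t
  · rw [(hB s hs x).funCalc_eq_calculus]
    exact propagation_calculus_smoothed_le (one_pos.trans_le hs) x hδ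
  · rw [(hB s hs x).funCalc_eq_calculus]
    exact isCompactOperator_smoothed_sq_sub_one _ δ fun a ha =>
      isCompactOperator_calculus_cutoff (one_pos.trans_le hs) x ha
  · rw [(hB s hs x).funCalc_eq_calculus, (hB s hs y).funCalc_eq_calculus]
    exact (relBound_right (one_pos.trans_le hs) x y).isCompactOperator_smoothed_sub _ δ fun a ha =>
      isCompactOperator_calculus_cutoff (one_pos.trans_le hs) y ha
  · rw [boundedBottDirac, boundedBottDirac, (hB s hs x).funCalc_eq_calculus,
      (hB s hs y).funCalc_eq_calculus]
    refine ((relBound_right (one_pos.trans_le hs) x y).norm_boundedTransform_sub_le _).trans ?_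
    linarith [norm_nonneg (x - y)]
  · rw [one_mul, (hB s hs x).funCalc_eq_calculus, (hB s hs y).funCalc_eq_calculus]
    exact (relBound_right (one_pos.trans_le hs) x y).norm_smoothed_sub_le _ δ
  · refine (continuousOn_funCalc_smoothed δ x u).congr fun s hs => ?_
    rw [adjoint_funCalc_smoothed (one_pos.trans_le hs)]
  · exact hR₁' ε₁ h E R hR s hs hsd x
  · exact hR₂' ε₂ h r E R hR s hs hsd x y hxy
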